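/- **Setting.** Let $\mathcal X\subset\mathbb R^{d_x}$, $\mathcal Y\subset\mathbb R^{d_y}$ be convex compact sets, $\mathcal Z=\mathcal X\times\mathcal Y\subset\mathbb R^d$, $d=d_x+d_y$, where $\mathcal Z$ has more than one point. Let $p,q\in[1,\infty]$ with $1/p+1/q=1$, and let $\omega$ be a prox-function on $\mathcal Z$: $\omega$ is differentiable on $\mathcal Z$, its Bregman divergence $V_z(v)=\omega(v)-\omega(z)-\langle\nabla\omega(z),v-z\rangle$ satisfies $V_z(v)\ge\frac12\|z-v\|_p^2$ for $z,v\in\mathcal Z$, and $\mathcal D=\sup_{z,v\in\mathcal Z}\sqrt{2V_z(v)}<\infty$. For $\tau>0$ let $\mathcal Z_\tau=\{z:\exists w\in\mathcal Z,\ \|z-w\|_2\le\tau\}$. Let $f(z,\xi)$ be such that for all $\xi$ and all $z_1,z_2\in\mathcal Z_\tau$, $|f(z_1,\xi)-f(z_2,\xi)|\le M_2(\xi)\|z_1-z_2\|_2$ with $\mathbb E M_2(\xi)^2\le M_2^2$, $M_2>0$, and such that $f(x,y)=\mathbb E_\xi f(x,y,\xi)$ is finite, convex in $x$ and concave in $y$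 on $\mathcal Z_\tau$. Let $(x_*,y_*)$ be a saddle point of $f$ on $\mathcal X\times\mathcal Y$. The oracle returns $\varphi(z,\xi)=f(z,\xi)+\delta(z)$. **Algorithm.** Let $z^1=\arg\min_{\mathcal Z}\omega$. For $k=1,\dots,N$ sample, independently, $\xi^k$ and $\boldsymbol e^k=(\boldsymbol e_x^k,\boldsymbol e_y^k)$ uniform on the Euclidean unit sphere of $\mathbb R^d$, and put $$g^k=\tfrac{d}{2\tau}\bigl(\varphi(z^k+\tau\boldsymbol e^k,\xi^k)-\varphi(z^k-\tau\boldsymbol e^k,\xi^k)\bigr)\begin{pmatrix}\boldsymbol e_x^k\\-\boldsymbol e_y^k\end{pmatrix},\qquad z^{k+1}=\arg\min_{v\in\mathcal Z}\bigl(V_{z^k}(v)+\langle\gamma_kg^k,v\rangle\bigr).$$ The output is $\hat z^N=(\hat x^N,\hat y^N)=\bigl(\sum_{k=1}^N\gamma_k\bigr)^{-1}\sum_{k=1}^N\gamma_kz^k$, and $\hat\epsilon_{\rm sad}=f(\hat x^N,y_*)-f(x_*,\hat y^N)$. Let $a_q^2=\sqrt{\mathbb E\|\boldsymbol e\|_q^4}$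 with $\boldsymbol e$ uniform on the sphere. The learning rate is $\gamma_k=\frac{\mathcal D}{M_{\rm case}}\sqrt{2/N}$, where, with a numerical constant $c>0$, $M_{\rm case1}^2=c\,d a_q^2M_2^2+d^2a_q^2\Delta^2\tau^{-2}$ for bounded noise and $M_{\rm case2}^2=c\,d a_q^2(M_2^2+M_{2,\delta}^2)$ for Lipschitz noise. **Statement.** For all constants $c>0$ and $0<b\le a<\frac12$ there are $\kappa,C>0$, depending only on $a,b,c$, such that for all data as above, every $\epsilon>0$, every $\tau\in(0,a\,\epsilon/M_2]$ and every integer $N\ge1$ with $$N\ \ge\ C\,\frac{d\,a_q^2M_2^2\mathcal D^2}{\epsilon^2}$$ one has $\mathbb E[\hat\epsilon_{\rm sad}]\le\epsilon$ for the output after $N$ iterations, in each of the two cases: 1. (bounded noise) $p\le2$, $\tau\ge b\,\epsilon/M_2$, $|\delta|\le\Delta$ on $\mathcal Z_\tau$, and $\Delta\le\kappa\,\dfrac{\epsilon^2}{\mathcal DM_2\sqrt d}$; 2. (Lipschitz noise) $|\delta(z_1)-\delta(z_2)|\le M_{2,\delta}\|z_1-z_2\|_2$ on $\mathcal Z_\tau$,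 and $M_{2,\delta}\le\kappa\,\dfrac{\epsilon}{\mathcal D\sqrt d}$. Moreover $a_q^2\le K\min\{q,\log d\}\,d^{2/q-1}$ for all $d\ge2$ and $q\in[1,\infty]$, with an absolute constant $K$. -/

import Mathlib

open MeasureTheory ProbabilityTheory
open scoped ENNReal

noncomputable section

namespace ZOSaddle

/-- The space `ℝ^m × ℝ^n` of dimension `d = m + n`, with the Euclidean (`ℓ₂`) norm. -/
abbrev Joint (m n : ℕ) : Type := EuclideanSpace ℝ (Fin m ⊕ Fin n)

section

variable {m n : ℕ}

/-- The point `z = (x, y)`. -/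
def joint (x : EuclideanSpace ℝ (Fin m)) (y : EuclideanSpace ℝ (Fin n)) : Joint m n :=
  WithLp.toLp 2 (Sum.elim (fun i => x i) (fun j => y j))

/-- The block `x` of `z = (x, y)`. -/
def xPart (z : Joint m n) : EuclideanSpace ℝ (Fin m) := WithLp.toLp 2 (fun i => z (Sum.inl i))

/-- The block `y` of `z = (x, y)`. -/
def yPart (z : Joint m n) : EuclideanSpace ℝ (Fin n) := WithLp.toLp 2 (fun j => z (Sum.inr j))

/-- The map `(e_x, e_y) ↦ (e_x, -e_y)`. -/
def flipY (e : Joint m n) : Joint m n := joint (xPart e) (-yPart e)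

/-- The feasible set `Z = X × Y`. -/
def feasible (X : Set (EuclideanSpace ℝ (Fin m))) (Y : Set (EuclideanSpace ℝ (Fin n))) :
    Set (Joint m n) :=
  {z | xPart z ∈ X ∧ yPart z ∈ Y}

/-- The closed Euclidean `τ`-neighbourhood `Z + τ B₂` of `Z`, which contains all query points. -/
def nbhd (Z : Set (Joint m n)) (τ : ℝ) : Set (Joint m n) :=
  {z | ∃ w ∈ Z, ‖z - w‖ ≤ τ}

/-- The `ℓ_p`-norm of a vector of `ℝ^m × ℝ^n`, `1 ≤ p ≤ ∞`. -/
def ellNorm (p : ℝ≥0∞) (v : Joint m n) : ℝ :=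
  ‖(WithLp.toLp p (fun i => v i) : PiLp p (fun _ : Fin m ⊕ Fin n => ℝ))‖

/-! ### Proximal setup -/

/-- The Bregman divergence `V_z(v) = ω(v) - ω(z) - ⟨∇ω(z), v - z⟩`, for `z, v ∈ Z`. The gradient is
taken within `Z`; for convex `Z` the value does not depend on the choice of this gradient. -/
def bregman (Z : Set (Joint m n)) (ω : Joint m n → ℝ) (z v : Joint m n) : ℝ :=
  ω v - ω z - inner ℝ (gradientWithin ω Z z) (v - z)

/-- `ω` is a prox-function on `Z` compatible with the `ℓ_p`-norm: it is differentiable on `Z`,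
`V_z(v) ≥ ‖z - v‖_p² / 2` on `Z`, and the `ω`-diameter of `Z` is finite. -/
structure IsProxFunction (p : ℝ≥0∞) (Z : Set (Joint m n)) (ω : Joint m n → ℝ) : Prop where
  differentiableOn : DifferentiableOn ℝ ω Z
  lower_bound : ∀ z ∈ Z, ∀ v ∈ Z, ellNorm p (z - v) ^ 2 / 2 ≤ bregman Z ω z v
  bddAbove : BddAbove {r : ℝ | ∃ z ∈ Z, ∃ v ∈ Z, r = √(2 * bregman Z ω z v)}

/-- The `ω`-diameter `𝒟 = max_{z, v ∈ Z} √(2 V_z(v))` of `Z`. -/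
def omegaDiam (Z : Set (Joint m n)) (ω : Joint m n → ℝ) : ℝ :=
  sSup {r : ℝ | ∃ z ∈ Z, ∃ v ∈ Z, r = √(2 * bregman Z ω z v)}

/-- A minimizer of `h` over `Z` (an arbitrary point if there is none). -/
def argminOn (Z : Set (Joint m n)) (h : Joint m n → ℝ) : Joint m n :=
  Classical.epsilon (fun v => v ∈ Z ∧ IsMinOn h Z v)

/-- The prox-operator `Prox_z(g) = argmin_{v ∈ Z} (V_z(v) + ⟨g, v⟩)`. -/
def prox (Z : Set (Joint m n)) (ω : Joint m n → ℝ) (z g : Joint m n) : Joint m n :=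
  argminOn Z (fun v => bregman Z ω z v + inner ℝ g v)

/-! ### The random direction -/

/-- The uniform distribution on the Euclidean unit sphere `{e : ‖e‖₂ = 1}`. -/
def sphereUniform (m n : ℕ) : Measure (Joint m n) :=
  (((volume : Measure (Joint m n)).toSphere Set.univ)⁻¹ •
    (volume : Measure (Joint m n)).toSphere).map Subtype.val

/-- `a_q² = √(𝔼 ‖e‖_q⁴)` for `e` uniform on the Euclidean unit sphere. -/
def aSq (m n : ℕ) (q : ℝ≥0∞) : ℝ :=
  √(∫ e, ellNorm q e ^ 4 ∂(sphereUniform m n))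

/-! ### The zeroth-order stochastic mirror descent -/

variable {Ξ : Type*}

/-- The noisy oracle `φ(z, ξ) = f(z, ξ) + δ(z)`. -/
def noisyOracle (f : Joint m n → Ξ → ℝ) (δ : Joint m n → ℝ) (z : Joint m n) (ξ : Ξ) : ℝ :=
  f z ξ + δ z

/-- `g(z, ξ, e) = d / (2 τ) · (φ(z + τ e, ξ) - φ(z - τ e, ξ)) · (e_x, -e_y)`, with `d = m + n`. -/
def gradEst (φ : Joint m n → Ξ → ℝ) (τ : ℝ) (z : Joint m n) (ξ : Ξ) (e : Joint m n) :
    Joint m n :=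
  (((m + n : ℕ) : ℝ) / (2 * τ) * (φ (z + τ • e) ξ - φ (z - τ • e) ξ)) • flipY e

/-- The iterates: the start is `argmin_{z ∈ Z} ω(z)`, and
`z^{k+1} = Prox_{z^k}(γ_k g(z^k, ξ^k, e^k))`. The index starts at `0`. -/
def iterate (Z : Set (Joint m n)) (ω : Joint m n → ℝ) (φ : Joint m n → Ξ → ℝ) (τ : ℝ)
    (γ : ℕ → ℝ) (e : ℕ → Joint m n) (ξ : ℕ → Ξ) : ℕ → Joint m n
  | 0 => argminOn Z ω
  | k + 1 =>
      prox Z ω (iterate Z ω φ τ γ e ξ k)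
        (γ k • gradEst φ τ (iterate Z ω φ τ γ e ξ k) (ξ k) (e k))

/-- The output `(∑ γ_k)⁻¹ ∑ γ_k z^k` after `N` iterations. -/
def output (Z : Set (Joint m n)) (ω : Joint m n → ℝ) (φ : Joint m n → Ξ → ℝ) (τ : ℝ)
    (γ : ℕ → ℝ) (N : ℕ) (e : ℕ → Joint m n) (ξ : ℕ → Ξ) : Joint m n :=
  (∑ k ∈ Finset.range N, γ k)⁻¹ •
    ∑ k ∈ Finset.range N, γ k • iterate Z ω φ τ γ e ξ k

/-- The constant learning rate `γ_k = (𝒟 / M_case) √(2 / N)`. -/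
def stepSize (D Mcase : ℝ) (N : ℕ) : ℕ → ℝ := fun _ => D / Mcase * √(2 / (N : ℝ))

/-- `M_case1`, where `M_case1² = c d a_q² M₂² + d² a_q² Δ² τ⁻²`. -/
def MBounded (m n : ℕ) (q : ℝ≥0∞) (c M Δ τ : ℝ) : ℝ :=
  √(c * ((m + n : ℕ) : ℝ) * aSq m n q * M ^ 2 +
    ((m + n : ℕ) : ℝ) ^ 2 * aSq m n q * Δ ^ 2 / τ ^ 2)

/-- `M_case2`, where `M_case2² = c d a_q² (M₂² + M_{2,δ}²)`. -/
def MLipschitz (m n : ℕ) (q : ℝ≥0∞) (c M Mδ : ℝ) : ℝ :=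
  √(c * ((m + n : ℕ) : ℝ) * aSq m n q * (M ^ 2 + Mδ ^ 2))

/-! ### The problem and the assumptions -/

/-- `f(z) = 𝔼_ξ f(z, ξ)`. -/
def meanObj [MeasurableSpace Ξ] (μ : Measure Ξ) (f : Joint m n → Ξ → ℝ) (z : Joint m n) : ℝ :=
  ∫ ξ, f z ξ ∂μ

/-- `f(·, ξ)` is `M₂(ξ)`-Lipschitz on `S` in the `ℓ₂`-norm for all `ξ`, and `𝔼 M₂(ξ)² ≤ M₂²`. -/
def LipschitzObjective [MeasurableSpace Ξ] (μ : Measure Ξ) (S : Set (Joint m n))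
    (f : Joint m n → Ξ → ℝ) (M : ℝ) : Prop :=
  ∃ L : Ξ → ℝ, MemLp L 2 μ ∧ ∫ ξ, L ξ ^ 2 ∂μ ≤ M ^ 2 ∧
    ∀ ξ, ∀ z₁ ∈ S, ∀ z₂ ∈ S, |f z₁ ξ - f z₂ ξ| ≤ L ξ * ‖z₁ - z₂‖

/-- `F` is convex in `x` and concave in `y` on `S`. -/
def ConvexConcaveOn (S : Set (Joint m n)) (F : Joint m n → ℝ) : Prop :=
  (∀ y, ConvexOn ℝ {x | joint x y ∈ S} (fun x => F (joint x y))) ∧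
    ∀ x, ConcaveOn ℝ {y | joint x y ∈ S} (fun y => F (joint x y))

/-- The noise is bounded by `Δ` on `S`. -/
def BoundedNoise (S : Set (Joint m n)) (δ : Joint m n → ℝ) (Δ : ℝ) : Prop :=
  ∀ z ∈ S, |δ z| ≤ Δ

/-- The noise is `M_{2,δ}`-Lipschitz on `S` in the `ℓ₂`-norm. -/
def LipschitzNoise (S : Set (Joint m n)) (δ : Joint m n → ℝ) (Mδ : ℝ) : Prop :=
  ∀ z₁ ∈ S, ∀ z₂ ∈ S, |δ z₁ - δ z₂| ≤ Mδ * ‖z₁ - z₂‖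

/-- `(x_*, y_*)` is a solution (saddle point) of `min_{x ∈ X} max_{y ∈ Y} F(x, y)`. -/
def IsSaddlePoint (X : Set (EuclideanSpace ℝ (Fin m))) (Y : Set (EuclideanSpace ℝ (Fin n)))
    (F : Joint m n → ℝ) (xs : EuclideanSpace ℝ (Fin m)) (ys : EuclideanSpace ℝ (Fin n)) : Prop :=
  xs ∈ X ∧ ys ∈ Y ∧ (∀ y ∈ Y, F (joint xs y) ≤ F (joint xs ys)) ∧
    ∀ x ∈ X, F (joint xs ys) ≤ F (joint x ys)

/-- `ε̂_sad(ẑ) = F(x̂, y_*) - F(x_*, ŷ)`. -/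
def saddleGap (F : Joint m n → ℝ) (xs : EuclideanSpace ℝ (Fin m))
    (ys : EuclideanSpace ℝ (Fin n)) (z : Joint m n) : ℝ :=
  F (joint (xPart z) ys) - F (joint xs (yPart z))

/-- The samples `(e^k, ξ^k)`, `k = 0, 1, …`, are independent, and in each of them `e^k` is uniform
on the Euclidean unit sphere and independent of `ξ^k`, which has the law `μ`. -/
structure IsSampling {Ω : Type*} [MeasurableSpace Ω] [MeasurableSpace Ξ] (P : Measure Ω)
    (μ : Measure Ξ) (e : ℕ → Ω → Joint m n) (ξ : ℕ → Ω → Ξ) : Prop where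
  measurable_e : ∀ k, Measurable (e k)
  measurable_ξ : ∀ k, Measurable (ξ k)
  indep : iIndepFun (fun k s => (e k s, ξ k s)) P
  law : ∀ k, P.map (fun s => (e k s, ξ k s)) = (sphereUniform m n).prod μ

/-- `𝔼 ε̂_sad(ẑ^N) ≤ ε` for the output `ẑ^N` of the method (the expectation being finite). -/
def ReachesAccuracy {Ω : Type*} [MeasurableSpace Ω] (P : Measure Ω) (F : Joint m n → ℝ)
    (xs : EuclideanSpace ℝ (Fin m)) (ys : EuclideanSpace ℝ (Fin n)) (ε : ℝ)
    (zhat : Ω → Joint m n) : Prop :=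
  Integrable (fun s => saddleGap F xs ys (zhat s)) P ∧
    ∫ s, saddleGap F xs ys (zhat s) ∂P ≤ ε

end

end ZOSaddle

end

open ZOSaddle

/-! The method is stochastic mirror descent, with an inequality for the two-point estimator in place
of an unbiased gradient. Put `u = z - (x_*, y_*)` and take a point `a = z + τ v` with `‖v‖ ≤ 1`.
Move from `a` a fraction `t` of the way along `y_* - y` in the second block only, and separately
along `x_* - x` in the first block only. Concavity in `y` and convexity in `x` bound the difference
of the two values from below by `t (F(b₂) - F(b₁))`, where `b₂ = (x, y_*) + τ v` and `b₁ = (x_*, y)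
+ τ v`. By the Lipschitz property this is at least `t (gap(z) - 2 τ M₂)`, uniformly over the ball of
radius `τ` around `z`. The divergence theorem turns the average of such difference quotients over
the ball into a surface integral, which is exactly `𝔼⟨g, u⟩`; hence `𝔼⟨g, u⟩ ≥ gap(z) - 2 τ M₂`.
`le_finrank_mul_integral_sphere` is this form of the divergence theorem; it needs no
differentiability of `F` and no joint convexity. Used with only a Lipschitz bound, it also shows
that Lipschitz noise has a bias without a dimension factor (`neg_mul_norm_le_twoPoint`). Bounded
noise is controlled by `𝔼|⟨e, u⟩| ≤ ‖u‖ / √d`.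

The bound of order `d a_q² M₂²` for `𝔼‖g‖_q²` rests on concentration. Cauchy-Schwarz separates
`‖e‖_q²`, which gives `a_q²`, from the squared difference at antipodal points, and
`integral_unitSphereMeasure_sub_neg_pow_four_le` bounds the fourth moment of that difference by a
constant times `L⁴ / d²`. The proof is Gaussian: the odd part is extended homogeneously to the whole
space, and `x` is rotated into `-x` through an independent copy `y`. Each small rotation has the
same law, and in the limit only the fourth moment of the Gaussian variable `DH(x) y` remains.

The regret bound `sum_inner_gradEst_le`, independence of each iterate from the next sample, and
Jensen's inequality give `integral_saddleGap_output_le`: optimization error plus bias. The accuracy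
`ε` is split into at most `2 a ε` for smoothing, `η ε` for the bias of the noise and `η ε` for
optimization, with `2 a + 2 η ≤ 1`. The noise also enters `M_case`, while the bound on `N` contains
`M₂` only. This is settled by a dichotomy: either the feasible set is so small that every feasible
point is `ε`-accurate, or `ε` is at most a multiple of the diameter times `M₂`, and then the noise
term of `M_case²` is a multiple of the main one.

The estimate of `a_q²` compares the `ℓ_q`-norm with the `ℓ_{2k}`-norm for `k` of order `min(q, log
d)` and uses moments of the coordinates of a random unit vector. -/

noncomputable section

set_option linter.unusedSectionVars false

/-! ### The uniform measure on the sphere and its moments, through Gaussian vectors. -/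

section SphereMeasure

variable {E : Type*} [NormedAddCommGroup E] [InnerProductSpace ℝ E] [FiniteDimensional ℝ E]
  [MeasurableSpace E] [BorelSpace E]

/-- The normalized surface measure of the unit sphere, as a measure on the ambient space. -/
def unitSphereMeasure (E : Type*) [NormedAddCommGroup E] [InnerProductSpace ℝ E]
    [FiniteDimensional ℝ E] [MeasurableSpace E] [BorelSpace E] : Measure E :=
  (((volume : Measure E).toSphere Set.univ)⁻¹ • (volume : Measure E).toSphere).map Subtype.val

theorem sphereUniform_eq (m n : ℕ) : sphereUniform m n = unitSphereMeasure (Joint m n) := rfl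

theorem integral_unitSphereMeasure (A : E → ℝ) :
    ∫ e, A e ∂unitSphereMeasure E =
      ((volume : Measure E).toSphere.real Set.univ)⁻¹ *
        ∫ e : Metric.sphere (0 : E) 1, A e ∂(volume : Measure E).toSphere := by
  have : MeasurableEmbedding (Subtype.val : Metric.sphere (0 : E) 1 → E) :=
    MeasurableEmbedding.subtype_coe Metric.isClosed_sphere.measurableSet
  rw [unitSphereMeasure, this.integral_map, integral_smul_measure]
  simp [measureReal_def, ENNReal.toReal_inv]

instance isProbabilityMeasure_unitSphereMeasure [Nontrivial E] :
    IsProbabilityMeasure (unitSphereMeasure E) := by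
  have : IsProbabilityMeasure (((volume : Measure E).toSphere Set.univ)⁻¹ •
      (volume : Measure E).toSphere) := by
    constructor
    rw [Measure.smul_apply, smul_eq_mul]
    refine ENNReal.inv_mul_cancel ?_ (measure_ne_top _ _)
    rw [Ne, Measure.measure_univ_eq_zero]
    exact Measure.toSphere_ne_zero _
  exact Measure.isProbabilityMeasure_map measurable_subtype_coe.aemeasurable

theorem ae_unitSphereMeasure_norm : ∀ᵐ e ∂unitSphereMeasure E, ‖e‖ = 1 := by
  rw [unitSphereMeasure, ae_map_iff measurable_subtype_coe.aemeasurable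
    (measurableSet_eq_fun measurable_norm measurable_const)]
  exact Filter.Eventually.of_forall fun e => by simp

/-- Polar coordinates: the direction and the norm are independent. -/
theorem integral_direction_mul_norm [Nontrivial E] (A : E → ℝ) (B : ℝ → ℝ) :
    ∫ x : E, A (‖x‖⁻¹ • x) * B ‖x‖ = (∫ e, A e ∂unitSphereMeasure E) * ∫ x : E, B ‖x‖ := by
  have key : ∀ A : E → ℝ, ∫ x : E, A (‖x‖⁻¹ • x) * B ‖x‖ =
      (∫ e : Metric.sphere (0 : E) 1, A e ∂(volume : Measure E).toSphere) *
        ∫ r : Set.Ioi (0 : ℝ), B r ∂Measure.volumeIoiPow (Module.finrank ℝ E - 1) := by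
    intro A
    calc ∫ x : E, A (‖x‖⁻¹ • x) * B ‖x‖
        = ∫ x : ({(0)}ᶜ : Set E), A (‖x.1‖⁻¹ • x.1) * B ‖x.1‖ ∂((volume : Measure E).comap (↑)) := by
          rw [integral_subtype_comap (measurableSet_singleton _).compl
            fun x : E => A (‖x‖⁻¹ • x) * B ‖x‖, restrict_compl_singleton]
      _ = ∫ p : Metric.sphere (0 : E) 1 × Set.Ioi (0 : ℝ), A p.1 * B p.2
            ∂(volume : Measure E).toSphere.prod (.volumeIoiPow (Module.finrank ℝ E - 1)) := by
          simpa using (volume : Measure E).measurePreserving_homeomorphUnitSphereProd.integral_comp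
            (Homeomorph.measurableEmbedding _)
            (fun p : Metric.sphere (0 : E) 1 × Set.Ioi (0 : ℝ) => A p.1 * B p.2)
      _ = _ := integral_prod_mul (fun e : Metric.sphere (0 : E) 1 => A e)
          (fun r : Set.Ioi (0 : ℝ) => B r)
  -- The case `A = 1` identifies the radial factor, up to the total mass of the sphere.
  have h1 := key (fun _ => 1)
  simp only [one_mul, integral_const, smul_eq_mul, mul_one] at h1
  have hne : (volume : Measure E).toSphere.real Set.univ ≠ 0 := by
    rw [measureReal_def, Ne, ENNReal.toReal_eq_zero_iff]
    simp [-Measure.toSphere_apply_univ]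
  rw [key, h1, integral_unitSphereMeasure]
  field_simp

/-- The density of the standard Gaussian measure. -/
theorem stdGaussian_eq_withDensity :
    stdGaussian E = (volume : Measure E).withDensity fun x =>
      ENNReal.ofReal ((2 * Real.pi) ^ (-(Module.finrank ℝ E / 2 : ℝ)) *
        Real.exp (-(1 / 2) * ‖x‖ ^ 2)) := by
  set c : ℝ := (2 * Real.pi) ^ (-(Module.finrank ℝ E / 2 : ℝ)) with hc
  have hc0 : 0 ≤ c := by positivity
  have hI : Integrable (fun x : E => Real.exp (-(1 / 2) * ‖x‖ ^ 2)) := by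
    have := (GaussianFourier.integrable_cexp_neg_mul_sq_norm_add (V := E)
      (b := 1 / 2) (by norm_num) 0 0).norm
    refine this.congr (Filter.Eventually.of_forall fun x => ?_)
    simp [Complex.norm_exp, ← Complex.ofReal_pow]
  have : IsFiniteMeasure ((volume : Measure E).withDensity fun x =>
      ENNReal.ofReal (c * Real.exp (-(1 / 2) * ‖x‖ ^ 2))) :=
    isFiniteMeasure_withDensity_ofReal (hI.const_mul c).2
  -- Both measures are finite, so it suffices to compare characteristic functions, by the complex
  -- Gaussian integral.
  apply Measure.ext_of_charFun
  ext t
  rw [charFun_stdGaussian, charFun_apply, integral_withDensity_eq_integral_toReal_smul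
    (by fun_prop) (by simp)]
  have h2 := GaussianFourier.integral_cexp_neg_mul_sq_norm_add (V := E)
    (b := 1 / 2) (by norm_num) Complex.I t
  have : ∀ x : E, (ENNReal.ofReal (c * Real.exp (-(1 / 2) * ‖x‖ ^ 2))).toReal •
      Complex.exp ((inner ℝ x t : ℝ) * Complex.I) =
      (c : ℂ) * Complex.exp (-(1 / 2) * ‖x‖ ^ 2 + Complex.I * (inner ℝ t x : ℝ)) := by
    intro x
    rw [ENNReal.toReal_ofReal (by positivity), Complex.exp_add, real_inner_comm, mul_comm Complex.I,
      Complex.real_smul]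
    push_cast
    ring
  simp_rw [this]
  rw [integral_const_mul, h2, hc, Complex.ofReal_cpow (by positivity), ← mul_assoc]
  have : ((2 * Real.pi : ℝ) : ℂ) ^ (((-(Module.finrank ℝ E / 2 : ℝ)) : ℝ) : ℂ) *
      (Real.pi / (1 / 2) : ℂ) ^ (Module.finrank ℝ E / 2 : ℂ) = 1 := by
    have h3 : (Real.pi / (1 / 2) : ℂ) = ((2 * Real.pi : ℝ) : ℂ) := by push_cast; ring
    rw [h3]
    push_cast
    rw [← Complex.cpow_add _ _ (by simp [Real.pi_ne_zero])]
    simp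
  rw [this, one_mul]
  congr 1
  simp
  ring

theorem stdGaussian_absolutelyContinuous : stdGaussian E ≪ (volume : Measure E) := by
  rw [stdGaussian_eq_withDensity]
  exact withDensity_absolutelyContinuous _ _

/-- The direction and the norm of a standard Gaussian vector are independent. -/
theorem integral_direction_mul_norm_stdGaussian [Nontrivial E] (A : E → ℝ) (B : ℝ → ℝ) :
    ∫ x : E, A (‖x‖⁻¹ • x) * B ‖x‖ ∂stdGaussian E =
      (∫ e, A e ∂unitSphereMeasure E) * ∫ x : E, B ‖x‖ ∂stdGaussian E := by
  rw [stdGaussian_eq_withDensity, integral_withDensity_eq_integral_toReal_smul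
    (by fun_prop) (by simp), integral_withDensity_eq_integral_toReal_smul (by fun_prop) (by simp)]
  set w : ℝ → ℝ := fun r => (ENNReal.ofReal ((2 * Real.pi) ^ (-(Module.finrank ℝ E / 2 : ℝ)) *
        Real.exp (-(1 / 2) * r ^ 2))).toReal
  rw [← integral_direction_mul_norm A (fun r => w r • B r)]
  refine integral_congr_ae (Filter.Eventually.of_forall fun x => ?_)
  simp only [w, smul_eq_mul]
  ring

/-- The law of the direction of a standard Gaussian vector is uniform on the sphere. -/
theorem integral_direction_stdGaussian [Nontrivial E] (A : E → ℝ) :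
    ∫ x : E, A (‖x‖⁻¹ • x) ∂stdGaussian E = ∫ e, A e ∂unitSphereMeasure E := by
  simpa using integral_direction_mul_norm_stdGaussian A (fun _ => 1)

/-- The Gaussian measure is invariant under the isometry `x ↦ -x`, and this passes to the law of the
direction. -/
theorem integral_unitSphereMeasure_comp_neg [Nontrivial E] (A : E → ℝ) :
    ∫ e, A (-e) ∂unitSphereMeasure E = ∫ e, A e ∂unitSphereMeasure E := by
  rw [← integral_direction_stdGaussian, ← integral_direction_stdGaussian A]
  conv_rhs => rw [← stdGaussian_map (E := E) (LinearIsometryEquiv.neg ℝ)]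
  have hm : MeasurableEmbedding (LinearIsometryEquiv.neg ℝ (E := E)) :=
    (LinearIsometryEquiv.neg ℝ (E := E)).toHomeomorph.measurableEmbedding
  rw [hm.integral_map]
  simp

theorem stdGaussian_map_inner (v : E) :
    (stdGaussian E).map (fun x => inner ℝ v x) = gaussianReal 0 (‖v‖ ^ 2).toNNReal := by
  have := IsGaussian.map_eq_gaussianReal (μ := stdGaussian E) (innerSL ℝ v)
  rw [integral_strongDual_stdGaussian, variance_dual_stdGaussian, innerSL_apply_norm] at this
  exact this

theorem integrable_stdGaussian_norm_pow (k : ℕ) :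
    Integrable (fun x : E => ‖x‖ ^ k) (stdGaussian E) := by
  rcases Nat.eq_zero_or_pos k with rfl | hk
  · simp
  have := (IsGaussian.memLp_id (stdGaussian E) (k : ℝ≥0∞) (by simp)).integrable_norm_pow hk.ne'
  simpa using this

theorem integrable_stdGaussian_inner_pow (v : E) (k : ℕ) :
    Integrable (fun x : E => (inner ℝ v x) ^ k) (stdGaussian E) := by
  refine ((integrable_stdGaussian_norm_pow k).const_mul (‖v‖ ^ k)).mono'
    (by fun_prop) (Filter.Eventually.of_forall fun x => ?_)
  rw [norm_pow, ← mul_pow]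
  exact pow_le_pow_left₀ (norm_nonneg _) (norm_inner_le_norm v x) k

theorem integral_stdGaussian_inner_sq (v : E) :
    ∫ x, (inner ℝ v x) ^ 2 ∂stdGaussian E = ‖v‖ ^ 2 := by
  have h := variance_dual_stdGaussian (innerSL ℝ v)
  rw [variance_eq_sub, integral_strongDual_stdGaussian, innerSL_apply_norm] at h
  · simpa using h
  · refine (memLp_two_iff_integrable_sq (by fun_prop)).2 ?_
    exact integrable_stdGaussian_inner_pow v 2

theorem integral_stdGaussian_norm_sq :
    ∫ x : E, ‖x‖ ^ 2 ∂stdGaussian E = Module.finrank ℝ E := by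
  have b := stdOrthonormalBasis ℝ E
  simp_rw [← b.sum_sq_inner_right]
  rw [integral_finsetSum _ fun i _ => integrable_stdGaussian_inner_pow (b i) 2]
  simp [integral_stdGaussian_inner_sq]

theorem pow_two_mul_le_exp_add_exp (k : ℕ) (x : ℝ) :
    x ^ (2 * k) ≤ (2 * k).factorial * (Real.exp x + Real.exp (-x)) := by
  have h : ∀ y : ℝ, 0 ≤ y → y ^ (2 * k) ≤ (2 * k).factorial * Real.exp y := fun y hy => by
    have := Real.pow_div_factorial_le_exp y hy (2 * k)
    rwa [div_le_iff₀ (by positivity), mul_comm (Real.exp y)] at this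
  rcases le_total 0 x with hx | hx
  · refine (h x hx).trans ?_
    gcongr
    linarith [Real.exp_pos (-x)]
  · have := h (-x) (by linarith)
    rw [Even.neg_pow (even_two_mul k)] at this
    refine this.trans ?_
    gcongr
    linarith [Real.exp_pos x]

/-- An even power is dominated by one Taylor coefficient of the exponential, so the moment is
controlled by the moment generating function at a well-chosen parameter. -/
theorem integral_stdGaussian_inner_pow_le (v : E) (k : ℕ) :
    ∫ x, (inner ℝ v x) ^ (2 * k) ∂stdGaussian E ≤
      2 * (2 * k * Real.exp 1) ^ k * ‖v‖ ^ (2 * k) := by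
  rcases Nat.eq_zero_or_pos k with rfl | hk
  · simp
  rcases eq_or_ne v 0 with rfl | hv
  · simp [hk.ne']
  have hv' : 0 < ‖v‖ := norm_pos_iff.2 hv
  -- With this scale `t² ‖v‖² / 2 = k`, so each of the two exponential moments equals `e^k`.
  set t : ℝ := √(2 * k) / ‖v‖ with ht
  have htpos : 0 < t := by positivity
  have hmgf : ∀ s : ℝ, ∫ x, Real.exp (s * inner ℝ v x) ∂stdGaussian E =
      Real.exp (‖v‖ ^ 2 * s ^ 2 / 2) := by
    intro s
    have := mgf_gaussianReal (stdGaussian_map_inner v) s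
    rw [mgf, Real.coe_toNNReal _ (by positivity)] at this
    simpa using this
  have hint : ∀ s : ℝ, Integrable (fun x => Real.exp (s * inner ℝ v x)) (stdGaussian E) := by
    intro s
    -- The integral of a non-integrable function is zero by convention, whereas the formula for this
    -- one is positive.
    by_contra hcon
    have := hmgf s
    rw [integral_undef hcon] at this
    exact (Real.exp_pos _).ne this
  have hts : t ^ 2 * ‖v‖ ^ 2 = 2 * k := by
    rw [ht, div_pow, Real.sq_sqrt (by positivity)]
    field_simp
  have h1 : t ^ (2 * k) * ∫ x, (inner ℝ v x) ^ (2 * k) ∂stdGaussian E ≤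
      (2 * k).factorial * (2 * Real.exp k) := by
    rw [← integral_const_mul]
    calc ∫ x, t ^ (2 * k) * (inner ℝ v x) ^ (2 * k) ∂stdGaussian E
        ≤ ∫ x, (2 * k).factorial * (Real.exp (t * inner ℝ v x) + Real.exp (-t * inner ℝ v x))
            ∂stdGaussian E := by
          refine integral_mono ((integrable_stdGaussian_inner_pow v _).const_mul _)
            (((hint t).add (hint (-t))).const_mul _) fun x => ?_
          have := pow_two_mul_le_exp_add_exp k (t * inner ℝ v x)
          simp only [← mul_pow, neg_mul]
          exact this
      _ = _ := by
          rw [integral_const_mul, integral_add (hint t) (hint (-t)), hmgf, hmgf]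
          have : ‖v‖ ^ 2 * t ^ 2 / 2 = k := by rw [mul_comm, hts]; ring
          have h' : ‖v‖ ^ 2 * (-t) ^ 2 / 2 = k := by rw [neg_sq]; exact this
          rw [this, h']
          ring
  have h2 : ((2 * k).factorial : ℝ) ≤ (2 * k) ^ (2 * k) := by
    exact_mod_cast Nat.factorial_le_pow (2 * k)
  have h3 : t ^ (2 * k) * ‖v‖ ^ (2 * k) = (2 * k) ^ k := by
    rw [pow_mul, pow_mul, ← mul_pow, hts]
  have h4 : Real.exp k = Real.exp 1 ^ k := by rw [← Real.exp_nat_mul, mul_one]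
  refine le_of_mul_le_mul_left ?_ (pow_pos htpos (2 * k))
  refine h1.trans ?_
  calc ((2 * k).factorial : ℝ) * (2 * Real.exp k)
      ≤ (2 * k) ^ (2 * k) * (2 * Real.exp k) := by gcongr
    _ = 2 * (2 * k * Real.exp 1) ^ k * (2 * k) ^ k := by
        rw [h4, mul_pow, two_mul k, pow_add]; ring
    _ = _ := by rw [← h3]; ring

/-- Moments of linear functionals on the sphere. -/
theorem integral_unitSphereMeasure_inner_pow_mul [Nontrivial E] (v : E) (k : ℕ) :
    (∫ e, (inner ℝ v e) ^ k ∂unitSphereMeasure E) * ∫ x : E, ‖x‖ ^ k ∂stdGaussian E =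
      ∫ x, (inner ℝ v x) ^ k ∂stdGaussian E := by
  rw [← integral_direction_mul_norm_stdGaussian (fun e => (inner ℝ v e) ^ k) (fun r => r ^ k)]
  refine integral_congr_ae (Filter.Eventually.of_forall fun x => ?_)
  rcases eq_or_ne x 0 with rfl | hx
  · rcases Nat.eq_zero_or_pos k with rfl | hk
    · simp
    · simp [hk.ne']
  · have : ‖x‖ ≠ 0 := norm_ne_zero_iff.2 hx
    simp only [inner_smul_right]
    rw [← mul_pow]
    congr 1
    field_simp

/-- Jensen's inequality for the `k`-th power, applied to `‖x‖²`, whose mean is the dimension. It is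
the denominator when Gaussian moments are converted into spherical ones. -/
theorem finrank_pow_le_integral_stdGaussian_norm_pow (k : ℕ) :
    (Module.finrank ℝ E : ℝ) ^ k ≤ ∫ x : E, ‖x‖ ^ (2 * k) ∂stdGaussian E := by
  rw [← integral_stdGaussian_norm_sq]
  have := (convexOn_pow k).map_integral_le (μ := stdGaussian E) (f := fun x : E => ‖x‖ ^ 2)
    (by fun_prop) isClosed_Ici (Filter.Eventually.of_forall fun x => by simp)
    (integrable_stdGaussian_norm_pow 2)
    (by simpa [Function.comp_def, ← pow_mul] using integrable_stdGaussian_norm_pow (E := E) (2 * k))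
  simpa [← pow_mul] using this

theorem integral_unitSphereMeasure_inner_pow_le [Nontrivial E] (v : E) (k : ℕ) :
    ∫ e, (inner ℝ v e) ^ (2 * k) ∂unitSphereMeasure E ≤
      2 * (2 * k * Real.exp 1 / Module.finrank ℝ E) ^ k * ‖v‖ ^ (2 * k) := by
  have hd : (0 : ℝ) < Module.finrank ℝ E := by exact_mod_cast Module.finrank_pos
  have h1 := integral_unitSphereMeasure_inner_pow_mul v (2 * k)
  have h2 := integral_stdGaussian_inner_pow_le v k
  have h3 := finrank_pow_le_integral_stdGaussian_norm_pow (E := E) k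
  have h0 : 0 ≤ ∫ e, (inner ℝ v e) ^ (2 * k) ∂unitSphereMeasure E :=
    integral_nonneg fun e => (even_two_mul k).pow_nonneg _
  have h4 : (∫ e, (inner ℝ v e) ^ (2 * k) ∂unitSphereMeasure E) * (Module.finrank ℝ E : ℝ) ^ k ≤
      2 * (2 * k * Real.exp 1) ^ k * ‖v‖ ^ (2 * k) :=
    (mul_le_mul_of_nonneg_left h3 h0).trans (h1.le.trans h2)
  rw [← le_div_iff₀ (by positivity)] at h4
  refine h4.trans (le_of_eq ?_)
  rw [div_pow]
  ring

theorem integral_unitSphereMeasure_inner_sq [Nontrivial E] (v : E) :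
    ∫ e, (inner ℝ v e) ^ 2 ∂unitSphereMeasure E = ‖v‖ ^ 2 / Module.finrank ℝ E := by
  have hd : (0 : ℝ) < Module.finrank ℝ E := by exact_mod_cast Module.finrank_pos
  have h1 := integral_unitSphereMeasure_inner_pow_mul v 2
  rw [integral_stdGaussian_norm_sq, integral_stdGaussian_inner_sq] at h1
  rw [eq_div_iff hd.ne', h1]

end SphereMeasure

/-! ### Comparison of the `ℓ_p`-norms and Hölder's inequality. -/

section EllNorm

variable {m n : ℕ}

theorem ellNorm_eq_sum {p : ℝ≥0∞} (hp : 0 < p.toReal) (v : Joint m n) :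
    ellNorm p v = (∑ i, |v i| ^ p.toReal) ^ (1 / p.toReal) := by
  simp [ellNorm, PiLp.norm_eq_sum hp]

theorem ellNorm_two (v : Joint m n) : ellNorm 2 v = ‖v‖ := by
  rw [ellNorm_eq_sum (by norm_num), EuclideanSpace.norm_eq, Real.sqrt_eq_rpow]
  simp

theorem continuous_ellNorm {p : ℝ≥0∞} (hp : 1 ≤ p) : Continuous (ellNorm p (m := m) (n := n)) := by
  have : Fact (1 ≤ p) := ⟨hp⟩
  unfold ellNorm
  refine continuous_norm.comp ?_
  exact (PiLp.continuous_toLp p _).comp (continuous_pi fun i => by fun_prop)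

theorem ellNorm_nonneg {p : ℝ≥0∞} (hp : 1 ≤ p) (v : Joint m n) : 0 ≤ ellNorm p v := by
  have : Fact (1 ≤ p) := ⟨hp⟩
  exact norm_nonneg _

theorem ellNorm_smul {p : ℝ≥0∞} (hp : 1 ≤ p) (c : ℝ) (v : Joint m n) :
    ellNorm p (c • v) = |c| * ellNorm p v := by
  have : Fact (1 ≤ p) := ⟨hp⟩
  unfold ellNorm
  rw [← Real.norm_eq_abs, ← norm_smul]
  rfl

theorem abs_apply_le_ellNorm {p : ℝ≥0∞} (hp : 1 ≤ p) (v : Joint m n) (i : Fin m ⊕ Fin n) :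
    |v i| ≤ ellNorm p v := by
  have : Fact (1 ≤ p) := ⟨hp⟩
  have := PiLp.norm_apply_le (WithLp.toLp p (fun i => v i) : PiLp p (fun _ : Fin m ⊕ Fin n => ℝ)) i
  rw [Real.norm_eq_abs] at this
  exact this

theorem ellNorm_congr_abs {p : ℝ≥0∞} (hp : 1 ≤ p) {v w : Joint m n} (h : ∀ i, |v i| = |w i|) :
    ellNorm p v = ellNorm p w := by
  rcases eq_or_ne p ⊤ with rfl | hpt
  · simp [ellNorm, PiLp.norm_eq_ciSup, h]
  · have hp0 : 0 < p.toReal := ENNReal.toReal_pos (by positivity) hpt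
    simp [ellNorm_eq_sum hp0, h]

theorem ellNorm_flipY {p : ℝ≥0∞} (hp : 1 ≤ p) (v : Joint m n) : ellNorm p (flipY v) = ellNorm p v :=
  ellNorm_congr_abs hp fun i => by rcases i with i | i <;> simp [flipY, joint, xPart, yPart]

theorem ellNorm_top_le {b : ℝ} (hb : 0 ≤ b) {v : Joint m n} (h : ∀ i, |v i| ≤ b) :
    ellNorm ⊤ v ≤ b := by
  simp only [ellNorm, PiLp.norm_eq_ciSup]
  exact Real.iSup_le (fun i => by simpa using h i) hb

/-- Each coordinate is at most `‖v‖_r`, so in the sum of `q`-th powers the surplus factor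
`|v_i|^(q-r)` can be replaced by `‖v‖_r^(q-r)`. -/
theorem ellNorm_antitone {r q : ℝ≥0∞} (hr : 1 ≤ r) (hrq : r ≤ q) (v : Joint m n) :
    ellNorm q v ≤ ellNorm r v := by
  have hs := ellNorm_nonneg hr v
  rcases eq_or_ne q ⊤ with rfl | hqt
  · exact ellNorm_top_le hs fun i => abs_apply_le_ellNorm hr v i
  have hrt : r ≠ ⊤ := ne_top_of_le_ne_top hqt hrq
  have hr0 : 0 < r.toReal := ENNReal.toReal_pos (by positivity) hrt
  have hrq' : r.toReal ≤ q.toReal := ENNReal.toReal_mono hqt hrq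
  have hq0 : 0 < q.toReal := hr0.trans_le hrq'
  have hrs : ellNorm r v ^ r.toReal = ∑ i, |v i| ^ r.toReal := by
    rw [ellNorm_eq_sum hr0, ← Real.rpow_mul (Finset.sum_nonneg fun i _ => by positivity)]
    rw [one_div, inv_mul_cancel₀ hr0.ne', Real.rpow_one]
  have key : ∑ i, |v i| ^ q.toReal ≤ ellNorm r v ^ q.toReal := by
    calc ∑ i, |v i| ^ q.toReal
        = ∑ i, |v i| ^ r.toReal * |v i| ^ (q.toReal - r.toReal) := by
          refine Finset.sum_congr rfl fun i _ => ?_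
          rw [← Real.rpow_add_of_nonneg (abs_nonneg _) hr0.le (sub_nonneg.2 hrq'), add_sub_cancel]
      _ ≤ ∑ i, |v i| ^ r.toReal * ellNorm r v ^ (q.toReal - r.toReal) := by
          refine Finset.sum_le_sum fun i _ => ?_
          exact mul_le_mul_of_nonneg_left (Real.rpow_le_rpow (abs_nonneg _)
            (abs_apply_le_ellNorm hr v i) (sub_nonneg.2 hrq')) (by positivity)
      _ = ellNorm r v ^ q.toReal := by
          rw [← Finset.sum_mul, ← hrs, ← Real.rpow_add_of_nonneg hs hr0.le (sub_nonneg.2 hrq'),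
            add_sub_cancel]
  rw [ellNorm_eq_sum hq0, one_div, Real.rpow_inv_le_iff_of_pos
    (Finset.sum_nonneg fun i _ => by positivity) hs hq0]
  exact key

theorem ellNorm_le_card_rpow_mul {r q : ℝ≥0∞} (hq : 1 ≤ q) (hrq : q ≤ r) (hrt : r ≠ ⊤)
    (v : Joint m n) :
    ellNorm q v ≤ ((m + n : ℕ) : ℝ) ^ (1 / q.toReal - 1 / r.toReal) * ellNorm r v := by
  have hqt : q ≠ ⊤ := ne_top_of_le_ne_top hrt hrq
  have hq0 : 0 < q.toReal := ENNReal.toReal_pos (by positivity) hqt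
  have hrq' : q.toReal ≤ r.toReal := ENNReal.toReal_mono hrt hrq
  have hr0 : 0 < r.toReal := hq0.trans_le hrq'
  have h1 := Real.rpow_sum_le_const_mul_sum_rpow (ι := Fin m ⊕ Fin n) Finset.univ
    (fun i => |v i| ^ q.toReal) (p := r.toReal / q.toReal) ((one_le_div hq0).2 hrq')
  have h2 : ∀ i, |(|v i| ^ q.toReal)| ^ (r.toReal / q.toReal) = |v i| ^ r.toReal := fun i => by
    rw [abs_of_nonneg (by positivity), ← Real.rpow_mul (abs_nonneg _)]
    congr 1
    field_simp
  have h3 : ∀ i, |(|v i| ^ q.toReal)| = |v i| ^ q.toReal := fun i => abs_of_nonneg (by positivity)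
  simp only [h2] at h1
  simp only [h3, Finset.card_univ, Fintype.card_sum, Fintype.card_fin] at h1
  have hS : 0 ≤ ∑ i, |v i| ^ q.toReal := Finset.sum_nonneg fun i _ => by positivity
  have hS' : 0 ≤ ∑ i, |v i| ^ r.toReal := Finset.sum_nonneg fun i _ => by positivity
  have h4 := Real.rpow_le_rpow (Real.rpow_nonneg hS _) h1 (one_div_nonneg.2 hr0.le)
  rw [← Real.rpow_mul hS, Real.mul_rpow (by positivity) hS',
    ← Real.rpow_mul (by positivity)] at h4
  rw [ellNorm_eq_sum hq0, ellNorm_eq_sum hr0]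
  convert h4 using 2
  · field_simp
  · congr 1
    field_simp

/-- Valid for every `p`, since only the bound of coordinates by the norm is used. It replaces
`norm_le_ellNorm_of_le_two` where `p ≤ 2` is not assumed. -/
theorem norm_le_sqrt_mul_ellNorm {p : ℝ≥0∞} (hp : 1 ≤ p) (v : Joint m n) :
    ‖v‖ ≤ √((m + n : ℕ) : ℝ) * ellNorm p v := by
  have h0 := ellNorm_nonneg hp v
  rw [EuclideanSpace.norm_eq, Real.sqrt_le_iff]
  refine ⟨by positivity, ?_⟩
  rw [mul_pow, Real.sq_sqrt (by positivity)]
  calc ∑ i, ‖v i‖ ^ 2 ≤ ∑ _i : Fin m ⊕ Fin n, ellNorm p v ^ 2 :=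
        Finset.sum_le_sum fun i _ => pow_le_pow_left₀ (norm_nonneg _)
          (abs_apply_le_ellNorm hp v i) 2
    _ = _ := by simp

theorem norm_le_ellNorm_of_le_two {p : ℝ≥0∞} (hp : 1 ≤ p) (hp2 : p ≤ 2) (v : Joint m n) :
    ‖v‖ ≤ ellNorm p v := by
  rw [← ellNorm_two]
  exact ellNorm_antitone hp hp2 v

theorem inner_le_ellNorm_mul {p q : ℝ≥0∞} (hpq : ENNReal.HolderConjugate p q) (u v : Joint m n) :
    inner ℝ u v ≤ ellNorm q u * ellNorm p v := by
  have hp : 1 ≤ p := hpq.one_le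
  have hq : 1 ≤ q := hpq.symm.one_le
  have hin : inner ℝ u v = ∑ i, u i * v i := by
    simp [PiLp.inner_apply, mul_comm]
  have habs : inner ℝ u v ≤ ∑ i, |u i| * |v i| := by
    rw [hin]
    exact Finset.sum_le_sum fun i _ => by rw [← abs_mul]; exact le_abs_self _
  refine habs.trans ?_
  have hone : ∀ w : Joint m n, ellNorm 1 w = ∑ i, |w i| := fun w => by
    rw [ellNorm_eq_sum (by norm_num)]; simp
  -- The endpoint pairs `(∞, 1)` and `(1, ∞)` are treated by hand, since Hölder's inequality for
  -- real exponents excludes them.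
  rcases eq_or_ne p ⊤ with rfl | hpt
  · have : q = 1 := by
      have := hpq.inv_add_inv_eq_one
      simpa using this
    subst this
    rw [hone, Finset.sum_mul]
    exact Finset.sum_le_sum fun i _ => by gcongr; exact abs_apply_le_ellNorm hp v i
  rcases eq_or_ne q ⊤ with rfl | hqt
  · have : p = 1 := by
      have := hpq.inv_add_inv_eq_one
      simpa using this
    subst this
    rw [hone, Finset.mul_sum]
    exact Finset.sum_le_sum fun i _ => by gcongr; exact abs_apply_le_ellNorm hq u i
  have hp0 : 0 < p.toReal := ENNReal.toReal_pos (by positivity) hpt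
  have hq0 : 0 < q.toReal := ENNReal.toReal_pos (by positivity) hqt
  have hreal : q.toReal.HolderConjugate p.toReal := by
    have := hpq.inv_add_inv_eq_one
    have h := congrArg ENNReal.toReal this
    rw [ENNReal.toReal_add (by simp; positivity) (by simp; positivity), ENNReal.toReal_inv,
      ENNReal.toReal_inv] at h
    rw [Real.holderConjugate_iff]
    refine ⟨?_, by simpa [add_comm] using h⟩
    have hpi : 0 < p.toReal⁻¹ := inv_pos.2 hp0
    have : q.toReal⁻¹ < 1 := by simp at h; linarith
    exact (inv_lt_one₀ hq0).1 this
  have := Real.inner_le_Lp_mul_Lq (ι := Fin m ⊕ Fin n) Finset.univ (fun i => |u i|)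
    (fun i => |v i|) hreal
  simpa [ellNorm_eq_sum hp0, ellNorm_eq_sum hq0] using this

theorem inner_flipY_left (u v : Joint m n) : inner ℝ (flipY u) v = inner ℝ u (flipY v) := by
  simp [PiLp.inner_apply, flipY, joint, xPart, yPart]

theorem norm_flipY (u : Joint m n) : ‖flipY u‖ = ‖u‖ := by
  rw [← ellNorm_two, ← ellNorm_two, ellNorm_flipY (by norm_num)]

end EllNorm

/-! ### The size of `a_q²`. -/

section DimensionBound

variable {m n : ℕ}

theorem finrank_joint : Module.finrank ℝ (Joint m n) = m + n := by simp

theorem nontrivial_joint (h : 1 ≤ m + n) : Nontrivial (Joint m n) :=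
  Module.nontrivial_of_finrank_pos (R := ℝ) (by rw [finrank_joint]; omega)

theorem integrable_unitSphereMeasure_of_continuous [Nontrivial (Joint m n)] {A : Joint m n → ℝ}
    (hA : Continuous A) : Integrable A (unitSphereMeasure (Joint m n)) := by
  obtain ⟨C, hC⟩ := (isCompact_sphere (0 : Joint m n) 1).exists_bound_of_continuousOn hA.continuousOn
  refine Integrable.of_bound hA.aestronglyMeasurable C ?_
  filter_upwards [ae_unitSphereMeasure_norm] with e he
  exact hC e (by simp [he])

theorem integral_sum_coord_pow_le (hd : 1 ≤ m + n) (k : ℕ) :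
    ∫ e : Joint m n, ∑ i, e i ^ (2 * k) ∂unitSphereMeasure (Joint m n) ≤
      2 * ((m + n : ℕ) : ℝ) * (2 * k * Real.exp 1 / ((m + n : ℕ) : ℝ)) ^ k := by
  have := nontrivial_joint hd
  rw [integral_finsetSum _ fun i _ => integrable_unitSphereMeasure_of_continuous (by fun_prop)]
  have h : ∀ i : Fin m ⊕ Fin n, ∫ e : Joint m n, e i ^ (2 * k) ∂unitSphereMeasure (Joint m n) ≤
      2 * (2 * k * Real.exp 1 / ((m + n : ℕ) : ℝ)) ^ k := fun i => by
    have := integral_unitSphereMeasure_inner_pow_le (EuclideanSpace.single i (1 : ℝ) : Joint m n) k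
    rw [finrank_joint] at this
    simpa [EuclideanSpace.inner_single_left] using this
  refine (Finset.sum_le_sum fun i _ => h i).trans (le_of_eq ?_)
  simp
  ring

/-- The comparison with `ℓ_{2k}` costs a power of `d` for `q ≤ 2k` and nothing for larger `q`; the
maximum with `0` in the exponent covers both cases. -/
theorem ellNorm_le_rpow_mul_sum {q : ℝ≥0∞} (hq : 1 ≤ q) (hd : 1 ≤ m + n) {k : ℕ} (hk : 1 ≤ k)
    (v : Joint m n) :
    ellNorm q v ≤ ((m + n : ℕ) : ℝ) ^ (max 0 ((q⁻¹).toReal - 1 / (2 * k))) *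
      (∑ i, v i ^ (2 * k)) ^ (1 / (2 * k : ℝ)) := by
  have hd1 : (1 : ℝ) ≤ ((m + n : ℕ) : ℝ) := by exact_mod_cast hd
  have hk2 : (1 : ℝ≥0∞) ≤ ((2 * k : ℕ) : ℝ≥0∞) := by exact_mod_cast (by omega : 1 ≤ 2 * k)
  have hkr : (((2 * k : ℕ) : ℝ≥0∞)).toReal = 2 * k := by simp
  have he : ellNorm ((2 * k : ℕ) : ℝ≥0∞) v = (∑ i, v i ^ (2 * k)) ^ (1 / (2 * k : ℝ)) := by
    rw [ellNorm_eq_sum (by rw [hkr]; positivity), hkr]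
    congr 1
    refine Finset.sum_congr rfl fun i _ => ?_
    have : (2 * k : ℝ) = ((2 * k : ℕ) : ℝ) := by push_cast; ring
    rw [this, Real.rpow_natCast, (even_two_mul k).pow_abs]
  rw [← he]
  have h0 := ellNorm_nonneg hk2 v
  rcases le_total q ((2 * k : ℕ) : ℝ≥0∞) with h | h
  · refine (ellNorm_le_card_rpow_mul hq h (ENNReal.natCast_ne_top _) v).trans ?_
    gcongr
    rw [hkr, ENNReal.toReal_inv, one_div]
    exact le_max_right _ _
  · refine (ellNorm_antitone hk2 h v).trans ?_
    exact le_mul_of_one_le_left h0 (Real.one_le_rpow hd1 (le_max_left _ _))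

/-- A bound with a free parameter `k`, to be optimized: the factor `k` comes from the growth of the
moments, the power of `d` from the passage to `ℓ_{2k}`. -/
theorem aSq_le_rpow {q : ℝ≥0∞} (hq : 1 ≤ q) (hd : 1 ≤ m + n) {k : ℕ} (hk : 2 ≤ k) :
    aSq m n q ≤ 4 * Real.exp 1 * k *
      ((m + n : ℕ) : ℝ) ^ (max (1 / (k : ℝ)) (2 * (q⁻¹).toReal) - 1) := by
  have := nontrivial_joint hd
  have hd0 : (0 : ℝ) < ((m + n : ℕ) : ℝ) := by exact_mod_cast hd
  have hk0 : (0 : ℝ) < k := by exact_mod_cast (by omega : 0 < k)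
  have hk2 : (2 : ℝ) ≤ k := by exact_mod_cast hk
  set d : ℝ := ((m + n : ℕ) : ℝ) with hdd
  set s : ℝ := max 0 ((q⁻¹).toReal - 1 / (2 * k)) with hs
  rw [aSq, Real.sqrt_le_iff]
  refine ⟨by positivity, ?_⟩
  rw [sphereUniform_eq]
  have hpt : ∀ e : Joint m n, ellNorm q e ^ 4 ≤ d ^ (4 * s) * (∑ i, e i ^ (2 * k)) ^ (2 / k : ℝ) := by
    intro e
    have hS : 0 ≤ ∑ i, e i ^ (2 * k) := Finset.sum_nonneg fun i _ => (even_two_mul k).pow_nonneg _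
    refine (pow_le_pow_left₀ (ellNorm_nonneg hq e)
      (ellNorm_le_rpow_mul_sum hq hd (by omega : 1 ≤ k) e) 4).trans (le_of_eq ?_)
    rw [mul_pow, ← Real.rpow_natCast (_ ^ _), ← Real.rpow_mul hd0.le, ← Real.rpow_natCast (_ ^ _),
      ← Real.rpow_mul hS]
    congr 2
    · push_cast; ring
    · field_simp; norm_num
  have hcont : Continuous fun e : Joint m n => (∑ i, e i ^ (2 * k)) ^ (2 / k : ℝ) :=
    Continuous.rpow_const (by fun_prop) fun e => Or.inr (by positivity)
  -- Jensen's inequality for the power `2 / k`, concave because `k ≥ 2`.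
  have hJ : ∫ e : Joint m n, (∑ i, e i ^ (2 * k)) ^ (2 / k : ℝ) ∂unitSphereMeasure (Joint m n) ≤
      (∫ e : Joint m n, ∑ i, e i ^ (2 * k) ∂unitSphereMeasure (Joint m n)) ^ (2 / k : ℝ) := by
    refine (Real.concaveOn_rpow (p := 2 / k) (by positivity)
      ((div_le_one hk0).2 hk2)).le_map_integral ?_ isClosed_Ici ?_ ?_ ?_
    · exact (Real.continuous_rpow_const (by positivity)).continuousOn
    · exact Filter.Eventually.of_forall fun e => Set.mem_Ici.2
        (Finset.sum_nonneg fun i _ => (even_two_mul k).pow_nonneg _)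
    · exact integrable_unitSphereMeasure_of_continuous (by fun_prop)
    · exact integrable_unitSphereMeasure_of_continuous hcont
  have hnn : 0 ≤ ∫ e : Joint m n, ∑ i, e i ^ (2 * k) ∂unitSphereMeasure (Joint m n) :=
    integral_nonneg fun e => Finset.sum_nonneg fun i _ => (even_two_mul k).pow_nonneg _
  calc ∫ e : Joint m n, ellNorm q e ^ 4 ∂unitSphereMeasure (Joint m n)
      ≤ ∫ e : Joint m n, d ^ (4 * s) * (∑ i, e i ^ (2 * k)) ^ (2 / k : ℝ)
          ∂unitSphereMeasure (Joint m n) :=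
        integral_mono (integrable_unitSphereMeasure_of_continuous ((continuous_ellNorm hq).pow 4))
          (integrable_unitSphereMeasure_of_continuous (hcont.const_mul _)) hpt
    _ ≤ d ^ (4 * s) * (2 * d * (2 * k * Real.exp 1 / d) ^ k) ^ (2 / k : ℝ) := by
        rw [integral_const_mul]
        gcongr
        exact hJ.trans (Real.rpow_le_rpow hnn (integral_sum_coord_pow_le hd k) (by positivity))
    _ = d ^ (4 * s) * (2 ^ (2 / k : ℝ) * d ^ (2 / k : ℝ) * (2 * k * Real.exp 1 / d) ^ 2) := by
        rw [Real.mul_rpow (by positivity) (by positivity), Real.mul_rpow (by norm_num) hd0.le,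
          ← Real.rpow_natCast (_ / d), ← Real.rpow_mul (by positivity)]
        have : (k : ℝ) * (2 / k) = (2 : ℕ) := by field_simp; norm_num
        rw [this, Real.rpow_natCast]
    _ ≤ d ^ (4 * s) * (4 * d ^ (2 / k : ℝ) * (2 * k * Real.exp 1 / d) ^ 2) := by
        gcongr
        calc (2 : ℝ) ^ (2 / k : ℝ) ≤ 2 ^ (2 : ℝ) := by
              gcongr
              · norm_num
              · exact div_le_self (by norm_num) (by linarith)
          _ = 4 := by norm_num
    _ = (4 * Real.exp 1 * k * d ^ (max (1 / (k : ℝ)) (2 * (q⁻¹).toReal) - 1)) ^ 2 := by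
        have hmax : max (1 / (k : ℝ)) (2 * (q⁻¹).toReal) = 1 / k + 2 * s := by
          rw [hs, mul_max_of_nonneg _ _ (by norm_num), ← max_add_add_left]
          congr 1
          · ring
          · field_simp; ring
        have h1 : d ^ (max (1 / (k : ℝ)) (2 * (q⁻¹).toReal) - 1) =
            d ^ (1 / k : ℝ) * d ^ (2 * s) / d := by
          rw [hmax, Real.rpow_sub hd0, Real.rpow_add hd0, Real.rpow_one]
        have h2 : d ^ (4 * s) = d ^ (2 * s) * d ^ (2 * s) := by
          rw [← Real.rpow_add hd0]; ring_nf
        have h3 : d ^ (2 / k : ℝ) = d ^ (1 / k : ℝ) * d ^ (1 / k : ℝ) := by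
          rw [← Real.rpow_add hd0]; ring_nf
        rw [h1, h2, h3]
        field_simp
        ring

theorem aSq_le : ∃ K : ℝ, 0 < K ∧ ∀ (m n : ℕ) (q : ℝ≥0∞), 2 ≤ m + n → 1 ≤ q →
      aSq m n q ≤ K * (min q (ENNReal.ofReal (Real.log ((m + n : ℕ) : ℝ)))).toReal *
        ((m + n : ℕ) : ℝ) ^ (2 * (q⁻¹).toReal - 1) := by
  -- The factor `4 e` is that of `aSq_le_rpow`; `5` comes from `k ≤ 5 t`, and `e²` bounds `d^(1/k)`
  -- when `t = log d`.
  refine ⟨4 * Real.exp 1 * 5 * Real.exp 2, by positivity, fun m n q hd hq => ?_⟩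
  have hd2 : (2 : ℝ) ≤ ((m + n : ℕ) : ℝ) := by exact_mod_cast hd
  set d : ℝ := ((m + n : ℕ) : ℝ) with hdd
  have hd0 : 0 < d := by linarith
  have hlog : 1 / 2 ≤ Real.log d :=
    le_trans (by linarith [Real.log_two_gt_d9]) (Real.log_le_log (by norm_num) hd2)
  -- Here `k = ⌈t/2⌉ + 1`, so that `k ≥ 2` and `k ≥ t/2`. If `t = q`, the exponent `2/q` already
  -- dominates `1/k`; if `t = log d`, the excess `d^(1/k)` is at most `e²`.
  have key : ∀ t : ℝ, 1 / 2 ≤ t → t = (min q (ENNReal.ofReal (Real.log d))).toReal →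
      (1 / (⌈t / 2⌉₊ + 1 : ℕ) ≤ 2 * (q⁻¹).toReal ∨ t = Real.log d) →
      aSq m n q ≤ 4 * Real.exp 1 * 5 * Real.exp 2 *
        (min q (ENNReal.ofReal (Real.log d))).toReal * d ^ (2 * (q⁻¹).toReal - 1) := by
    intro t ht htm hcase
    rw [← htm]
    have hc1 : 1 ≤ ⌈t / 2⌉₊ := Nat.one_le_ceil_iff.2 (by linarith)
    have hk := aSq_le_rpow hq (by omega : 1 ≤ m + n) (k := ⌈t / 2⌉₊ + 1) (by omega)
    refine hk.trans ?_
    have hkt : ((⌈t / 2⌉₊ + 1 : ℕ) : ℝ) ≤ 5 * t := by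
      push_cast
      have := Nat.ceil_lt_add_one (a := t / 2) (by linarith)
      linarith
    have hkt2 : t / 2 ≤ ((⌈t / 2⌉₊ + 1 : ℕ) : ℝ) := by
      push_cast
      linarith [Nat.le_ceil (t / 2)]
    have hk0 : (0 : ℝ) < ((⌈t / 2⌉₊ + 1 : ℕ) : ℝ) := by positivity
    set k : ℝ := ((⌈t / 2⌉₊ + 1 : ℕ) : ℝ) with hkk
    have hpow : d ^ (max (1 / k) (2 * (q⁻¹).toReal) - 1) ≤
        Real.exp 2 * d ^ (2 * (q⁻¹).toReal - 1) := by
      rw [Real.rpow_sub hd0, Real.rpow_sub hd0, Real.rpow_one, mul_div_assoc']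
      gcongr
      have hq0 : 0 ≤ (q⁻¹).toReal := ENNReal.toReal_nonneg
      have hone : 1 ≤ d ^ (2 * (q⁻¹).toReal) := Real.one_le_rpow (by linarith) (by positivity)
      rcases le_total (1 / k) (2 * (q⁻¹).toReal) with h | h
      · rw [max_eq_right h]
        exact le_mul_of_one_le_left (by positivity) (Real.one_le_exp (by norm_num))
      · rw [max_eq_left h]
        rcases hcase with hcase | hcase
        · rw [le_antisymm h hcase]
          exact le_mul_of_one_le_left (by positivity) (Real.one_le_exp (by norm_num))
        · refine le_trans ?_ (le_mul_of_one_le_right (Real.exp_pos 2).le hone)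
          rw [Real.rpow_def_of_pos hd0, ← hcase]
          gcongr
          rw [mul_one_div, div_le_iff₀ hk0]
          linarith
    calc 4 * Real.exp 1 * k * d ^ (max (1 / k) (2 * (q⁻¹).toReal) - 1)
        ≤ 4 * Real.exp 1 * (5 * t) * (Real.exp 2 * d ^ (2 * (q⁻¹).toReal - 1)) := by gcongr
      _ = _ := by ring
  rcases le_total q (ENNReal.ofReal (Real.log d)) with h | h
  · have hqt : q ≠ ⊤ := ne_top_of_le_ne_top ENNReal.ofReal_ne_top h
    have hq1 : 1 ≤ q.toReal := by
      simpa using ENNReal.toReal_mono hqt hq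
    refine key q.toReal (by linarith) (by rw [min_eq_left h]) (Or.inl ?_)
    rw [ENNReal.toReal_inv, ← div_eq_mul_inv, div_le_div_iff₀ (by positivity) (by linarith)]
    push_cast
    linarith [Nat.le_ceil (q.toReal / 2)]
  · refine key (Real.log d) hlog ?_ (Or.inr rfl)
    rw [min_eq_right h, ENNReal.toReal_ofReal (by linarith)]

end DimensionBound

/-! ### Fourth-moment concentration of odd parts of Lipschitz functions. -/

section Concentration

variable {E : Type*} [NormedAddCommGroup E] [InnerProductSpace ℝ E] [FiniteDimensional ℝ E]
  [MeasurableSpace E] [BorelSpace E]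

theorem add_pow_four_le (s t : ℝ) : (s + t) ^ 4 ≤ 8 * (s ^ 4 + t ^ 4) := by
  nlinarith [sq_nonneg (s - t), sq_nonneg (s + t), sq_nonneg (s ^ 2 - t ^ 2), sq_nonneg (s * t),
    mul_nonneg (sq_nonneg (s - t)) (sq_nonneg (s + t)),
    mul_nonneg (sq_nonneg (s - t)) (sq_nonneg (s - t)),
    mul_nonneg (sq_nonneg (s - t)) (add_nonneg (sq_nonneg s) (sq_nonneg t))]

theorem integrable_add_norm_pow_four :
    Integrable (fun p : E × E => (‖p.1‖ + ‖p.2‖) ^ 4) ((stdGaussian E).prod (stdGaussian E)) := by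
  have h1 := (integrable_stdGaussian_norm_pow (E := E) 4).comp_fst (stdGaussian E)
  have h2 := (integrable_stdGaussian_norm_pow (E := E) 4).comp_snd (stdGaussian E)
  refine ((h1.add h2).const_mul 8).mono' (by fun_prop) (Filter.Eventually.of_forall fun p => ?_)
  rw [Real.norm_of_nonneg (by positivity)]
  exact add_pow_four_le _ _

theorem integrable_pow_four_of_abs_le {F : E × E → ℝ} (hF : Continuous F) {C : ℝ}
    (h : ∀ p, |F p| ≤ C * (‖p.1‖ + ‖p.2‖)) :
    Integrable (fun p => F p ^ 4) ((stdGaussian E).prod (stdGaussian E)) := by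
  refine (integrable_add_norm_pow_four.const_mul (C ^ 4)).mono'
    (hF.pow 4).aestronglyMeasurable (Filter.Eventually.of_forall fun p => ?_)
  rw [norm_pow, ← mul_pow, Real.norm_eq_abs]
  exact pow_le_pow_left₀ (abs_nonneg _) (h p) 4

theorem abs_sub_comp_rotation_le {L : NNReal} {H : E → ℝ} (hH : LipschitzWith L H)
    (a b c d : ℝ) (p : E × E) :
    |H (a • p.1 + b • p.2) - H (c • p.1 + d • p.2)| ≤
      L * (|a - c| * ‖p.1‖ + |b - d| * ‖p.2‖) := by
  have h := hH.dist_le_mul (a • p.1 + b • p.2) (c • p.1 + d • p.2)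
  rw [Real.dist_eq, dist_eq_norm] at h
  refine h.trans ?_
  gcongr
  have : a • p.1 + b • p.2 - (c • p.1 + d • p.2) = (a - c) • p.1 + (b - d) • p.2 := by
    rw [sub_smul, sub_smul]; abel
  rw [this]
  refine (norm_add_le _ _).trans (le_of_eq ?_)
  simp [norm_smul]

theorem sum_pow_four_le (n : ℕ) (a : ℕ → ℝ) :
    (∑ j ∈ Finset.range n, a j) ^ 4 ≤ (n : ℝ) ^ 3 * ∑ j ∈ Finset.range n, a j ^ 4 := by
  rcases Nat.eq_zero_or_pos n with rfl | hn
  · simp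
  have h := pow_sum_div_card_le_sum_pow (s := Finset.range n) (f := fun j => |a j|)
    (fun _ _ => abs_nonneg _) 3
  rw [Finset.card_range, div_le_iff₀ (by positivity)] at h
  calc (∑ j ∈ Finset.range n, a j) ^ 4 = |∑ j ∈ Finset.range n, a j| ^ 4 :=
        (Even.pow_abs (by decide) _).symm
    _ ≤ (∑ j ∈ Finset.range n, |a j|) ^ 4 :=
        pow_le_pow_left₀ (abs_nonneg _) (Finset.abs_sum_le_sum_abs _ _) 4
    _ ≤ _ := by
        refine h.trans (le_of_eq ?_)
        rw [mul_comm]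
        congr 1
        exact Finset.sum_congr rfl fun j _ => Even.pow_abs (by decide) _

/-- The path `cos θ • x + sin θ • y` leads from `x` to `-x` as `θ` runs from `0` to `π`. Cut into
`n` steps, its increments of `H` all have the same law, because the Gaussian pair is rotation
invariant. The power mean inequality contributes `n³` and the number of steps one more factor `n`.
-/
theorem integral_sub_neg_pow_four_le_rotation {L : NNReal} {H : E → ℝ} (hH : LipschitzWith L H)
    {n : ℕ} (hn : 1 ≤ n) :
    ∫ x, (H (-x) - H x) ^ 4 ∂stdGaussian E ≤
      (n : ℝ) ^ 4 * ∫ p : E × E,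
        (H (Real.cos (Real.pi / n) • p.1 + Real.sin (Real.pi / n) • p.2) - H p.1) ^ 4
          ∂(stdGaussian E).prod (stdGaussian E) := by
  set γ := (stdGaussian E).prod (stdGaussian E) with hγ
  set δ : ℝ := Real.pi / n with hδ
  have hn0 : (n : ℝ) ≠ 0 := by positivity
  set X : ℕ → E × E → E := fun j p => Real.cos (j * δ) • p.1 + Real.sin (j * δ) • p.2 with hX
  have hc := hH.continuous
  have hstep : ∀ j, ∫ p, (H (X (j + 1) p) - H (X j p)) ^ 4 ∂γ =
      ∫ p : E × E, (H (Real.cos δ • p.1 + Real.sin δ • p.2) - H p.1) ^ 4 ∂γ := by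
    intro j
    have hrot : γ.map (ContinuousLinearMap.rotation (j * δ)) = γ :=
      IsGaussian.map_rotation_eq_self (by simp) _
    conv_rhs => rw [← hrot]
    rw [integral_map (by fun_prop) (Continuous.aestronglyMeasurable (by fun_prop))]
    refine integral_congr_ae (Filter.Eventually.of_forall fun p => ?_)
    have hj : ((j + 1 : ℕ) : ℝ) * δ = j * δ + δ := by push_cast; ring
    have : X (j + 1) p = Real.cos δ • (ContinuousLinearMap.rotation (j * δ) p).1 +
        Real.sin δ • (ContinuousLinearMap.rotation (j * δ) p).2 := by
      simp only [ContinuousLinearMap.rotation_apply, hX]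
      rw [hj, Real.cos_add, Real.sin_add]
      module
    simp only [this]
    rfl
  have hint : ∀ j, Integrable (fun p => (H (X (j + 1) p) - H (X j p)) ^ 4) γ := by
    intro j
    refine integrable_pow_four_of_abs_le (C := 2 * L) (by simp only [hX]; fun_prop) fun p => ?_
    refine (abs_sub_comp_rotation_le hH _ _ _ _ p).trans ?_
    have h1 : |Real.cos ((j + 1 : ℕ) * δ) - Real.cos (j * δ)| ≤ 2 := by
      rw [abs_le]
      constructor <;> linarith [Real.cos_le_one ((j + 1 : ℕ) * δ), Real.cos_le_one (j * δ),
        Real.neg_one_le_cos ((j + 1 : ℕ) * δ), Real.neg_one_le_cos (j * δ)]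
    have h2 : |Real.sin ((j + 1 : ℕ) * δ) - Real.sin (j * δ)| ≤ 2 := by
      rw [abs_le]
      constructor <;> linarith [Real.sin_le_one ((j + 1 : ℕ) * δ), Real.sin_le_one (j * δ),
        Real.neg_one_le_sin ((j + 1 : ℕ) * δ), Real.neg_one_le_sin (j * δ)]
    calc (L : ℝ) * (_ * ‖p.1‖ + _ * ‖p.2‖) ≤ L * (2 * ‖p.1‖ + 2 * ‖p.2‖) := by gcongr
      _ = _ := by ring
  have htel : ∀ p, H (-p.1) - H p.1 = ∑ j ∈ Finset.range n, (H (X (j + 1) p) - H (X j p)) := by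
    intro p
    rw [Finset.sum_range_sub (fun j => H (X j p))]
    have : (n : ℝ) * δ = Real.pi := by rw [hδ]; field_simp
    simp [hX, this]
  calc ∫ x, (H (-x) - H x) ^ 4 ∂stdGaussian E
      = ∫ p : E × E, (H (-p.1) - H p.1) ^ 4 ∂γ := by
        rw [hγ, integral_fun_fst (fun x => (H (-x) - H x) ^ 4)]
        simp
    _ ≤ ∫ p, (n : ℝ) ^ 3 * ∑ j ∈ Finset.range n, (H (X (j + 1) p) - H (X j p)) ^ 4 ∂γ := by
        refine integral_mono_of_nonneg (Filter.Eventually.of_forall fun p => by positivity)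
          ((integrable_finsetSum _ fun j _ => hint j).const_mul _)
          (Filter.Eventually.of_forall fun p => ?_)
        simp only
        rw [htel]
        exact sum_pow_four_le n _
    _ = _ := by
        rw [integral_const_mul, integral_finsetSum _ fun j _ => hint j]
        simp only [hstep, Finset.sum_const, Finset.card_range, nsmul_eq_mul]
        ring

/-- Concentration of a Lipschitz function of a standard Gaussian vector, in fourth moment. -/
theorem integral_sub_neg_pow_four_le {L : NNReal} {H : E → ℝ} (hH : LipschitzWith L H) :
    ∫ x, (H (-x) - H x) ^ 4 ∂stdGaussian E ≤
      Real.pi ^ 4 * (2 * (4 * Real.exp 1) ^ 2) * L ^ 4 := by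
  set γ := (stdGaussian E).prod (stdGaussian E) with hγ
  have hc := hH.continuous
  set F : ℕ → E × E → ℝ := fun k p => ((k + 1 : ℕ) *
    (H (Real.cos (Real.pi / (k + 1 : ℕ)) • p.1 + Real.sin (Real.pi / (k + 1 : ℕ)) • p.2) -
      H p.1)) ^ 4 with hF
  -- Rademacher's theorem; the Gaussian measure is absolutely continuous.
  have hdiff : ∀ᵐ p ∂γ, DifferentiableAt ℝ H p.1 :=
    Measure.quasiMeasurePreserving_fst.ae
      (stdGaussian_absolutelyContinuous.ae_le hH.ae_differentiableAt)
  -- As the number of steps grows, the rescaled first increment tends to `π DH(x) y`.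
  have hlim : Filter.Tendsto (fun k => ∫ p, F k p ∂γ) Filter.atTop
      (nhds (∫ p, (Real.pi * fderiv ℝ H p.1 p.2) ^ 4 ∂γ)) := by
    refine tendsto_integral_of_dominated_convergence
      (fun p => (L * Real.pi) ^ 4 * (‖p.1‖ + ‖p.2‖) ^ 4)
      (fun k => Continuous.aestronglyMeasurable (by simp only [hF]; fun_prop))
      (integrable_add_norm_pow_four.const_mul _) ?_ ?_
    · intro k
      refine Filter.Eventually.of_forall fun p => ?_
      rw [norm_pow, ← mul_pow]
      refine pow_le_pow_left₀ (norm_nonneg _) ?_ 4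
      set δ : ℝ := Real.pi / (k + 1 : ℕ) with hδ
      have hδ0 : 0 ≤ δ := by positivity
      have h := abs_sub_comp_rotation_le hH (Real.cos δ) (Real.sin δ) 1 0 p
      simp only [one_smul, zero_smul, add_zero, sub_zero] at h
      have h1 : |Real.cos δ - 1| ≤ δ := by
        have := Real.abs_sin_le_one
        have h2 : Real.cos δ - 1 = -2 * Real.sin (δ / 2) ^ 2 := by
          rw [Real.sin_sq, Real.cos_sq]; ring_nf
        rw [h2, abs_mul, abs_neg, abs_two, abs_pow]
        have h3 : |Real.sin (δ / 2)| ≤ δ / 2 := by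
          have := Real.abs_sin_le_abs (x := δ / 2)
          rwa [abs_of_nonneg (by positivity : 0 ≤ δ / 2)] at this
        nlinarith [abs_nonneg (Real.sin (δ / 2)), Real.abs_sin_le_one (δ / 2)]
      have h2 : |Real.sin δ| ≤ δ := by
        have := Real.abs_sin_le_abs (x := δ)
        rwa [abs_of_nonneg hδ0] at this
      have hkδ : ((k + 1 : ℕ) : ℝ) * δ = Real.pi := by rw [hδ]; field_simp
      rw [norm_mul, Real.norm_natCast, Real.norm_eq_abs]
      calc ((k + 1 : ℕ) : ℝ) * |H (Real.cos δ • p.1 + Real.sin δ • p.2) - H p.1|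
          ≤ ((k + 1 : ℕ) : ℝ) * (L * (δ * ‖p.1‖ + δ * ‖p.2‖)) := by
            gcongr
            exact h.trans (by gcongr)
        _ = L * (((k + 1 : ℕ) : ℝ) * δ) * (‖p.1‖ + ‖p.2‖) := by ring
        _ = _ := by rw [hkδ]
    · filter_upwards [hdiff] with p hp
      refine Filter.Tendsto.pow ?_ 4
      have hcurve : HasDerivAt (fun s : ℝ => Real.cos s • p.1 + Real.sin s • p.2) p.2 0 := by
        have := ((Real.hasDerivAt_cos 0).smul_const p.1).add
          ((Real.hasDerivAt_sin 0).smul_const p.2)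
        simp only [Real.sin_zero, neg_zero, zero_smul, Real.cos_zero, one_smul, zero_add] at this
        exact this
      have hp' : HasFDerivAt H (fderiv ℝ H p.1)
          ((fun s : ℝ => Real.cos s • p.1 + Real.sin s • p.2) 0) := by
        simpa using hp.hasFDerivAt
      have hcomp := hp'.comp_hasDerivAt (0 : ℝ) hcurve
      have hslope := hcomp.tendsto_slope_zero
      have hδ : Filter.Tendsto (fun k : ℕ => Real.pi / (k + 1 : ℕ)) Filter.atTop
          (nhdsWithin 0 {0}ᶜ) := by
        refine tendsto_nhdsWithin_iff.2 ⟨?_, Filter.Eventually.of_forall fun k => ?_⟩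
        · exact (tendsto_const_div_atTop_nhds_zero_nat Real.pi).comp
            (Filter.tendsto_add_atTop_nat 1)
        · simp only [Set.mem_compl_iff, Set.mem_singleton_iff]
          positivity
      have := (hslope.comp hδ).const_mul Real.pi
      refine this.congr fun k => ?_
      have hk : ((k + 1 : ℕ) : ℝ) ≠ 0 := by positivity
      simp only [Function.comp, zero_add, Real.cos_zero, Real.sin_zero, one_smul, zero_smul,
        add_zero, smul_eq_mul]
      have := Real.pi_ne_zero
      field_simp
  have hle : ∫ x, (H (-x) - H x) ^ 4 ∂stdGaussian E ≤
      ∫ p, (Real.pi * fderiv ℝ H p.1 p.2) ^ 4 ∂γ := by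
    refine ge_of_tendsto' hlim fun k => ?_
    refine (integral_sub_neg_pow_four_le_rotation hH (n := k + 1) (by omega)).trans (le_of_eq ?_)
    rw [← integral_const_mul]
    simp only [hF, mul_pow]
    rfl
  refine hle.trans ?_
  have hmeas : Measurable fun p : E × E => (Real.pi * fderiv ℝ H p.1 p.2) ^ 4 := by
    have h1 : Measurable fun p : E × E => fderiv ℝ H p.1 :=
      (measurable_fderiv ℝ H).comp measurable_fst
    have h2 : Measurable fun p : E × E => fderiv ℝ H p.1 p.2 :=
      (isBoundedBilinearMap_apply (𝕜 := ℝ) (E := E) (F := ℝ)).continuous.measurable.comp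
        (h1.prodMk measurable_snd)
    exact (h2.const_mul _).pow_const 4
  have hfd : ∀ x, ‖fderiv ℝ H x‖ ≤ L := fun x => norm_fderiv_le_of_lipschitz ℝ hH
  have hintg : Integrable (fun p : E × E => (Real.pi * fderiv ℝ H p.1 p.2) ^ 4) γ := by
    refine (integrable_add_norm_pow_four.const_mul ((L * Real.pi) ^ 4)).mono'
      hmeas.aestronglyMeasurable (Filter.Eventually.of_forall fun p => ?_)
    rw [norm_pow, ← mul_pow]
    refine pow_le_pow_left₀ (norm_nonneg _) ?_ 4
    rw [norm_mul, Real.norm_of_nonneg Real.pi_pos.le]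
    calc Real.pi * ‖fderiv ℝ H p.1 p.2‖ ≤ Real.pi * (L * ‖p.2‖) := by
          gcongr
          exact (fderiv ℝ H p.1).le_of_opNorm_le (hfd _) _
      _ ≤ L * Real.pi * (‖p.1‖ + ‖p.2‖) := by
          have : 0 ≤ L * Real.pi * ‖p.1‖ := by positivity
          linarith
  rw [hγ, integral_prod _ hintg]
  -- For fixed `x` the variable `DH(x) y` is a linear functional of norm at most `L` of a Gaussian
  -- vector, so the moment bound with `k = 2` applies.
  have hbound : ∀ x, ∫ y, (Real.pi * fderiv ℝ H x y) ^ 4 ∂stdGaussian E ≤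
      Real.pi ^ 4 * (2 * (4 * Real.exp 1) ^ 2) * L ^ 4 := by
    intro x
    set v := (InnerProductSpace.toDual ℝ E).symm (fderiv ℝ H x) with hv
    have hvn : ‖v‖ ≤ L := by rw [hv, LinearIsometryEquiv.norm_map]; exact hfd x
    have h1 : ∀ y, fderiv ℝ H x y = inner ℝ v y := fun y => by
      rw [hv, InnerProductSpace.toDual_symm_apply]
    simp_rw [h1, mul_pow Real.pi]
    rw [integral_const_mul, mul_assoc]
    gcongr
    have h2 := integral_stdGaussian_inner_pow_le v 2
    have h3 : (2 : ℝ) * (2 : ℕ) * Real.exp 1 = 4 * Real.exp 1 := by norm_num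
    rw [h3] at h2
    exact h2.trans (by gcongr)
  refine (integral_mono_of_nonneg (Filter.Eventually.of_forall fun x => integral_nonneg fun y => ?_)
    (integrable_const _) (Filter.Eventually.of_forall hbound)).trans (by simp)
  positivity

/-- The scaled difference of directions equals `(‖y‖ - ‖x‖) x/‖x‖ + (x - y)`, and both terms are at
most `‖x - y‖`. -/
theorem norm_direction_sub_le {x y : E} (hx : x ≠ 0) (hy : y ≠ 0) :
    ‖y‖ * ‖‖x‖⁻¹ • x - ‖y‖⁻¹ • y‖ ≤ 2 * ‖x - y‖ := by
  have hx' : ‖x‖ ≠ 0 := norm_ne_zero_iff.2 hx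
  have hy' : ‖y‖ ≠ 0 := norm_ne_zero_iff.2 hy
  have h1 : ‖y‖ * ‖‖x‖⁻¹ • x - ‖y‖⁻¹ • y‖ = ‖(‖y‖ - ‖x‖) • (‖x‖⁻¹ • x) + (x - y)‖ := by
    rw [← norm_norm y, ← norm_smul, norm_norm]
    congr 1
    rw [smul_sub, sub_smul, smul_smul ‖y‖ ‖y‖⁻¹, mul_inv_cancel₀ hy', smul_smul ‖x‖ ‖x‖⁻¹,
      mul_inv_cancel₀ hx']
    module
  rw [h1]
  refine (norm_add_le _ _).trans ?_
  rw [norm_smul, norm_smul, norm_inv, norm_norm, inv_mul_cancel₀ hx', mul_one]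
  have : ‖‖y‖ - ‖x‖‖ ≤ ‖x - y‖ := by
    rw [norm_sub_rev x y]; exact abs_norm_sub_norm_le y x
  linarith

/-- The fourth moment of the odd part of a Lipschitz function on the sphere. -/
theorem integral_unitSphereMeasure_sub_neg_pow_four_le [Nontrivial E] {h : E → ℝ} {L : ℝ}
    (hL : 0 ≤ L) (hh : ∀ x y : E, ‖x‖ = 1 → ‖y‖ = 1 → |h x - h y| ≤ L * ‖x - y‖) :
    ∫ e, (h e - h (-e)) ^ 4 ∂unitSphereMeasure E ≤
      Real.pi ^ 4 * (2 * (4 * Real.exp 1) ^ 2) * (6 * L) ^ 4 / (Module.finrank ℝ E : ℝ) ^ 2 := by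
  set g : E → ℝ := fun e => h e - h (-e) with hg
  have hgodd : ∀ e, g (-e) = -g e := fun e => by simp [hg]
  have hglip : ∀ x y : E, ‖x‖ = 1 → ‖y‖ = 1 → |g x - g y| ≤ 2 * L * ‖x - y‖ := by
    intro x y hx hy
    have h1 := hh x y hx hy
    have h2 := hh (-x) (-y) (by simpa) (by simpa)
    rw [neg_sub_neg, norm_sub_rev] at h2
    have : g x - g y = (h x - h y) - (h (-x) - h (-y)) := by simp only [hg]; ring
    rw [this]
    refine (abs_sub _ _).trans ?_
    linarith
  have hgb : ∀ x : E, ‖x‖ = 1 → |g x| ≤ 2 * L := by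
    intro x hx
    have h1 := hglip x (-x) hx (by simpa)
    rw [hgodd, sub_neg_eq_add, sub_neg_eq_add, ← two_mul, ← two_smul ℝ x, norm_smul, hx,
      abs_mul] at h1
    norm_num at h1
    linarith
  have hunit : ∀ x : E, x ≠ 0 → ‖‖x‖⁻¹ • x‖ = 1 := fun x hx => by
    rw [norm_smul, norm_inv, norm_norm, inv_mul_cancel₀ (norm_ne_zero_iff.2 hx)]
  -- The extension of the odd part, homogeneous of degree one. Its Lipschitz constant `6 L` is `2 L`
  -- from the change of the norm, since oddness gives `|g| ≤ 2 L` on the sphere, plus `2 L · 2` from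
  -- the change of the direction.
  set H : E → ℝ := fun x => ‖x‖ * g (‖x‖⁻¹ • x) with hHdef
  have hH : LipschitzWith (Real.toNNReal (6 * L)) H := by
    refine LipschitzWith.of_dist_le_mul fun x y => ?_
    rw [Real.coe_toNNReal _ (by positivity), Real.dist_eq, dist_eq_norm]
    rcases eq_or_ne x 0 with rfl | hx
    · rcases eq_or_ne y 0 with rfl | hy
      · simp
      · have := hgb _ (hunit y hy)
        simp only [hHdef, norm_zero, zero_mul, zero_sub, abs_neg, norm_neg, abs_mul, abs_norm]
        nlinarith [norm_nonneg y]
    · rcases eq_or_ne y 0 with rfl | hy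
      · have := hgb _ (hunit x hx)
        simp only [hHdef, norm_zero, zero_mul, sub_zero, abs_mul, abs_norm]
        nlinarith [norm_nonneg x]
      · have h1 := hgb _ (hunit x hx)
        have h2 := hglip _ _ (hunit x hx) (hunit y hy)
        have h3 := norm_direction_sub_le hx hy
        have h4 : |‖x‖ - ‖y‖| ≤ ‖x - y‖ := abs_norm_sub_norm_le x y
        have : H x - H y = (‖x‖ - ‖y‖) * g (‖x‖⁻¹ • x) +
            ‖y‖ * (g (‖x‖⁻¹ • x) - g (‖y‖⁻¹ • y)) := by simp only [hHdef]; ring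
        rw [this]
        refine (abs_add_le _ _).trans ?_
        rw [abs_mul, abs_mul, abs_norm]
        calc |‖x‖ - ‖y‖| * |g (‖x‖⁻¹ • x)| + ‖y‖ * |g (‖x‖⁻¹ • x) - g (‖y‖⁻¹ • y)|
            ≤ ‖x - y‖ * (2 * L) + ‖y‖ * (2 * L * ‖‖x‖⁻¹ • x - ‖y‖⁻¹ • y‖) := by gcongr
          _ = ‖x - y‖ * (2 * L) + 2 * L * (‖y‖ * ‖‖x‖⁻¹ • x - ‖y‖⁻¹ • y‖) := by ring
          _ ≤ ‖x - y‖ * (2 * L) + 2 * L * (2 * ‖x - y‖) := by gcongr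
          _ = 6 * L * ‖x - y‖ := by ring
  have hconc := integral_sub_neg_pow_four_le hH
  rw [Real.coe_toNNReal _ (by positivity)] at hconc
  -- Direction and norm separate here; dividing by `𝔼‖x‖⁴ ≥ d²` leaves the spherical moment. The
  -- factor `16` is simply discarded.
  have hHneg : ∀ x, (H (-x) - H x) ^ 4 = 16 * (g (‖x‖⁻¹ • x) ^ 4 * ‖x‖ ^ 4) := fun x => by
    simp only [hHdef, norm_neg, smul_neg, hgodd]
    ring
  simp_rw [hHneg] at hconc
  rw [integral_const_mul, integral_direction_mul_norm_stdGaussian (fun e => g e ^ 4)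
    (fun r => r ^ 4)] at hconc
  have hd : (0 : ℝ) < Module.finrank ℝ E := by exact_mod_cast Module.finrank_pos
  have h5 := finrank_pow_le_integral_stdGaussian_norm_pow (E := E) 2
  have h6 : 0 ≤ ∫ e, g e ^ 4 ∂unitSphereMeasure E := integral_nonneg fun e => by positivity
  rw [le_div_iff₀ (by positivity)]
  norm_num at h5
  have h7 := mul_le_mul_of_nonneg_left h5 h6
  have h8 : 0 ≤ (∫ e, g e ^ 4 ∂unitSphereMeasure E) * ∫ x : E, ‖x‖ ^ 4 ∂stdGaussian E :=
    mul_nonneg h6 (integral_nonneg fun e => by positivity)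
  linarith

end Concentration

/-! ### A divergence theorem on the ball for one-sided difference quotients. -/

section Smoothing

variable {E : Type*} [NormedAddCommGroup E] [InnerProductSpace ℝ E] [FiniteDimensional ℝ E]
  [MeasurableSpace E] [BorelSpace E]

/-- The radial profile equal to `1` on `[0, 1 - η]`, to `0` on `[1, ∞)`, and linear in between. -/
def radialCutoff (η r : ℝ) : ℝ := min 1 (max 0 ((1 - r) / η))

theorem radialCutoff_nonneg (η r : ℝ) : 0 ≤ radialCutoff η r :=
  le_min zero_le_one (le_max_left _ _)

theorem radialCutoff_le_one (η r : ℝ) : radialCutoff η r ≤ 1 := min_le_left _ _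

theorem radialCutoff_eq_zero {η r : ℝ} (hη : 0 < η) (hr : 1 ≤ r) : radialCutoff η r = 0 := by
  rw [radialCutoff, max_eq_left (div_nonpos_of_nonpos_of_nonneg (by linarith) hη.le)]
  simp

theorem radialCutoff_eq_one {η r : ℝ} (hη : 0 < η) (hr : r ≤ 1 - η) : radialCutoff η r = 1 := by
  have : 1 ≤ (1 - r) / η := (one_le_div hη).2 (by linarith)
  rw [radialCutoff, max_eq_right (by linarith), min_eq_left this]

theorem radialCutoff_eq_div {η r : ℝ} (hη : 0 < η) (h1 : 1 - η ≤ r) (h2 : r ≤ 1) :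
    radialCutoff η r = (1 - r) / η := by
  rw [radialCutoff, max_eq_right (div_nonneg (by linarith) hη.le),
    min_eq_right ((div_le_one hη).2 (by linarith))]

theorem continuous_radialCutoff (η : ℝ) : Continuous (radialCutoff η) := by
  unfold radialCutoff; fun_prop

theorem abs_radialCutoff_sub_le {η : ℝ} (hη : 0 < η) (r s : ℝ) :
    |radialCutoff η r - radialCutoff η s| ≤ |r - s| / η := by
  unfold radialCutoff
  refine (abs_min_sub_min_le_max _ _ _ _).trans ?_
  rw [sub_self, abs_zero, max_eq_right (abs_nonneg _)]
  refine (abs_max_sub_max_le_max _ _ _ _).trans ?_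
  rw [sub_self, abs_zero, max_eq_right (abs_nonneg _), ← sub_div, abs_div, abs_of_pos hη]
  refine le_of_eq ?_
  rw [show 1 - r - (1 - s) = s - r by ring, abs_sub_comm]

theorem hasCompactSupport_radialCutoff {η : ℝ} (hη : 0 < η) :
    HasCompactSupport fun v : E => radialCutoff η ‖v‖ := by
  refine HasCompactSupport.intro (isCompact_closedBall (0 : E) 1) fun v hv => ?_
  rw [mem_closedBall_zero_iff, not_le] at hv
  exact radialCutoff_eq_zero hη hv.le

theorem hasDerivAt_norm_add_smul {v : E} (hv : v ≠ 0) (u : E) :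
    HasDerivAt (fun t : ℝ => ‖v + t • u‖) (inner ℝ (‖v‖⁻¹ • v) u) 0 := by
  have h1 : HasDerivAt (fun t : ℝ => v + t • u) u 0 := by
    simpa using ((hasDerivAt_id (0 : ℝ)).smul_const u).const_add v
  have h2 := h1.norm_sq.sqrt (by simpa using hv)
  simp only [Real.sqrt_sq (norm_nonneg _), zero_smul, add_zero] at h2
  convert h2 using 1
  rw [inner_smul_left]
  simp
  field_simp

/-- Away from the two boundary spheres, the derivative of the radial cutoff along a line. -/
theorem hasDerivAt_radialCutoff {η : ℝ} (hη : 0 < η) (hη1 : η < 1) {v : E} (h1 : ‖v‖ ≠ 1)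
    (h2 : ‖v‖ ≠ 1 - η) (u : E) :
    HasDerivAt (fun t : ℝ => radialCutoff η ‖v + t • u‖)
      (-((Set.Ioo (1 - η) 1).indicator (fun _ => 1 / η) ‖v‖ * inner ℝ (‖v‖⁻¹ • v) u)) 0 := by
  have hcont : Filter.Tendsto (fun t : ℝ => ‖v + t • u‖) (nhds 0) (nhds ‖v‖) := by
    have : Continuous fun t : ℝ => ‖v + t • u‖ := by fun_prop
    simpa using this.tendsto 0
  rcases lt_or_gt_of_ne h2 with h | h
  · rw [Set.indicator_of_notMem (fun hm => by linarith [hm.1])]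
    simp only [zero_mul, neg_zero]
    refine (hasDerivAt_const (0 : ℝ) (1 : ℝ)).congr_of_eventuallyEq ?_
    filter_upwards [hcont.eventually_lt_const h] with t ht
    exact radialCutoff_eq_one hη ht.le
  rcases lt_or_gt_of_ne h1 with h' | h'
  · rw [Set.indicator_of_mem (Set.mem_Ioo.2 ⟨h, h'⟩)]
    have hv : v ≠ 0 := by
      rintro rfl
      simp at h
      linarith
    have hd := ((hasDerivAt_norm_add_smul hv u).const_sub 1).div_const η
    have : -(1 / η * inner ℝ (‖v‖⁻¹ • v) u) = -inner ℝ (‖v‖⁻¹ • v) u / η := by ring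
    rw [this]
    refine hd.congr_of_eventuallyEq ?_
    filter_upwards [hcont.eventually_lt_const h', hcont.eventually_const_lt h] with t ht ht'
    exact radialCutoff_eq_div hη ht'.le ht.le
  · rw [Set.indicator_of_notMem (fun hm => by linarith [hm.2])]
    simp only [zero_mul, neg_zero]
    refine (hasDerivAt_const (0 : ℝ) (0 : ℝ)).congr_of_eventuallyEq ?_
    filter_upwards [hcont.eventually_const_lt h'] with t ht
    exact radialCutoff_eq_zero hη ht.le

/-- Integration by parts against the radial cutoff, for one-sided difference quotients. -/
theorem mul_integral_radialCutoff_le {h : E → ℝ} (hh : Continuous h) {u₁ u₂ : E} {A : ℝ}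
    (hA : ∀ v : E, ‖v‖ ≤ 1 → ∀ t : ℝ, 0 < t → t ≤ 1 →
      t * A ≤ h (v - t • u₂) - h (v - t • u₁)) {η : ℝ} (hη : 0 < η) (hη1 : η < 1) [Nontrivial E] :
    A * ∫ v : E, radialCutoff η ‖v‖ ≤
      ∫ v : E, h v * ((Set.Ioo (1 - η) 1).indicator (fun _ => 1 / η) ‖v‖ *
        inner ℝ (‖v‖⁻¹ • v) (u₁ - u₂)) := by
  set k : E → ℝ := fun v => radialCutoff η ‖v‖ with hk
  have hkc : Continuous k := (continuous_radialCutoff η).comp continuous_norm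
  have hkint : ∀ w : E, Integrable fun v => h (v - w) * k v := fun w =>
    Continuous.integrable_of_hasCompactSupport (by fun_prop)
      ((hasCompactSupport_radialCutoff hη).mul_left)
  have hkint' : ∀ w : E, Integrable fun v => h v * k (v + w) := fun w => by
    simpa using (hkint w).comp_add_right w
  -- Translation invariance moves the difference quotient from `h`, which need not be
  -- differentiable, to the cutoff.
  have htrans : ∀ w : E, ∫ v, h v * k (v + w) = ∫ v, h (v - w) * k v := fun w => by
    rw [← integral_add_right_eq_self (fun v => h (v - w) * k v) w]
    simp only [add_sub_cancel_right]
  set t : ℕ → ℝ := fun j => 1 / ((j : ℝ) + 1) with ht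
  have ht0 : ∀ j, 0 < t j := fun j => by positivity
  have ht1 : ∀ j, t j ≤ 1 := fun j => by
    rw [ht, div_le_one (by positivity)]; linarith [(Nat.cast_nonneg j : (0 : ℝ) ≤ j)]
  set R : ℝ := 1 + ‖u₁‖ + ‖u₂‖ with hR
  have hlim : Filter.Tendsto (fun j => ∫ v, h v * ((t j)⁻¹ * (k (v + t j • u₂) - k (v + t j • u₁))))
      Filter.atTop (nhds (∫ v : E, h v * ((Set.Ioo (1 - η) 1).indicator (fun _ => 1 / η) ‖v‖ *
        inner ℝ (‖v‖⁻¹ • v) (u₁ - u₂)))) := by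
    refine tendsto_integral_of_dominated_convergence
      ((Metric.closedBall (0 : E) R).indicator fun v => |h v| * (‖u₂ - u₁‖ / η))
      (fun j => Continuous.aestronglyMeasurable (by fun_prop)) ?_ ?_ ?_
    · rw [integrable_indicator_iff Metric.isClosed_closedBall.measurableSet]
      exact (Continuous.continuousOn (by fun_prop)).integrableOn_compact (isCompact_closedBall _ _)
    · intro j
      refine Filter.Eventually.of_forall fun v => ?_
      have hj := ht0 j
      by_cases hv : v ∈ Metric.closedBall (0 : E) R
      · rw [Set.indicator_of_mem hv, norm_mul, norm_mul, Real.norm_eq_abs, Real.norm_eq_abs,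
          Real.norm_eq_abs, abs_of_pos (inv_pos.2 hj)]
        gcongr
        calc (t j)⁻¹ * |k (v + t j • u₂) - k (v + t j • u₁)|
            ≤ (t j)⁻¹ * (|‖v + t j • u₂‖ - ‖v + t j • u₁‖| / η) := by
              gcongr
              exact abs_radialCutoff_sub_le hη _ _
          _ ≤ (t j)⁻¹ * (‖t j • (u₂ - u₁)‖ / η) := by
              gcongr
              refine (abs_norm_sub_norm_le _ _).trans (le_of_eq ?_)
              congr 1
              rw [smul_sub]; abel
          _ = ‖u₂ - u₁‖ / η := by
              rw [norm_smul, Real.norm_of_nonneg hj.le]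
              field_simp
      · rw [Set.indicator_of_notMem hv]
        have hbig : ∀ u : E, ‖u‖ ≤ ‖u₁‖ + ‖u₂‖ → k (v + t j • u) = 0 := by
          intro u hu
          refine radialCutoff_eq_zero hη ?_
          rw [mem_closedBall_zero_iff, not_le] at hv
          have h1 : ‖v‖ ≤ ‖v + t j • u‖ + ‖t j • u‖ := by
            simpa using norm_sub_le (v + t j • u) (t j • u)
          have h2 : ‖t j • u‖ ≤ ‖u‖ := by
            rw [norm_smul, Real.norm_of_nonneg hj.le]
            exact mul_le_of_le_one_left (norm_nonneg _) (ht1 j)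
          linarith
        rw [hbig u₁ (by linarith [norm_nonneg u₂]), hbig u₂ (by linarith [norm_nonneg u₁])]
        simp
    -- The two spheres on which the cutoff has a kink are null sets.
    · have hs1 : ∀ᵐ v : E, ‖v‖ ≠ 1 := by
        have := Measure.addHaar_sphere (volume : Measure E) 0 1
        filter_upwards [measure_eq_zero_iff_ae_notMem.1 this] with v hv
        simpa using hv
      have hs2 : ∀ᵐ v : E, ‖v‖ ≠ 1 - η := by
        have := Measure.addHaar_sphere (volume : Measure E) 0 (1 - η)
        filter_upwards [measure_eq_zero_iff_ae_notMem.1 this] with v hv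
        simpa using hv
      filter_upwards [hs1, hs2] with v hv1 hv2
      refine Filter.Tendsto.const_mul _ ?_
      have hd := (hasDerivAt_radialCutoff hη hη1 hv1 hv2 u₂).sub
        (hasDerivAt_radialCutoff hη hη1 hv1 hv2 u₁)
      have htt : Filter.Tendsto t Filter.atTop (nhdsWithin 0 {0}ᶜ) :=
        tendsto_nhdsWithin_iff.2 ⟨tendsto_one_div_add_atTop_nhds_zero_nat,
          Filter.Eventually.of_forall fun j => (ht0 j).ne'⟩
      have := hd.tendsto_slope_zero.comp htt
      rw [show (Set.Ioo (1 - η) 1).indicator (fun _ => 1 / η) ‖v‖ *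
          inner ℝ (‖v‖⁻¹ • v) (u₁ - u₂) =
        -((Set.Ioo (1 - η) 1).indicator (fun _ => 1 / η) ‖v‖ * inner ℝ (‖v‖⁻¹ • v) u₂) -
          -((Set.Ioo (1 - η) 1).indicator (fun _ => 1 / η) ‖v‖ * inner ℝ (‖v‖⁻¹ • v) u₁) by
        rw [inner_sub_right]; ring]
      refine this.congr fun j => ?_
      simp [hk]
  refine ge_of_tendsto' hlim fun j => ?_
  have hj := ht0 j
  have e1 : ∀ v, h v * ((t j)⁻¹ * (k (v + t j • u₂) - k (v + t j • u₁))) =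
      (t j)⁻¹ * (h v * k (v + t j • u₂) - h v * k (v + t j • u₁)) := fun v => by ring
  simp_rw [e1]
  rw [integral_const_mul, integral_sub (hkint' _) (hkint' _), htrans, htrans,
    ← integral_sub (hkint _) (hkint _), ← integral_const_mul, ← integral_const_mul]
  refine integral_mono ?_ (((hkint _).sub (hkint _)).const_mul _) fun v => ?_
  · exact (hkc.integrable_of_hasCompactSupport (hasCompactSupport_radialCutoff hη)).const_mul A
  · simp only
    rw [← sub_mul, ← mul_assoc]
    -- Outside the unit ball the cutoff vanishes, so the hypothesis is needed on the ball only.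
    by_cases hv : ‖v‖ ≤ 1
    · refine mul_le_mul_of_nonneg_right ?_ (radialCutoff_nonneg _ _)
      rw [inv_mul_eq_div, le_div_iff₀ hj, mul_comm]
      exact hA v hv (t j) hj (ht1 j)
    · have : k v = 0 := radialCutoff_eq_zero hη (not_le.1 hv).le
      rw [show radialCutoff η ‖v‖ = k v from rfl, this]
      simp

theorem integral_indicator_ball_diff (η : ℝ) (hη : 0 < η) (hη1 : η < 1) [Nontrivial E] :
    ∫ v : E, (Set.Ioo (1 - η) 1).indicator (fun _ => 1 / η) ‖v‖ =
      (volume : Measure E).real (Metric.ball 0 1) * ((1 - (1 - η) ^ Module.finrank ℝ E) / η) := by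
  have hset : ∀ v : E, (Set.Ioo (1 - η) 1).indicator (fun _ => 1 / η) ‖v‖ =
      (Metric.ball (0 : E) 1 \ Metric.closedBall 0 (1 - η)).indicator (fun _ => 1 / η) v := by
    intro v
    simp [Set.indicator, and_comm]
  simp_rw [hset]
  rw [integral_indicator (measurableSet_ball.diff Metric.isClosed_closedBall.measurableSet),
    setIntegral_const, smul_eq_mul, measureReal_sdiff
      (Metric.closedBall_subset_ball (by linarith)) Metric.isClosed_closedBall.measurableSet,
    Measure.addHaar_real_closedBall _ _ (by linarith)]
  ring

/-- The relative volume of a thin shell per unit thickness tends to `d`, the derivative of `1 - (1 -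
x)^d` at `0`. This is the source of the factor `d` in the estimator; the shift by `2` keeps the
thickness below `1`. -/
theorem tendsto_one_sub_pow_div (d : ℕ) :
    Filter.Tendsto (fun j : ℕ => (1 - (1 - 1 / ((j : ℝ) + 2)) ^ d) / (1 / ((j : ℝ) + 2)))
      Filter.atTop (nhds d) := by
  have hd : HasDerivAt (fun x : ℝ => 1 - (1 - x) ^ d) d 0 := by
    have := (((hasDerivAt_id (0 : ℝ)).const_sub 1).pow d).const_sub 1
    simpa using this
  have ht : Filter.Tendsto (fun j : ℕ => 1 / ((j : ℝ) + 2)) Filter.atTop (nhdsWithin 0 {0}ᶜ) := by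
    refine tendsto_nhdsWithin_iff.2 ⟨?_, Filter.Eventually.of_forall fun j => ?_⟩
    · have := (tendsto_one_div_add_atTop_nhds_zero_nat (𝕜 := ℝ)).comp (Filter.tendsto_add_atTop_nat 1)
      refine this.congr fun j => ?_
      simp only [Function.comp]
      push_cast
      ring
    · simp only [Set.mem_compl_iff, Set.mem_singleton_iff]
      positivity
  refine (hd.tendsto_slope_zero.comp ht).congr fun j => ?_
  simp [div_eq_mul_inv, mul_comm]

/-- One-sided bounds on difference quotients bound the surface integral which, for a smooth
function, is the gradient of its average over the unit ball. -/
theorem le_finrank_mul_integral_sphere [Nontrivial E] {L : NNReal} {h : E → ℝ}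
    (hh : LipschitzWith L h) {u₁ u₂ : E} {A : ℝ}
    (hA : ∀ v : E, ‖v‖ ≤ 1 → ∀ t : ℝ, 0 < t → t ≤ 1 →
      t * A ≤ h (v - t • u₂) - h (v - t • u₁)) :
    A ≤ Module.finrank ℝ E * ∫ e, h e * inner ℝ e (u₁ - u₂) ∂unitSphereMeasure E := by
  set w := u₁ - u₂ with hw
  set J := ∫ e, h e * inner ℝ e w ∂unitSphereMeasure E with hJ
  set V := (volume : Measure E).real (Metric.ball 0 1) with hV
  have hV0 : 0 < V := by
    rw [hV, measureReal_def]
    exact ENNReal.toReal_pos (Metric.measure_ball_pos _ _ one_pos).ne' measure_ball_lt_top.ne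
  set d := Module.finrank ℝ E with hd
  have hη : ∀ η : ℝ, 0 < η → η < 1 → A * ((∫ v : E, radialCutoff η ‖v‖) / V) ≤
      (1 - (1 - η) ^ d) / η * (J + L * η * ‖w‖) := by
    intro η hη hη1
    have h1 := mul_integral_radialCutoff_le hh.continuous hA hη hη1
    -- On the shell, replacing `h v` by its value at the direction of `v` costs at most `L η ‖w‖`.
    -- The new integrand is a function of the direction times a function of the norm, so polar
    -- coordinates apply.
    have h2 : ∫ v : E, h v * ((Set.Ioo (1 - η) 1).indicator (fun _ => 1 / η) ‖v‖ *
          inner ℝ (‖v‖⁻¹ • v) w) ≤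
        ∫ v : E, (h (‖v‖⁻¹ • v) * inner ℝ (‖v‖⁻¹ • v) w + L * η * ‖w‖) *
          (Set.Ioo (1 - η) 1).indicator (fun _ => 1 / η) ‖v‖ := by
      have hind : Measurable fun v : E => (Set.Ioo (1 - η) 1).indicator (fun _ => 1 / η) ‖v‖ :=
        (measurable_const.indicator measurableSet_Ioo).comp measurable_norm
      have hdir : Measurable fun v : E => ‖v‖⁻¹ • v := by fun_prop
      have hfin : Integrable ((Metric.closedBall (0 : E) 1).indicator fun _ => (1 : ℝ)) := by
        rw [integrable_indicator_iff Metric.isClosed_closedBall.measurableSet]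
        exact (Continuous.continuousOn (by fun_prop)).integrableOn_compact (isCompact_closedBall _ _)
      obtain ⟨B, hB⟩ := (isCompact_closedBall (0 : E) 1).exists_bound_of_continuousOn
        hh.continuous.continuousOn
      have hdn : ∀ v : E, ‖‖v‖⁻¹ • v‖ ≤ 1 := fun v => by
        rw [norm_smul, norm_inv, norm_norm]
        exact inv_mul_le_one
      have hip : ∀ v : E, |inner ℝ (‖v‖⁻¹ • v) w| ≤ ‖w‖ := fun v =>
        (abs_real_inner_le_norm _ _).trans (mul_le_of_le_one_left (norm_nonneg _) (hdn v))
      have hB0 : 0 ≤ B := (norm_nonneg _).trans (hB 0 (by simp))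
      refine integral_mono ?_ ?_ fun v => ?_
      · refine (hfin.const_mul (B * (1 / η * ‖w‖))).mono' ?_ (Filter.Eventually.of_forall fun v => ?_)
        · exact (hh.continuous.measurable.mul (hind.mul
            (hdir.inner measurable_const))).aestronglyMeasurable
        · by_cases hv : ‖v‖ ∈ Set.Ioo (1 - η) 1
          · have hv' : v ∈ Metric.closedBall (0 : E) 1 := by simpa using hv.2.le
            rw [Set.indicator_of_mem hv, Set.indicator_of_mem hv', mul_one, norm_mul, norm_mul,
              Real.norm_of_nonneg (by positivity : 0 ≤ 1 / η)]
            gcongr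
            · exact hB v hv'
            · exact hip v
          · rw [Set.indicator_of_notMem hv]
            simp only [zero_mul, mul_zero, norm_zero]
            have : 0 ≤ (Metric.closedBall (0 : E) 1).indicator (fun _ => (1 : ℝ)) v :=
              Set.indicator_nonneg (fun _ _ => zero_le_one) _
            positivity
      · refine (hfin.const_mul ((B * ‖w‖ + L * η * ‖w‖) * (1 / η))).mono' ?_
          (Filter.Eventually.of_forall fun v => ?_)
        · exact ((((hh.continuous.measurable.comp hdir).mul
            (hdir.inner measurable_const)).add_const _).mul hind).aestronglyMeasurable
        · by_cases hv : ‖v‖ ∈ Set.Ioo (1 - η) 1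
          · have hv' : v ∈ Metric.closedBall (0 : E) 1 := by simpa using hv.2.le
            rw [Set.indicator_of_mem hv, Set.indicator_of_mem hv', mul_one, norm_mul,
              Real.norm_of_nonneg (by positivity : 0 ≤ 1 / η)]
            gcongr
            refine (norm_add_le _ _).trans ?_
            rw [norm_mul, Real.norm_of_nonneg (by positivity : 0 ≤ L * η * ‖w‖)]
            gcongr
            · exact hB _ (by simpa using hdn v)
            · exact hip v
          · rw [Set.indicator_of_notMem hv]
            simp only [mul_zero, norm_zero]
            have : 0 ≤ (Metric.closedBall (0 : E) 1).indicator (fun _ => (1 : ℝ)) v :=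
              Set.indicator_nonneg (fun _ _ => zero_le_one) _
            positivity
      · by_cases hv : ‖v‖ ∈ Set.Ioo (1 - η) 1
        · simp only [Set.indicator_of_mem hv]
          have hv0 : ‖v‖ ≠ 0 := by have := hv.1; linarith
          have hdist : |h v - h (‖v‖⁻¹ • v)| ≤ L * η := by
            have := hh.dist_le_mul v (‖v‖⁻¹ • v)
            rw [Real.dist_eq, dist_eq_norm] at this
            refine this.trans ?_
            gcongr
            have : v - ‖v‖⁻¹ • v = (‖v‖ - 1) • (‖v‖⁻¹ • v) := by
              rw [sub_smul, smul_smul, mul_inv_cancel₀ hv0, one_smul, one_smul]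
            rw [this, norm_smul, Real.norm_eq_abs, abs_of_nonpos (by linarith [hv.2])]
            have h3 := hdn v
            nlinarith [hv.1, hv.2, norm_nonneg (‖v‖⁻¹ • v)]
          have : h v * inner ℝ (‖v‖⁻¹ • v) w ≤
              h (‖v‖⁻¹ • v) * inner ℝ (‖v‖⁻¹ • v) w + L * η * ‖w‖ := by
            have h4 : (h v - h (‖v‖⁻¹ • v)) * inner ℝ (‖v‖⁻¹ • v) w ≤ L * η * ‖w‖ := by
              refine (le_abs_self _).trans ?_
              rw [abs_mul]
              exact mul_le_mul hdist (hip v) (abs_nonneg _) (by positivity)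
            linarith
          calc h v * (1 / η * inner ℝ (‖v‖⁻¹ • v) w)
              = h v * inner ℝ (‖v‖⁻¹ • v) w * (1 / η) := by ring
            _ ≤ _ := by gcongr
        · simp [Set.indicator_of_notMem hv]
    rw [integral_direction_mul_norm (fun e => h e * inner ℝ e w + L * η * ‖w‖),
      integral_indicator_ball_diff η hη hη1, integral_add, ← hJ] at h2
    · rw [mul_div_assoc', div_le_iff₀ hV0]
      refine (h1.trans h2).trans (le_of_eq ?_)
      simp
      ring
    · obtain ⟨C, hC⟩ := (isCompact_sphere (0 : E) 1).exists_bound_of_continuousOn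
        (f := fun e => h e * inner ℝ e w)
        (Continuous.continuousOn (hh.continuous.mul (by fun_prop)))
      refine Integrable.of_bound (hh.continuous.mul (by fun_prop)).aestronglyMeasurable C ?_
      filter_upwards [ae_unitSphereMeasure_norm] with e he
      exact hC e (by simp [he])
    · exact integrable_const _
  set η : ℕ → ℝ := fun j => 1 / ((j : ℝ) + 2) with hηdef
  have hη0 : ∀ j, 0 < η j := fun j => by positivity
  have hη1 : ∀ j, η j < 1 := fun j => by
    rw [hηdef, div_lt_one (by positivity)]; linarith [(Nat.cast_nonneg j : (0 : ℝ) ≤ j)]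
  have hηt : Filter.Tendsto η Filter.atTop (nhds 0) := by
    have := (tendsto_one_div_add_atTop_nhds_zero_nat (𝕜 := ℝ)).comp (Filter.tendsto_add_atTop_nat 1)
    refine this.congr fun j => ?_
    simp only [Function.comp, hηdef]
    push_cast
    ring
  have hkint : ∀ j, Integrable fun v : E => radialCutoff (η j) ‖v‖ := fun j =>
    ((continuous_radialCutoff _).comp continuous_norm).integrable_of_hasCompactSupport
      (hasCompactSupport_radialCutoff (hη0 j))
  -- The cutoff lies between the indicators of the balls of radii `1 - η` and `1`, so its normalized
  -- integral tends to `1`.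
  have hlow : ∀ j, (1 - η j) ^ d ≤ (∫ v : E, radialCutoff (η j) ‖v‖) / V := by
    intro j
    rw [le_div_iff₀ hV0, ← Measure.addHaar_real_closedBall _ (0 : E) (by linarith [hη1 j]),
      ← integral_indicator_one Metric.isClosed_closedBall.measurableSet]
    refine integral_mono ?_ (hkint j) fun v => ?_
    · exact (integrable_indicator_iff Metric.isClosed_closedBall.measurableSet).2
        ((Continuous.continuousOn (by fun_prop)).integrableOn_compact (isCompact_closedBall _ _))
    · by_cases hv : v ∈ Metric.closedBall (0 : E) (1 - η j)
      · rw [Set.indicator_of_mem hv]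
        exact (radialCutoff_eq_one (hη0 j) (by simpa using hv)).ge
      · rw [Set.indicator_of_notMem hv]
        exact radialCutoff_nonneg _ _
  have hup : ∀ j, (∫ v : E, radialCutoff (η j) ‖v‖) / V ≤ 1 := by
    intro j
    rw [div_le_one hV0, hV, ← integral_indicator_one measurableSet_ball]
    refine integral_mono (hkint j) ?_ fun v => ?_
    · exact (integrable_indicator_iff measurableSet_ball).2
        (((Continuous.continuousOn (by fun_prop)).integrableOn_compact
          (isCompact_closedBall (0 : E) 1)).mono_set Metric.ball_subset_closedBall)
    · by_cases hv : v ∈ Metric.ball (0 : E) 1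
      · rw [Set.indicator_of_mem hv]
        exact radialCutoff_le_one _ _
      · rw [Set.indicator_of_notMem hv]
        exact (radialCutoff_eq_zero (hη0 j) (by simpa using hv)).le
  have hlim1 : Filter.Tendsto (fun j => (∫ v : E, radialCutoff (η j) ‖v‖) / V) Filter.atTop
      (nhds 1) := by
    refine tendsto_of_tendsto_of_tendsto_of_le_of_le ?_ tendsto_const_nhds hlow hup
    have := (hηt.const_sub 1).pow d
    simpa using this
  have hlim2 : Filter.Tendsto (fun j => (1 - (1 - η j) ^ d) / η j * (J + L * η j * ‖w‖))
      Filter.atTop (nhds (d * (J + L * 0 * ‖w‖))) :=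
    (tendsto_one_sub_pow_div d).mul (((hηt.const_mul _).mul_const _).const_add _)
  have := le_of_tendsto_of_tendsto' (hlim1.const_mul A) hlim2 fun j => hη _ (hη0 j) (hη1 j)
  simpa using this

end Smoothing

/-! ### The prox step: regularity, measurability and the descent inequality. -/

section Prox

variable {m n : ℕ} {Z : Set (Joint m n)} {ω : Joint m n → ℝ} {p q : ℝ≥0∞}

theorem argminOn_spec {h : Joint m n → ℝ} (hZ : IsCompact Z) (hne : Z.Nonempty)
    (hh : ContinuousOn h Z) : argminOn Z h ∈ Z ∧ IsMinOn h Z (argminOn Z h) := by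
  obtain ⟨v, hv, hmin⟩ := hZ.exists_isMinOn hne hh
  exact Classical.epsilon_spec (p := fun v => v ∈ Z ∧ IsMinOn h Z v) ⟨v, hv, hmin⟩

theorem argminOn_congr {h h' : Joint m n → ℝ} {c : ℝ} (H : ∀ v ∈ Z, h v = h' v + c) :
    argminOn Z h = argminOn Z h' := by
  unfold argminOn
  congr 1
  funext v
  refine propext (and_congr_right fun hv => ?_)
  simp only [isMinOn_iff]
  refine forall₂_congr fun u hu => ?_
  rw [H v hv, H u hu, add_le_add_iff_right]

/-- The minimizer over `Z` of `ω - ⟨s, ·⟩`. -/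
def mirrorMap (Z : Set (Joint m n)) (ω : Joint m n → ℝ) (s : Joint m n) : Joint m n :=
  argminOn Z fun v => ω v - inner ℝ s v

/-- The component of the gradient of `ω` along the affine span of `Z`. -/
def tangentGradient (Z : Set (Joint m n)) (ω : Joint m n → ℝ) (z : Joint m n) : Joint m n :=
  (vectorSpan ℝ Z).starProjection (gradientWithin ω Z z)

theorem inner_tangentGradient {z v w : Joint m n} (hv : v ∈ Z) (hw : w ∈ Z) :
    inner ℝ (tangentGradient Z ω z) (v - w) = inner ℝ (gradientWithin ω Z z) (v - w) := by
  rw [tangentGradient, Submodule.inner_starProjection_left_eq_right,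
    ← vsub_eq_sub v w, Submodule.starProjection_eq_self_iff.2 (vsub_mem_vectorSpan ℝ hv hw)]

/-- The two objectives differ by a constant on `Z`. The step thus factors through a continuous map
of a dual variable, which is how the iterates are shown to be measurable. When `Z` spans a proper
subspace, pairings with differences of points of `Z` see the tangential component of the gradient
only, so that component suffices. -/
theorem prox_eq_mirrorMap {z : Joint m n} (hz : z ∈ Z) (g : Joint m n) :
    prox Z ω z g = mirrorMap Z ω (tangentGradient Z ω z - g) := by
  refine argminOn_congr (c := inner ℝ (tangentGradient Z ω z) z - ω z) fun v hv => ?_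
  rw [bregman, ← inner_tangentGradient hv hz, inner_sub_left, inner_sub_right]
  ring

theorem tendsto_gradientWithin (hω : DifferentiableOn ℝ ω Z) (hc : Convex ℝ Z)
    {z v : Joint m n} (hz : z ∈ Z) (hv : v ∈ Z) :
    Filter.Tendsto (fun j : ℕ => ((j : ℝ) + 1) * (ω (z + (1 / ((j : ℝ) + 1)) • (v - z)) - ω z))
      Filter.atTop (nhds (inner ℝ (gradientWithin ω Z z) (v - z))) := by
  have h := (hω z hz).hasFDerivWithinAt
  rw [inner_gradientWithin_left]
  refine h.lim (c := fun j : ℕ => (j : ℝ) + 1) (d := fun j : ℕ => (1 / ((j : ℝ) + 1)) • (v - z))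
    ?_ ?_ ?_
  · simpa using (tendsto_one_div_add_atTop_nhds_zero_nat (𝕜 := ℝ)).smul_const (v - z)
  · refine Filter.Eventually.of_forall fun j => hc.add_smul_sub_mem hz hv ⟨by positivity, ?_⟩
    rw [div_le_one (by positivity)]; linarith [(Nat.cast_nonneg j : (0 : ℝ) ≤ j)]
  · refine tendsto_const_nhds.congr fun j => ?_
    rw [smul_smul, mul_one_div_cancel (by positivity), one_smul]

/-- Along `v - z` with `v ∈ Z` the derivative is a pointwise limit of difference quotients that are
continuous in `z`. Differences of two such pairings give every `v - u`, and these vectors span the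
tangent directions. -/
theorem measurable_inner_gradientWithin (hω : DifferentiableOn ℝ ω Z) (hc : Convex ℝ Z)
    {w : Joint m n} (hw : w ∈ vectorSpan ℝ Z) :
    Measurable fun z : Z => (inner ℝ (gradientWithin ω Z z) w : ℝ) := by
  have hdir : ∀ v ∈ Z, Measurable fun z : Z => (inner ℝ (gradientWithin ω Z z) (v - z) : ℝ) := by
    intro v hv
    refine measurable_of_tendsto_metrizable (fun j => ?_)
      (tendsto_pi_nhds.2 fun z : Z => tendsto_gradientWithin hω hc z.2 hv)
    refine Continuous.measurable ?_
    have hmem : ∀ z : Z, (z : Joint m n) + (1 / ((j : ℝ) + 1)) • (v - z) ∈ Z := fun z => by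
      refine hc.add_smul_sub_mem z.2 hv ⟨by positivity, ?_⟩
      rw [div_le_one (by positivity)]; linarith [(Nat.cast_nonneg j : (0 : ℝ) ≤ j)]
    have h1 : Continuous fun z : Z => ω ((z : Joint m n) + (1 / ((j : ℝ) + 1)) • (v - z)) :=
      hω.continuousOn.comp_continuous (by fun_prop) hmem
    have h2 : Continuous fun z : Z => ω z := hω.continuousOn.comp_continuous (by fun_prop) fun z => z.2
    exact continuous_const.mul (h1.sub h2)
  rw [vectorSpan_def] at hw
  induction hw using Submodule.span_induction with
  | mem w h =>
    obtain ⟨v, hv, u, hu, rfl⟩ := h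
    convert (hdir v hv).sub (hdir u hu) using 1
    funext z
    simp only [Pi.sub_apply, vsub_eq_sub]
    rw [← inner_sub_right, sub_sub_sub_cancel_right]
  | zero => simp
  | add x y _ _ hx hy => simp only [inner_add_right]; exact hx.add hy
  | smul a x _ hx => simpa only [inner_smul_right] using hx.const_mul a

theorem measurable_tangentGradient (hω : DifferentiableOn ℝ ω Z) (hc : Convex ℝ Z) :
    Measurable fun z : Z => tangentGradient Z ω z := by
  have : Measurable fun z : Z => WithLp.ofLp (tangentGradient Z ω z) := by
    refine measurable_pi_iff.2 fun i => ?_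
    have h := measurable_inner_gradientWithin hω hc
      (Submodule.starProjection_apply_mem (vectorSpan ℝ Z) (EuclideanSpace.single i (1 : ℝ)))
    convert h using 1
    funext z
    rw [← Submodule.inner_starProjection_left_eq_right, EuclideanSpace.inner_single_right]
    simp [tangentGradient]
  exact (WithLp.measurable_toLp 2 _).comp this

theorem inner_gradientWithin_nonneg_of_isMinOn (hω : DifferentiableOn ℝ ω Z) (hc : Convex ℝ Z)
    {s v u : Joint m n} (hv : v ∈ Z) (hu : u ∈ Z) (hmin : IsMinOn (fun v => ω v - inner ℝ s v) Z v) :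
    0 ≤ inner ℝ (gradientWithin ω Z v - s) (u - v) := by
  have h1 := (hω v hv).hasFDerivWithinAt
  have h2 : HasFDerivWithinAt (fun v => ω v - inner ℝ s v)
      (fderivWithin ℝ ω Z v - innerSL ℝ s) Z v :=
    h1.sub (innerSL ℝ s).hasFDerivAt.hasFDerivWithinAt
  have h3 := hmin.localize.hasFDerivWithinAt_nonneg h2
    (sub_mem_posTangentConeAt_of_segment_subset (hc.segment_subset hv hu))
  rw [inner_sub_left, inner_gradientWithin_left]
  simpa using h3

theorem mirrorMap_spec (hω : DifferentiableOn ℝ ω Z) (hZ : IsCompact Z) (hne : Z.Nonempty)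
    (s : Joint m n) :
    mirrorMap Z ω s ∈ Z ∧ IsMinOn (fun v => ω v - inner ℝ s v) Z (mirrorMap Z ω s) :=
  argminOn_spec hZ hne (hω.continuousOn.sub (by fun_prop))

/-- Adding the optimality conditions at two minimizers and the lower bounds on the two Bregman
divergences gives strong monotonicity, hence a Lipschitz bound; the constant `d` comes from
comparing `ℓ_p` with `ℓ₂`. -/
theorem continuous_mirrorMap (hp : 1 ≤ p) (hω : IsProxFunction p Z ω) (hZ : IsCompact Z)
    (hc : Convex ℝ Z) (hne : Z.Nonempty) : Continuous (mirrorMap Z ω) := by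
  refine (LipschitzWith.of_dist_le_mul (K := ((m + n : ℕ) : NNReal)) fun s s' => ?_).continuous
  rw [dist_eq_norm, dist_eq_norm]
  obtain ⟨hv, hvm⟩ := mirrorMap_spec hω.differentiableOn hZ hne s
  obtain ⟨hv', hvm'⟩ := mirrorMap_spec hω.differentiableOn hZ hne s'
  set v := mirrorMap Z ω s
  set v' := mirrorMap Z ω s'
  have h1 := inner_gradientWithin_nonneg_of_isMinOn hω.differentiableOn hc hv hv' hvm
  have h2 := inner_gradientWithin_nonneg_of_isMinOn hω.differentiableOn hc hv' hv hvm'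
  have h3 := hω.lower_bound v hv v' hv'
  have h4 := hω.lower_bound v' hv' v hv
  have hn1 := norm_le_sqrt_mul_ellNorm hp (v - v')
  have hn2 := norm_le_sqrt_mul_ellNorm hp (v' - v)
  simp only [bregman, inner_sub_left, inner_sub_right] at h1 h2 h3 h4
  have hin : inner ℝ (s - s') (v - v') ≤ ‖s - s'‖ * ‖v - v'‖ := real_inner_le_norm _ _
  simp only [inner_sub_left, inner_sub_right] at hin
  have hd : (0 : ℝ) ≤ ((m + n : ℕ) : ℝ) := by positivity
  have hsq1 : ‖v - v'‖ ^ 2 ≤ ((m + n : ℕ) : ℝ) * ellNorm p (v - v') ^ 2 := by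
    rw [← Real.sq_sqrt hd, ← mul_pow]
    exact pow_le_pow_left₀ (norm_nonneg _) hn1 2
  have hsq2 : ‖v - v'‖ ^ 2 ≤ ((m + n : ℕ) : ℝ) * ellNorm p (v' - v) ^ 2 := by
    rw [← Real.sq_sqrt hd, ← mul_pow, norm_sub_rev]
    exact pow_le_pow_left₀ (norm_nonneg _) hn2 2
  have hkey : ‖v - v'‖ ^ 2 ≤ ((m + n : ℕ) : ℝ) * (‖s - s'‖ * ‖v - v'‖) := by
    have : ellNorm p (v - v') ^ 2 / 2 + ellNorm p (v' - v) ^ 2 / 2 ≤ ‖s - s'‖ * ‖v - v'‖ := by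
      linarith
    nlinarith
  rcases eq_or_ne ‖v - v'‖ 0 with h0 | h0
  · rw [h0]; positivity
  · have hpos : 0 < ‖v - v'‖ := lt_of_le_of_ne (norm_nonneg _) h0.symm
    refine le_of_mul_le_mul_right ?_ hpos
    simp only [NNReal.coe_natCast]
    nlinarith

theorem prox_mem (hω : DifferentiableOn ℝ ω Z) (hZ : IsCompact Z) {z : Joint m n} (hz : z ∈ Z)
    (g : Joint m n) : prox Z ω z g ∈ Z := by
  rw [prox_eq_mirrorMap hz]
  exact (mirrorMap_spec hω hZ ⟨z, hz⟩ _).1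

/-- One step of mirror descent. -/
theorem inner_le_bregman_sub_of_prox (hpq : ENNReal.HolderConjugate p q) (hω : IsProxFunction p Z ω)
    (hZ : IsCompact Z) (hc : Convex ℝ Z) {z u : Joint m n} (hz : z ∈ Z) (hu : u ∈ Z)
    (g : Joint m n) :
    inner ℝ g (z - u) ≤ bregman Z ω z u - bregman Z ω (prox Z ω z g) u + ellNorm q g ^ 2 / 2 := by
  have hmem := prox_mem hω.differentiableOn hZ hz g
  have hmin : IsMinOn (fun v => ω v - inner ℝ (tangentGradient Z ω z - g) v) Z (prox Z ω z g) := by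
    rw [prox_eq_mirrorMap hz]
    exact (mirrorMap_spec hω.differentiableOn hZ ⟨z, hz⟩ _).2
  set v := prox Z ω z g
  have h1 := inner_gradientWithin_nonneg_of_isMinOn hω.differentiableOn hc hmem hu hmin
  have h2 := hω.lower_bound z hz v hmem
  have h3 := inner_le_ellNorm_mul hpq g (z - v)
  -- Young's inequality: the second term is absorbed by the divergence `V_z(v)` that the three-point
  -- identity leaves over.
  have h4 : ellNorm q g * ellNorm p (z - v) ≤ ellNorm q g ^ 2 / 2 + ellNorm p (z - v) ^ 2 / 2 := by
    nlinarith [sq_nonneg (ellNorm q g - ellNorm p (z - v))]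
  have h5 := inner_tangentGradient (ω := ω) (z := z) hu hmem
  simp only [bregman, inner_sub_left, inner_sub_right] at *
  linarith

theorem bregman_nonneg (hω : IsProxFunction p Z ω) {z v : Joint m n} (hz : z ∈ Z) (hv : v ∈ Z) :
    0 ≤ bregman Z ω z v :=
  le_trans (by positivity) (hω.lower_bound z hz v hv)

theorem sqrt_two_mul_bregman_le (hω : IsProxFunction p Z ω) {z v : Joint m n} (hz : z ∈ Z)
    (hv : v ∈ Z) : √(2 * bregman Z ω z v) ≤ omegaDiam Z ω :=
  le_csSup hω.bddAbove ⟨z, hz, v, hv, rfl⟩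

theorem bregman_le (hω : IsProxFunction p Z ω) {z v : Joint m n} (hz : z ∈ Z) (hv : v ∈ Z) :
    bregman Z ω z v ≤ omegaDiam Z ω ^ 2 / 2 := by
  have h := pow_le_pow_left₀ (Real.sqrt_nonneg _) (sqrt_two_mul_bregman_le hω hz hv) 2
  rw [Real.sq_sqrt (by linarith [bregman_nonneg hω hz hv])] at h
  linarith

theorem ellNorm_sub_le_omegaDiam (hω : IsProxFunction p Z ω) {z v : Joint m n} (hz : z ∈ Z)
    (hv : v ∈ Z) : ellNorm p (z - v) ≤ omegaDiam Z ω := by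
  refine le_trans (Real.le_sqrt_of_sq_le ?_) (sqrt_two_mul_bregman_le hω hz hv)
  linarith [hω.lower_bound z hz v hv]

theorem omegaDiam_pos (hp : 1 ≤ p) (hω : IsProxFunction p Z ω) (hZ : Z.Nontrivial) :
    0 < omegaDiam Z ω := by
  obtain ⟨z, hz, v, hv, hne⟩ := hZ
  have h1 := norm_le_sqrt_mul_ellNorm hp (z - v)
  have h2 : 0 < ‖z - v‖ := norm_pos_iff.2 (sub_ne_zero.2 hne)
  have h3 := ellNorm_sub_le_omegaDiam hω hz hv
  by_contra hcon
  have h4 : ellNorm p (z - v) ≤ 0 := h3.trans (not_lt.1 hcon)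
  nlinarith [Real.sqrt_nonneg ((m + n : ℕ) : ℝ)]

end Prox

/-! ### The product structure and the neighbourhood of the feasible set. -/

section Feasible

variable {m n : ℕ} {X : Set (EuclideanSpace ℝ (Fin m))} {Y : Set (EuclideanSpace ℝ (Fin n))}

@[simp] theorem xPart_joint (x : EuclideanSpace ℝ (Fin m)) (y : EuclideanSpace ℝ (Fin n)) :
    xPart (joint x y) = x := by ext i; simp [xPart, joint]

@[simp] theorem yPart_joint (x : EuclideanSpace ℝ (Fin m)) (y : EuclideanSpace ℝ (Fin n)) :
    yPart (joint x y) = y := by ext i; simp [yPart, joint]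

@[simp] theorem joint_xPart_yPart (z : Joint m n) : joint (xPart z) (yPart z) = z := by
  ext i; rcases i with i | i <;> simp [xPart, yPart, joint]

theorem xPart_add (z w : Joint m n) : xPart (z + w) = xPart z + xPart w := by
  ext i; simp [xPart]

theorem yPart_add (z w : Joint m n) : yPart (z + w) = yPart z + yPart w := by
  ext i; simp [yPart]

theorem xPart_smul (c : ℝ) (z : Joint m n) : xPart (c • z) = c • xPart z := by
  ext i; simp [xPart]

theorem yPart_smul (c : ℝ) (z : Joint m n) : yPart (c • z) = c • yPart z := by
  ext i; simp [yPart]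

theorem continuous_xPart : Continuous (xPart (m := m) (n := n)) := by
  unfold xPart; fun_prop

theorem continuous_yPart : Continuous (yPart (m := m) (n := n)) := by
  unfold yPart; fun_prop

theorem continuous_joint : Continuous fun w : EuclideanSpace ℝ (Fin m) × EuclideanSpace ℝ (Fin n) =>
    joint w.1 w.2 := by
  unfold joint
  refine (PiLp.continuous_toLp 2 _).comp (continuous_pi fun i => ?_)
  rcases i with i | i <;> simp <;> fun_prop

theorem isCompact_feasible (hX : IsCompact X) (hY : IsCompact Y) : IsCompact (feasible X Y) := by
  have : feasible X Y = (fun w : EuclideanSpace ℝ (Fin m) × EuclideanSpace ℝ (Fin n) =>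
      joint w.1 w.2) '' (X ×ˢ Y) := by
    ext z
    constructor
    · intro hz
      exact ⟨(xPart z, yPart z), ⟨hz.1, hz.2⟩, joint_xPart_yPart z⟩
    · rintro ⟨w, hw, rfl⟩
      exact ⟨by simpa using hw.1, by simpa using hw.2⟩
  rw [this]
  exact (hX.prod hY).image continuous_joint

theorem convex_feasible (hX : Convex ℝ X) (hY : Convex ℝ Y) : Convex ℝ (feasible X Y) := by
  intro z hz w hw a b ha hb hab
  refine ⟨?_, ?_⟩
  · rw [xPart_add, xPart_smul, xPart_smul]; exact hX hz.1 hw.1 ha hb hab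
  · rw [yPart_add, yPart_smul, yPart_smul]; exact hY hz.2 hw.2 ha hb hab

open scoped Pointwise in
theorem isClosed_nbhd {Z : Set (Joint m n)} (hZ : IsCompact Z) (τ : ℝ) : IsClosed (nbhd Z τ) := by
  have : nbhd Z τ = Z + Metric.closedBall (0 : Joint m n) τ := by
    ext z
    simp only [nbhd, Set.mem_ofPred_eq, Set.mem_add, mem_closedBall_zero_iff]
    constructor
    · rintro ⟨w, hw, h⟩
      exact ⟨w, hw, z - w, h, by abel⟩
    · rintro ⟨w, hw, u, hu, rfl⟩
      exact ⟨w, hw, by simpa using hu⟩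
  rw [this]
  exact (hZ.add (isCompact_closedBall 0 τ)).isClosed

theorem add_smul_mem_nbhd {Z : Set (Joint m n)} {τ : ℝ} (hτ : 0 ≤ τ) {z v : Joint m n} (hz : z ∈ Z)
    (hv : ‖v‖ ≤ 1) : z + τ • v ∈ nbhd Z τ := by
  refine ⟨z, hz, ?_⟩
  rw [add_sub_cancel_left, norm_smul, Real.norm_of_nonneg hτ]
  exact mul_le_of_le_one_right hτ hv

theorem sub_smul_mem_nbhd {Z : Set (Joint m n)} {τ : ℝ} (hτ : 0 ≤ τ) {z v : Joint m n} (hz : z ∈ Z)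
    (hv : ‖v‖ ≤ 1) : z - τ • v ∈ nbhd Z τ := by
  rw [sub_eq_add_neg, ← smul_neg]
  exact add_smul_mem_nbhd hτ hz (by simpa)

theorem subset_nbhd {Z : Set (Joint m n)} {τ : ℝ} (hτ : 0 ≤ τ) : Z ⊆ nbhd Z τ := fun z hz =>
  ⟨z, hz, by simpa⟩

end Feasible

/-! ### Bias and second moment of the two-point estimator. -/

section TwoPoint

variable {m n : ℕ}

theorem integral_sub_neg_mul_inner [Nontrivial (Joint m n)] {h : Joint m n → ℝ} (hh : Continuous h)
    (u : Joint m n) :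
    ∫ e, (h e - h (-e)) * inner ℝ e u ∂unitSphereMeasure (Joint m n) =
      2 * ∫ e, h e * inner ℝ e u ∂unitSphereMeasure (Joint m n) := by
  have h1 : ∫ e, h (-e) * inner ℝ e u ∂unitSphereMeasure (Joint m n) =
      -∫ e, h e * inner ℝ e u ∂unitSphereMeasure (Joint m n) := by
    rw [← integral_unitSphereMeasure_comp_neg, ← integral_neg]
    simp
  simp_rw [sub_mul]
  rw [integral_sub, h1]
  · ring
  · exact integrable_unitSphereMeasure_of_continuous (by fun_prop)
  · exact integrable_unitSphereMeasure_of_continuous (by fun_prop)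

/-- The expectation of the two-point estimator of the gradient of `G`, tested against `u`. -/
def twoPoint (G : Joint m n → ℝ) (τ : ℝ) (z u : Joint m n) : ℝ :=
  ∫ e, ((m + n : ℕ) : ℝ) / (2 * τ) * (G (z + τ • e) - G (z - τ • e)) * inner ℝ e u
    ∂unitSphereMeasure (Joint m n)

/-- Only values at query points matter, so a function that is Lipschitz on the neighbourhood may be
replaced by a globally Lipschitz extension. -/
theorem twoPoint_congr {G G' : Joint m n → ℝ} {τ : ℝ} (hτ : 0 ≤ τ) {Z : Set (Joint m n)}
    (h : Set.EqOn G G' (nbhd Z τ)) {z : Joint m n} (hz : z ∈ Z) (u : Joint m n) :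
    twoPoint G τ z u = twoPoint G' τ z u := by
  refine integral_congr_ae ?_
  filter_upwards [ae_unitSphereMeasure_norm] with e he
  rw [h (add_smul_mem_nbhd hτ hz he.le), h (sub_smul_mem_nbhd hτ hz he.le)]

/-- The surface integral bound on the unit sphere, transported to the sphere of radius `τ` about `z`
by rescaling; the symmetric difference is twice the one-point integral by oddness. -/
theorem le_twoPoint (hd : 1 ≤ m + n) {K : NNReal} {G : Joint m n → ℝ} (hG : LipschitzWith K G)
    {τ : ℝ} (hτ : 0 < τ) {z a₁ a₂ : Joint m n} {A : ℝ}
    (hA : ∀ v : Joint m n, ‖v‖ ≤ 1 → ∀ t : ℝ, 0 < t → t ≤ 1 →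
      t * A ≤ G (z + τ • v - t • a₂) - G (z + τ • v - t • a₁)) :
    A ≤ twoPoint G τ z (a₁ - a₂) := by
  have := nontrivial_joint hd
  set h : Joint m n → ℝ := fun v => G (z + τ • v) with hh
  have hlip : LipschitzWith (K * (τ.toNNReal)) h := by
    refine LipschitzWith.of_dist_le_mul fun x y => ?_
    refine (hG.dist_le_mul _ _).trans (le_of_eq ?_)
    rw [dist_add_left, dist_smul₀, NNReal.coe_mul, Real.coe_toNNReal _ hτ.le,
      Real.norm_of_nonneg hτ.le]
    ring
  have key := le_finrank_mul_integral_sphere hlip (u₁ := τ⁻¹ • a₁) (u₂ := τ⁻¹ • a₂) (A := A) ?_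
  · refine key.trans (le_of_eq ?_)
    have h1 := integral_sub_neg_mul_inner hlip.continuous (a₁ - a₂)
    rw [← smul_sub]
    simp_rw [inner_smul_right]
    rw [finrank_joint, twoPoint]
    have h2 : ∀ e : Joint m n, ((m + n : ℕ) : ℝ) / (2 * τ) * (G (z + τ • e) - G (z - τ • e)) *
        inner ℝ e (a₁ - a₂) = ((m + n : ℕ) : ℝ) / (2 * τ) * ((h e - h (-e)) *
          inner ℝ e (a₁ - a₂)) := fun e => by
      simp only [hh, smul_neg, ← sub_eq_add_neg]
      ring
    have h3 : ∀ e : Joint m n, h e * (τ⁻¹ * inner ℝ e (a₁ - a₂)) =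
        τ⁻¹ * (h e * inner ℝ e (a₁ - a₂)) := fun e => by ring
    simp_rw [h2, h3]
    rw [integral_const_mul, integral_const_mul, h1]
    field_simp
  · intro v hv t ht0 ht1
    have h4 : ∀ a : Joint m n, z + τ • (v - t • τ⁻¹ • a) = z + τ • v - t • a := fun a => by
      rw [smul_sub, smul_comm τ t, smul_smul τ, mul_inv_cancel₀ hτ.ne', one_smul]
      abel
    simp only [hh, h4]
    exact hA v hv t ht0 ht1

theorem neg_mul_norm_le_twoPoint (hd : 1 ≤ m + n) {K : NNReal} {G : Joint m n → ℝ} {τ : ℝ}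
    (hτ : 0 < τ) {Z : Set (Joint m n)} (hG : LipschitzOnWith K G (nbhd Z τ)) {z : Joint m n}
    (hz : z ∈ Z) (u : Joint m n) : -(K * ‖u‖) ≤ twoPoint G τ z u := by
  obtain ⟨g, hg, hGg⟩ := hG.extend_real
  rw [twoPoint_congr hτ.le hGg hz]
  have := le_twoPoint hd hg hτ (z := z) (a₁ := u) (a₂ := 0) (A := -(K * ‖u‖)) ?_
  · simpa using this
  · intro v _ t ht0 _
    have h1 := hg.dist_le_mul (z + τ • v - t • u) (z + τ • v - t • 0)
    rw [Real.dist_eq, dist_eq_norm] at h1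
    have h2 : ‖z + τ • v - t • u - (z + τ • v - t • 0)‖ = t * ‖u‖ := by
      rw [smul_zero, sub_zero, sub_sub_cancel_left, norm_neg, norm_smul, Real.norm_of_nonneg ht0.le]
    rw [h2] at h1
    have := (abs_le.1 h1).2
    linarith

variable {X : Set (EuclideanSpace ℝ (Fin m))} {Y : Set (EuclideanSpace ℝ (Fin n))}

theorem joint_sub_smul_left (a : Joint m n) (t : ℝ) (x : EuclideanSpace ℝ (Fin m)) :
    a - t • joint x 0 = joint (xPart a - t • x) (yPart a) := by
  ext i; rcases i with i | i <;> simp [xPart, yPart, joint]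

theorem joint_sub_smul_right (a : Joint m n) (t : ℝ) (y : EuclideanSpace ℝ (Fin n)) :
    a - t • joint 0 y = joint (xPart a) (yPart a - t • y) := by
  ext i; rcases i with i | i <;> simp [xPart, yPart, joint]

theorem joint_sub_joint_eq_flipY (z : Joint m n) (xs : EuclideanSpace ℝ (Fin m))
    (ys : EuclideanSpace ℝ (Fin n)) :
    joint (xPart z - xs) 0 - joint 0 (yPart z - ys) = flipY (z - joint xs ys) := by
  ext i; rcases i with i | i <;> simp [xPart, yPart, joint, flipY]

theorem add_mem_nbhd {Z : Set (Joint m n)} {τ : ℝ} {z w : Joint m n} (hz : z ∈ Z) (hw : ‖w‖ ≤ τ) :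
    z + w ∈ nbhd Z τ := ⟨z, hz, by simpa⟩

/-- The two-point estimator bounds the saddle gap of a convex-concave function up to `2 τ K`. -/
theorem saddleGap_sub_le_twoPoint (hd : 1 ≤ m + n) {K : NNReal} {F : Joint m n → ℝ} {τ : ℝ}
    (hτ : 0 < τ) (hF : LipschitzOnWith K F (nbhd (feasible X Y) τ))
    (hcc : ConvexConcaveOn (nbhd (feasible X Y) τ) F) {z : Joint m n} (hz : z ∈ feasible X Y)
    {xs : EuclideanSpace ℝ (Fin m)} {ys : EuclideanSpace ℝ (Fin n)} (hxs : xs ∈ X) (hys : ys ∈ Y) :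
    saddleGap F xs ys z - 2 * τ * K ≤ twoPoint F τ z (flipY (z - joint xs ys)) := by
  obtain ⟨g, hg, hFg⟩ := hF.extend_real
  set S := nbhd (feasible X Y) τ with hS
  rw [twoPoint_congr hτ.le hFg hz, ← joint_sub_joint_eq_flipY]
  have hzx : joint (xPart z) ys ∈ feasible X Y := ⟨by simpa using hz.1, by simpa using hys⟩
  have hzy : joint xs (yPart z) ∈ feasible X Y := ⟨by simpa using hxs, by simpa using hz.2⟩
  refine le_twoPoint hd hg hτ fun v hv t ht0 ht1 => ?_
  set a := z + τ • v with ha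
  have hw : ‖τ • v‖ ≤ τ := by
    rw [norm_smul, Real.norm_of_nonneg hτ.le]; exact mul_le_of_le_one_right hτ.le hv
  have haS : a ∈ S := add_mem_nbhd hz hw
  -- `b₂` and `b₁` are the endpoints, at `t = 1`, of the moves in the `y`-block and in the
  -- `x`-block. They are `(x, y_*)` and `(x_*, y)` shifted by `τ v`, so they stay in the
  -- neighbourhood, and each shift costs at most `K τ`.
  set b₂ : Joint m n := joint (xPart a) (yPart a - (yPart z - ys)) with hb₂
  set b₁ : Joint m n := joint (xPart a - (xPart z - xs)) (yPart a) with hb₁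
  have hb₂' : b₂ = joint (xPart z) ys + τ • v := by
    ext i; rcases i with i | i <;> simp [hb₂, ha, xPart, yPart, joint]; ring
  have hb₁' : b₁ = joint xs (yPart z) + τ • v := by
    ext i; rcases i with i | i <;> simp [hb₁, ha, xPart, yPart, joint]; ring
  have hb₂S : b₂ ∈ S := by rw [hb₂']; exact add_mem_nbhd hzx hw
  have hb₁S : b₁ ∈ S := by rw [hb₁']; exact add_mem_nbhd hzy hw
  have haS' : joint (xPart a) (yPart a) ∈ S := by simpa using haS
  have hconv := hcc.1 (yPart a)
  have hconc := hcc.2 (xPart a)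
  have e1 : (1 - t) • xPart a + t • (xPart a - (xPart z - xs)) = xPart a - t • (xPart z - xs) := by
    module
  have e2 : (1 - t) • yPart a + t • (yPart a - (yPart z - ys)) = yPart a - t • (yPart z - ys) := by
    module
  have h1S := hconv.1 haS' hb₁S (sub_nonneg.2 ht1) ht0.le (sub_add_cancel 1 t)
  have h2S := hconc.1 haS' hb₂S (sub_nonneg.2 ht1) ht0.le (sub_add_cancel 1 t)
  have h1 := hconv.2 haS' hb₁S (sub_nonneg.2 ht1) ht0.le (sub_add_cancel 1 t)
  have h2 := hconc.2 haS' hb₂S (sub_nonneg.2 ht1) ht0.le (sub_add_cancel 1 t)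
  rw [e1] at h1 h1S
  rw [e2] at h2 h2S
  simp only [smul_eq_mul, ← hb₁, ← hb₂] at h1 h2
  rw [joint_sub_smul_left, joint_sub_smul_right, ← hFg h2S, ← hFg h1S]
  have hl2 := hF.dist_le_mul b₂ hb₂S _ (subset_nbhd hτ.le hzx)
  have hl1 := hF.dist_le_mul b₁ hb₁S _ (subset_nbhd hτ.le hzy)
  rw [hb₂', Real.dist_eq, dist_eq_norm, add_sub_cancel_left, ← hb₂'] at hl2
  rw [hb₁', Real.dist_eq, dist_eq_norm, add_sub_cancel_left, ← hb₁'] at hl1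
  have hKτ : K * ‖τ • v‖ ≤ K * τ := by gcongr
  have hl2' := (abs_le.1 hl2).1
  have hl1' := (abs_le.1 hl1).2
  rw [saddleGap]
  have : t * (F (joint (xPart z) ys) - F (joint xs (yPart z)) - 2 * τ * K) ≤ t * (F b₂ - F b₁) :=
    mul_le_mul_of_nonneg_left (by linarith) ht0.le
  linarith

/-- The constant in the second moment bound of the two-point estimator. -/
def secondMomentConst : ℝ := √(Real.pi ^ 4 * (2 * (4 * Real.exp 1) ^ 2) * 6 ^ 4)

theorem secondMomentConst_nonneg : 0 ≤ secondMomentConst := Real.sqrt_nonneg _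

theorem aSq_nonneg (m n : ℕ) (q : ℝ≥0∞) : 0 ≤ aSq m n q := Real.sqrt_nonneg _

theorem integral_mul_sq_le_sqrt [Nontrivial (Joint m n)] {f g : Joint m n → ℝ} (hf : Continuous f)
    (hg : Continuous g) :
    ∫ e, f e ^ 2 * g e ^ 2 ∂unitSphereMeasure (Joint m n) ≤
      √(∫ e, f e ^ 4 ∂unitSphereMeasure (Joint m n)) *
        √(∫ e, g e ^ 4 ∂unitSphereMeasure (Joint m n)) := by
  have hmem : ∀ {f : Joint m n → ℝ}, Continuous f →
      MemLp (fun e => f e ^ 2) (ENNReal.ofReal 2) (unitSphereMeasure (Joint m n)) := by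
    intro f hf
    rw [ENNReal.ofReal_ofNat]
    refine (memLp_two_iff_integrable_sq (by fun_prop)).2 ?_
    exact integrable_unitSphereMeasure_of_continuous (by fun_prop)
  have := integral_mul_le_Lp_mul_Lq_of_nonneg Real.HolderConjugate.two_two
    (Filter.Eventually.of_forall fun e => sq_nonneg (f e))
    (Filter.Eventually.of_forall fun e => sq_nonneg (g e)) (hmem hf) (hmem hg)
  rw [Real.sqrt_eq_rpow, Real.sqrt_eq_rpow]
  simpa [← pow_mul] using this

/-- Cauchy-Schwarz separates the antipodal difference from the norm. Concentration makes the first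
factor of order `L² / d`, a gain of `d` over the trivial bound. -/
theorem integral_sub_neg_sq_mul_ellNorm_sq_le (hd : 1 ≤ m + n) {q : ℝ≥0∞} (hq : 1 ≤ q)
    {h : Joint m n → ℝ} {L : ℝ} (hL : 0 ≤ L)
    (hh : ∀ x y : Joint m n, ‖x‖ = 1 → ‖y‖ = 1 → |h x - h y| ≤ L * ‖x - y‖) :
    ∫ e, (h e - h (-e)) ^ 2 * ellNorm q e ^ 2 ∂unitSphereMeasure (Joint m n) ≤
      secondMomentConst * L ^ 2 / ((m + n : ℕ) : ℝ) * aSq m n q := by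
  have := nontrivial_joint hd
  have hlip : LipschitzOnWith L.toNNReal h (Metric.sphere 0 1) := by
    refine LipschitzOnWith.of_dist_le_mul fun x hx y hy => ?_
    rw [Real.coe_toNNReal _ hL, Real.dist_eq, dist_eq_norm]
    exact hh x y (by simpa using hx) (by simpa using hy)
  obtain ⟨g, hg, hhg⟩ := hlip.extend_real
  have hgc := hg.continuous
  have h1 : ∫ e, (h e - h (-e)) ^ 2 * ellNorm q e ^ 2 ∂unitSphereMeasure (Joint m n) =
      ∫ e, (g e - g (-e)) ^ 2 * ellNorm q e ^ 2 ∂unitSphereMeasure (Joint m n) := by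
    refine integral_congr_ae ?_
    filter_upwards [ae_unitSphereMeasure_norm] with e he
    rw [hhg (by simpa using he), hhg (by simpa using he)]
  rw [h1]
  refine (integral_mul_sq_le_sqrt (f := fun e => g e - g (-e)) (by fun_prop)
    (continuous_ellNorm hq)).trans ?_
  rw [aSq, sphereUniform_eq]
  gcongr
  have h2 := integral_unitSphereMeasure_sub_neg_pow_four_le (h := g) hL fun x y hx hy => by
    rw [← hhg (by simpa using hx), ← hhg (by simpa using hy)]; exact hh x y hx hy
  refine (Real.sqrt_le_sqrt h2).trans (le_of_eq ?_)
  have hd0 : (0 : ℝ) < ((m + n : ℕ) : ℝ) := by exact_mod_cast hd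
  rw [finrank_joint, Real.sqrt_div (by positivity), Real.sqrt_sq hd0.le, secondMomentConst]
  congr 1
  rw [show Real.pi ^ 4 * (2 * (4 * Real.exp 1) ^ 2) * (6 * L) ^ 4 =
    Real.pi ^ 4 * (2 * (4 * Real.exp 1) ^ 2) * 6 ^ 4 * (L ^ 2) ^ 2 by ring,
    Real.sqrt_mul (by positivity), Real.sqrt_sq (by positivity)]

theorem integral_ellNorm_sq_le_aSq (hd : 1 ≤ m + n) {q : ℝ≥0∞} (hq : 1 ≤ q) :
    ∫ e, ellNorm q e ^ 2 ∂unitSphereMeasure (Joint m n) ≤ aSq m n q := by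
  have := nontrivial_joint hd
  have h := integral_mul_sq_le_sqrt (f := fun _ : Joint m n => (1 : ℝ)) continuous_const
    (continuous_ellNorm hq)
  simpa [aSq, sphereUniform_eq] using h

/-- On the sphere `‖e‖_q² ≥ 1 / d`. -/
theorem aSq_pos (hd : 1 ≤ m + n) {q : ℝ≥0∞} (hq : 1 ≤ q) : 0 < aSq m n q := by
  have := nontrivial_joint hd
  have hd0 : (0 : ℝ) < ((m + n : ℕ) : ℝ) := by exact_mod_cast hd
  refine lt_of_lt_of_le ?_ (integral_ellNorm_sq_le_aSq hd hq)
  refine lt_of_lt_of_le (one_div_pos.2 hd0) ?_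
  have h1 : ∫ _e : Joint m n, 1 / ((m + n : ℕ) : ℝ) ∂unitSphereMeasure (Joint m n) =
      1 / ((m + n : ℕ) : ℝ) := by simp
  rw [← h1]
  refine integral_mono_ae (integrable_const _) (integrable_unitSphereMeasure_of_continuous
    ((continuous_ellNorm hq).pow 2)) ?_
  filter_upwards [ae_unitSphereMeasure_norm] with e he
  rw [div_le_iff₀ hd0]
  have := pow_le_pow_left₀ (norm_nonneg _) (norm_le_sqrt_mul_ellNorm hq e) 2
  rw [he, mul_pow, Real.sq_sqrt hd0.le] at this
  linarith

/-- The first absolute moment of a linear functional on the sphere. -/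
theorem integral_abs_inner_le (hd : 1 ≤ m + n) (u : Joint m n) :
    ∫ e, |inner ℝ e u| ∂unitSphereMeasure (Joint m n) ≤ ‖u‖ / √((m + n : ℕ) : ℝ) := by
  have := nontrivial_joint hd
  have hd0 : (0 : ℝ) < ((m + n : ℕ) : ℝ) := by exact_mod_cast hd
  have h2 := integral_unitSphereMeasure_inner_sq u
  rw [finrank_joint] at h2
  have h3 : (∫ e, |inner ℝ e u| ∂unitSphereMeasure (Joint m n)) ^ 2 ≤
      ∫ e, |inner ℝ e u| ^ 2 ∂unitSphereMeasure (Joint m n) :=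
    (convexOn_pow 2).map_integral_le (by fun_prop) isClosed_Ici
      (Filter.Eventually.of_forall fun e => abs_nonneg (inner ℝ e u : ℝ))
      (integrable_unitSphereMeasure_of_continuous (by fun_prop))
      (integrable_unitSphereMeasure_of_continuous (by simp only [Function.comp_def]; fun_prop))
  simp only [sq_abs, real_inner_comm] at h3 h2 ⊢
  rw [h2] at h3
  refine abs_le_of_sq_le_sq' ?_ (by positivity) |>.2
  rw [div_pow, Real.sq_sqrt hd0.le]
  simpa only [real_inner_comm] using h3

end TwoPoint

/-! ### Expectations over a fresh sample independent of the current state. -/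

section IndependentSample

variable {Ω α β : Type*} [MeasurableSpace Ω] [MeasurableSpace α] [MeasurableSpace β]
  {P : Measure Ω} [IsProbabilityMeasure P] {ν : Measure β} [IsProbabilityMeasure ν]

/-- Fubini on the product law. The dominating function depends on the sample alone, so no
information on the law of the state is needed. -/
theorem integrable_comp_of_indepFun {U : Ω → α} {W : Ω → β} (hU : Measurable U) (hW : Measurable W)
    (hind : IndepFun U W P) (hlaw : P.map W = ν) {Ψ : α × β → ℝ} (hΨ : Measurable Ψ) {b : β → ℝ}
    (hb : Integrable b ν) (hΨb : ∀ᵐ w ∂ν, ∀ z, |Ψ (z, w)| ≤ b w) :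
    Integrable Ψ ((P.map U).prod ν) ∧ Integrable (fun s => Ψ (U s, W s)) P ∧
      ∫ s, Ψ (U s, W s) ∂P = ∫ s, ∫ w, Ψ (U s, w) ∂ν ∂P := by
  have hprob : IsProbabilityMeasure (P.map U) := Measure.isProbabilityMeasure_map hU.aemeasurable
  have hmap : P.map (fun s => (U s, W s)) = (P.map U).prod ν := by
    rw [(indepFun_iff_map_prod_eq_prod_map_map hU.aemeasurable hW.aemeasurable).1 hind, hlaw]
  have hint : Integrable Ψ ((P.map U).prod ν) := by
    refine (hb.comp_snd (P.map U)).mono' hΨ.aestronglyMeasurable ?_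
    filter_upwards [Measure.quasiMeasurePreserving_snd.ae hΨb] with x hx
    exact hx x.1
  refine ⟨hint, ?_, ?_⟩
  · rw [← hmap] at hint
    exact hint.comp_measurable (hU.prodMk hW)
  · calc ∫ s, Ψ (U s, W s) ∂P = ∫ x, Ψ x ∂(P.map fun s => (U s, W s)) :=
          (integral_map (hU.prodMk hW).aemeasurable hΨ.aestronglyMeasurable).symm
      _ = ∫ z, ∫ w, Ψ (z, w) ∂ν ∂(P.map U) := by rw [hmap, integral_prod _ hint]
      _ = _ := integral_map hU.aemeasurable hint.integral_prod_left.aestronglyMeasurable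

theorem integral_le_of_indepFun {U : Ω → α} {W : Ω → β} (hU : Measurable U) (hW : Measurable W)
    (hind : IndepFun U W P) (hlaw : P.map W = ν) {Ψ : α × β → ℝ} (hΨ : Measurable Ψ) {b : β → ℝ}
    (hb : Integrable b ν) (hΨb : ∀ᵐ w ∂ν, ∀ z, |Ψ (z, w)| ≤ b w) {B : α → ℝ}
    (hB : Integrable (fun s => B (U s)) P) (h : ∀ z, B z ≤ ∫ w, Ψ (z, w) ∂ν) :
    ∫ s, B (U s) ∂P ≤ ∫ s, Ψ (U s, W s) ∂P := by
  obtain ⟨h1, h2, h3⟩ := integrable_comp_of_indepFun hU hW hind hlaw hΨ hb hΨb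
  rw [h3]
  exact integral_mono hB (h1.integral_prod_left.comp_measurable hU) fun s => h (U s)

end IndependentSample

/-! ### The iterates: regret, measurability and independence of the next sample. -/

section Iterates

variable {m n : ℕ} {Z : Set (Joint m n)} {ω : Joint m n → ℝ} {p q : ℝ≥0∞} {Ξ : Type*}
  {φ : Joint m n → Ξ → ℝ} {τ : ℝ}

theorem iterate_mem (hω : DifferentiableOn ℝ ω Z) (hZ : IsCompact Z) (hne : Z.Nonempty)
    (γ : ℕ → ℝ) (e : ℕ → Joint m n) (ξ : ℕ → Ξ) (k : ℕ) : iterate Z ω φ τ γ e ξ k ∈ Z := by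
  induction k with
  | zero => exact (argminOn_spec hZ hne hω.continuousOn).1
  | succ k ih => exact prox_mem hω hZ ih _

theorem ellNorm_gradEst (hq : 1 ≤ q) (z : Joint m n) (ξ : Ξ) (e : Joint m n) :
    ellNorm q (gradEst φ τ z ξ e) =
      |((m + n : ℕ) : ℝ) / (2 * τ) * (φ (z + τ • e) ξ - φ (z - τ • e) ξ)| * ellNorm q e := by
  rw [gradEst, ellNorm_smul hq, ellNorm_flipY hq]

theorem inner_gradEst (z : Joint m n) (ξ : Ξ) (e u : Joint m n) :
    inner ℝ (gradEst φ τ z ξ e) u =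
      ((m + n : ℕ) : ℝ) / (2 * τ) * (φ (z + τ • e) ξ - φ (z - τ • e) ξ) * inner ℝ e (flipY u) := by
  rw [gradEst, real_inner_smul_left, inner_flipY_left]

/-- The regret bound of mirror descent with a constant step. -/
theorem sum_inner_gradEst_le (hpq : ENNReal.HolderConjugate p q) (hω : IsProxFunction p Z ω)
    (hZ : IsCompact Z) (hc : Convex ℝ Z) {u : Joint m n} (hu : u ∈ Z) (c : ℝ)
    (e : ℕ → Joint m n) (ξ : ℕ → Ξ) (N : ℕ) :
    c * ∑ k ∈ Finset.range N, inner ℝ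
        (gradEst φ τ (iterate Z ω φ τ (fun _ => c) e ξ k) (ξ k) (e k))
        (iterate Z ω φ τ (fun _ => c) e ξ k - u) ≤
      omegaDiam Z ω ^ 2 / 2 + c ^ 2 / 2 * ∑ k ∈ Finset.range N,
        ellNorm q (gradEst φ τ (iterate Z ω φ τ (fun _ => c) e ξ k) (ξ k) (e k)) ^ 2 := by
  set z := iterate Z ω φ τ (fun _ => c) e ξ with hz
  have hmem : ∀ k, z k ∈ Z := iterate_mem hω.differentiableOn hZ ⟨u, hu⟩ _ e ξ
  have key : ∀ N, c * ∑ k ∈ Finset.range N, inner ℝ (gradEst φ τ (z k) (ξ k) (e k)) (z k - u) ≤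
      bregman Z ω (z 0) u - bregman Z ω (z N) u + c ^ 2 / 2 * ∑ k ∈ Finset.range N,
        ellNorm q (gradEst φ τ (z k) (ξ k) (e k)) ^ 2 := by
    intro N
    induction N with
    | zero => simp
    | succ N ih =>
      have h := inner_le_bregman_sub_of_prox hpq hω hZ hc (hmem N) hu
        (c • gradEst φ τ (z N) (ξ N) (e N))
      have hstep : prox Z ω (z N) (c • gradEst φ τ (z N) (ξ N) (e N)) = z (N + 1) := rfl
      rw [hstep, real_inner_smul_left, ellNorm_smul hpq.symm.one_le, mul_pow, sq_abs] at h
      rw [Finset.sum_range_succ, Finset.sum_range_succ, mul_add, mul_add]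
      linarith
  have h1 := bregman_le hω (hmem 0) hu
  have h2 := bregman_nonneg hω (hmem N) hu
  linarith [key N]

theorem output_eq_sum {c : ℝ} (hc : c ≠ 0) {N : ℕ} (e : ℕ → Joint m n)
    (ξ : ℕ → Ξ) :
    output Z ω φ τ (fun _ => c) N e ξ =
      ∑ k ∈ Finset.range N, (1 / (N : ℝ)) • iterate Z ω φ τ (fun _ => c) e ξ k := by
  rw [output, Finset.smul_sum]
  refine Finset.sum_congr rfl fun k _ => ?_
  rw [smul_smul]
  congr 1
  simp
  field_simp

variable {Ω : Type*} [MeasurableSpace Ω] [MeasurableSpace Ξ] {P : Measure Ω}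
  {μ : Measure Ξ} {e : ℕ → Ω → Joint m n} {ξ : ℕ → Ω → Ξ}

theorem continuous_flipY : Continuous (flipY (m := m) (n := n)) := by
  unfold flipY
  exact continuous_joint.comp (continuous_xPart.prodMk continuous_yPart.neg)

theorem measurable_gradEst (hφ : Measurable fun w : Joint m n × Ξ => φ w.1 w.2) :
    Measurable fun w : Z × (Joint m n × Ξ) => gradEst φ τ w.1 w.2.2 w.2.1 := by
  unfold gradEst
  have h1 : Measurable fun w : Z × (Joint m n × Ξ) => φ (w.1 + τ • w.2.1) w.2.2 :=
    hφ.comp (g := fun w : Joint m n × Ξ => φ w.1 w.2)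
      (f := fun w : Z × (Joint m n × Ξ) => ((w.1 : Joint m n) + τ • w.2.1, w.2.2)) (by fun_prop)
  have h2 : Measurable fun w : Z × (Joint m n × Ξ) => φ (w.1 - τ • w.2.1) w.2.2 :=
    hφ.comp (g := fun w : Joint m n × Ξ => φ w.1 w.2)
      (f := fun w : Z × (Joint m n × Ξ) => ((w.1 : Joint m n) - τ • w.2.1, w.2.2)) (by fun_prop)
  have h3 : Measurable fun w : Z × (Joint m n × Ξ) => flipY w.2.1 :=
    continuous_flipY.measurable.comp (by fun_prop)
  exact (measurable_const.mul (h1.sub h2)).smul h3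

theorem measurable_prox_step (hp : 1 ≤ p) (hω : IsProxFunction p Z ω) (hZ : IsCompact Z)
    (hc : Convex ℝ Z) (hne : Z.Nonempty) (hφ : Measurable fun w : Joint m n × Ξ => φ w.1 w.2)
    (c : ℝ) : Measurable fun w : Z × (Joint m n × Ξ) =>
      (⟨prox Z ω w.1 (c • gradEst φ τ w.1 w.2.2 w.2.1),
        prox_mem hω.differentiableOn hZ w.1.2 _⟩ : Z) := by
  refine Measurable.subtype_mk ?_
  have h : ∀ w : Z × (Joint m n × Ξ), prox Z ω w.1 (c • gradEst φ τ w.1 w.2.2 w.2.1) =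
      mirrorMap Z ω (tangentGradient Z ω w.1 - c • gradEst φ τ w.1 w.2.2 w.2.1) :=
    fun w => prox_eq_mirrorMap w.1.2 _
  simp_rw [h]
  refine (continuous_mirrorMap hp hω hZ hc hne).measurable.comp ?_
  exact ((measurable_tangentGradient hω.differentiableOn hc).comp measurable_fst).sub
    ((measurable_gradEst hφ).const_smul c)

/-- The σ-algebra generated by the first `k` samples. -/
abbrev history (e : ℕ → Ω → Joint m n) (ξ : ℕ → Ω → Ξ) (k : ℕ) : MeasurableSpace Ω :=
  ⨆ j ∈ Set.Iio k, MeasurableSpace.comap (fun s => (e j s, ξ j s)) inferInstance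

/-- The iterate with index `k` uses the samples with index strictly below `k`. Together with
`indep_history` this makes it independent of the sample used in the next step. -/
theorem measurable_history_iterate (hp : 1 ≤ p) (hω : IsProxFunction p Z ω) (hZ : IsCompact Z)
    (hc : Convex ℝ Z) (hne : Z.Nonempty) (hφ : Measurable fun w : Joint m n × Ξ => φ w.1 w.2)
    (c : ℝ) (k : ℕ) :
    Measurable[history e ξ k] fun s =>
      (⟨iterate Z ω φ τ (fun _ => c) (fun j => e j s) (fun j => ξ j s) k,
        iterate_mem hω.differentiableOn hZ hne _ _ _ k⟩ : Z) := by
  induction k with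
  | zero =>
    exact Measurable.subtype_mk (f := fun _ => argminOn Z ω) measurable_const
  | succ k ih =>
    have h1 : history e ξ k ≤ history e ξ (k + 1) :=
      biSup_mono fun j hj => (Set.mem_Iio.1 hj).trans (Nat.lt_succ_self k)
    have h2 : MeasurableSpace.comap (fun s => (e k s, ξ k s)) inferInstance ≤ history e ξ (k + 1) :=
      le_biSup (fun j => MeasurableSpace.comap (fun s => (e j s, ξ j s)) inferInstance)
        (Set.mem_Iio.2 (Nat.lt_succ_self k))
    have h3 : Measurable[history e ξ (k + 1)] fun s => (e k s, ξ k s) :=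
      (comap_measurable _).mono h2 le_rfl
    have h4 := (measurable_prox_step (τ := τ) hp hω hZ hc hne hφ c).comp
      ((ih.mono h1 le_rfl).prodMk h3)
    exact Measurable.subtype_mk (measurable_subtype_coe.comp h4)

theorem history_le (hs : IsSampling P μ e ξ) (k : ℕ) :
    history e ξ k ≤ (inferInstance : MeasurableSpace Ω) :=
  iSup₂_le fun j _ => ((hs.measurable_e j).prodMk (hs.measurable_ξ j)).comap_le

theorem indep_history (hs : IsSampling P μ e ξ) (k : ℕ) :
    Indep (history e ξ k) (MeasurableSpace.comap (fun s => (e k s, ξ k s)) inferInstance) P := by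
  have h := indep_iSup_of_disjoint (S := Set.Iio k) (T := {k})
    (fun j => ((hs.measurable_e j).prodMk (hs.measurable_ξ j)).comap_le) hs.indep.iIndep
    (by simp)
  simp only [Set.mem_singleton_iff, iSup_iSup_eq_left] at h
  exact h

end Iterates

/-! ### Convexity and continuity of the saddle gap. -/

section ConvexGap

variable {m n : ℕ} {X : Set (EuclideanSpace ℝ (Fin m))} {Y : Set (EuclideanSpace ℝ (Fin n))}
  {F : Joint m n → ℝ} {τ : ℝ} {xs : EuclideanSpace ℝ (Fin m)} {ys : EuclideanSpace ℝ (Fin n)}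

theorem xPart_sum {ι : Type*} (t : Finset ι) (z : ι → Joint m n) :
    xPart (∑ i ∈ t, z i) = ∑ i ∈ t, xPart (z i) := by
  ext j; simp [xPart]

theorem yPart_sum {ι : Type*} (t : Finset ι) (z : ι → Joint m n) :
    yPart (∑ i ∈ t, z i) = ∑ i ∈ t, yPart (z i) := by
  ext j; simp [yPart]

/-- The gap is convex: one term moves only in `x` with `y_*` fixed, the other only in `y` with `x_*`
fixed, so Jensen's inequality applies to each. -/
theorem saddleGap_sum_le (hτ : 0 ≤ τ) (hcc : ConvexConcaveOn (nbhd (feasible X Y) τ) F)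
    (hxs : xs ∈ X) (hys : ys ∈ Y) {ι : Type*} {t : Finset ι} {w : ι → ℝ} {z : ι → Joint m n}
    (hw : ∀ i ∈ t, 0 ≤ w i) (hw1 : ∑ i ∈ t, w i = 1) (hz : ∀ i ∈ t, z i ∈ feasible X Y) :
    saddleGap F xs ys (∑ i ∈ t, w i • z i) ≤ ∑ i ∈ t, w i * saddleGap F xs ys (z i) := by
  have h1 := (hcc.1 ys).map_sum_le hw hw1 (p := fun i => xPart (z i)) fun i hi =>
    subset_nbhd hτ ⟨by simpa using (hz i hi).1, by simpa using hys⟩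
  have h2 := (hcc.2 xs).le_map_sum hw hw1 (p := fun i => yPart (z i)) fun i hi =>
    subset_nbhd hτ ⟨by simpa using hxs, by simpa using (hz i hi).2⟩
  simp only [saddleGap, xPart_sum, yPart_sum, xPart_smul, yPart_smul, mul_sub,
    Finset.sum_sub_distrib]
  exact sub_le_sub h1 h2

theorem continuousOn_saddleGap {K : NNReal} (hτ : 0 ≤ τ)
    (hF : LipschitzOnWith K F (nbhd (feasible X Y) τ)) (hxs : xs ∈ X) (hys : ys ∈ Y) :
    ContinuousOn (saddleGap F xs ys) (feasible X Y) := by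
  have hc := hF.continuousOn
  refine ContinuousOn.sub ?_ ?_
  · exact hc.comp (continuous_joint.comp (continuous_xPart.prodMk continuous_const)).continuousOn
      fun z hz => subset_nbhd hτ ⟨by simpa using hz.1, by simpa using hys⟩
  · exact hc.comp (continuous_joint.comp (continuous_const.prodMk continuous_yPart)).continuousOn
      fun z hz => subset_nbhd hτ ⟨by simpa using hxs, by simpa using hz.2⟩

end ConvexGap

/-! ### The convergence bound in terms of bias and second moment. -/

section Convergence

variable {m n : ℕ} {p q : ℝ≥0∞} {X : Set (EuclideanSpace ℝ (Fin m))}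
  {Y : Set (EuclideanSpace ℝ (Fin n))} {ω : Joint m n → ℝ} {Ξ : Type*} [MeasurableSpace Ξ]
  {φ : Joint m n → Ξ → ℝ} {F : Joint m n → ℝ} {τ K : ℝ} {xs : EuclideanSpace ℝ (Fin m)}
  {ys : EuclideanSpace ℝ (Fin n)}

/-- The standing assumptions on the feasible set, the prox-function and the mean objective. -/
structure IsSaddleSetup (p q : ℝ≥0∞) (X : Set (EuclideanSpace ℝ (Fin m)))
    (Y : Set (EuclideanSpace ℝ (Fin n))) (ω F : Joint m n → ℝ) (τ K : ℝ)
    (xs : EuclideanSpace ℝ (Fin m)) (ys : EuclideanSpace ℝ (Fin n)) : Prop where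
  conj : ENNReal.HolderConjugate p q
  compact_X : IsCompact X
  convex_X : Convex ℝ X
  compact_Y : IsCompact Y
  convex_Y : Convex ℝ Y
  nontrivial : (feasible X Y).Nontrivial
  prox : IsProxFunction p (feasible X Y) ω
  τ_pos : 0 < τ
  K_nonneg : 0 ≤ K
  lipschitz : LipschitzOnWith K.toNNReal F (nbhd (feasible X Y) τ)
  convexConcave : ConvexConcaveOn (nbhd (feasible X Y) τ) F
  saddle : IsSaddlePoint X Y F xs ys

namespace IsSaddleSetup

variable (S : IsSaddleSetup p q X Y ω F τ K xs ys)
include S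

theorem compact : IsCompact (feasible X Y) := isCompact_feasible S.compact_X S.compact_Y

theorem convex : Convex ℝ (feasible X Y) := convex_feasible S.convex_X S.convex_Y

theorem saddle_mem : joint xs ys ∈ feasible X Y :=
  ⟨by simpa using S.saddle.1, by simpa using S.saddle.2.1⟩

theorem one_le_dim : 1 ≤ m + n := by
  obtain ⟨z, -, v, -, hne⟩ := S.nontrivial
  by_contra hcon
  have : Subsingleton (Joint m n) :=
    Module.finrank_zero_iff (R := ℝ).1 (by rw [finrank_joint]; omega)
  exact hne (Subsingleton.elim z v)

theorem output_mem {c : ℝ} (hc : c ≠ 0) {N : ℕ} (hN : 1 ≤ N) (e : ℕ → Joint m n) (ξ : ℕ → Ξ) :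
    output (feasible X Y) ω φ τ (fun _ => c) N e ξ ∈ feasible X Y := by
  rw [output_eq_sum hc]
  refine S.convex.sum_mem (fun _ _ => by positivity) ?_ fun k _ =>
    iterate_mem S.prox.differentiableOn S.compact S.nontrivial.nonempty _ e ξ k
  have : (N : ℝ) ≠ 0 := by positivity
  simp [this]

/-- The saddle gap is controlled by the distance to the saddle point. -/
theorem saddleGap_le {z : Joint m n} (hz : z ∈ feasible X Y) :
    saddleGap F xs ys z ≤ √2 * K * ‖z - joint xs ys‖ := by
  have hτ := S.τ_pos.le
  have h0 := subset_nbhd hτ S.saddle_mem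
  have h1 : joint (xPart z) ys ∈ nbhd (feasible X Y) τ :=
    subset_nbhd hτ ⟨by simpa using hz.1, by simpa using S.saddle.2.1⟩
  have h2 : joint xs (yPart z) ∈ nbhd (feasible X Y) τ :=
    subset_nbhd hτ ⟨by simpa using S.saddle.1, by simpa using hz.2⟩
  have e1 := S.lipschitz.dist_le_mul _ h1 _ h0
  have e2 := S.lipschitz.dist_le_mul _ h2 _ h0
  rw [Real.dist_eq, dist_eq_norm, Real.coe_toNNReal _ S.K_nonneg] at e1 e2
  set α := ‖joint (xPart z) ys - joint xs ys‖
  set β := ‖joint xs (yPart z) - joint xs ys‖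
  -- The two displacements lie in orthogonal blocks; this is why `√2`, and not `2`, appears.
  have hαβ : α ^ 2 + β ^ 2 = ‖z - joint xs ys‖ ^ 2 := by
    simp [α, β, EuclideanSpace.real_norm_sq_eq, joint, xPart, yPart]
  have hsum : α + β ≤ √2 * ‖z - joint xs ys‖ := by
    refine abs_le_of_sq_le_sq' ?_ (by positivity) |>.2
    rw [mul_pow, Real.sq_sqrt (by norm_num), ← hαβ]
    nlinarith [sq_nonneg (α - β)]
  have := (abs_le.1 e1).2
  have := (abs_le.1 e2).1
  rw [saddleGap]
  calc F (joint (xPart z) ys) - F (joint xs (yPart z)) ≤ K * (α + β) := by linarith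
    _ ≤ K * (√2 * ‖z - joint xs ys‖) := mul_le_mul_of_nonneg_left hsum S.K_nonneg
    _ = _ := by ring

theorem exists_abs_saddleGap_le : ∃ B : ℝ, ∀ z ∈ feasible X Y, |saddleGap F xs ys z| ≤ B :=
  S.compact.exists_bound_of_continuousOn
    (continuousOn_saddleGap S.τ_pos.le S.lipschitz S.saddle.1 S.saddle.2.1)

variable {Ω : Type*} [MeasurableSpace Ω] {P : Measure Ω} [IsProbabilityMeasure P]
  {μ : Measure Ξ} [IsProbabilityMeasure μ] {e : ℕ → Ω → Joint m n} {ξ : ℕ → Ω → Ξ}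

theorem integrable_saddleGap_comp {U : Ω → Joint m n} (hU : Measurable U)
    (hmem : ∀ s, U s ∈ feasible X Y) : Integrable (fun s => saddleGap F xs ys (U s)) P := by
  obtain ⟨B, hB⟩ := S.exists_abs_saddleGap_le
  have hc : Continuous fun z : feasible X Y => saddleGap F xs ys z :=
    continuousOn_iff_continuous_domRestrict.1
      (continuousOn_saddleGap S.τ_pos.le S.lipschitz S.saddle.1 S.saddle.2.1)
  refine Integrable.of_bound (C := B) ?_ (Filter.Eventually.of_forall fun s => hB _ (hmem s))
  exact (hc.measurable.comp (hU.subtype_mk (h := hmem))).aestronglyMeasurable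

variable (hφ : Measurable fun w : Joint m n × Ξ => φ w.1 w.2) (hs : IsSampling P μ e ξ)
include hφ hs

theorem measurable_iterate (c : ℝ) (k : ℕ) : Measurable fun s =>
    iterate (feasible X Y) ω φ τ (fun _ => c) (fun j => e j s) (fun j => ξ j s) k :=
  measurable_subtype_coe.comp ((measurable_history_iterate S.conj.one_le S.prox S.compact S.convex
    S.nontrivial.nonempty hφ c k).mono (history_le hs k) le_rfl)

theorem indepFun_iterate (c : ℝ) (k : ℕ) : IndepFun (fun s =>
    (⟨iterate (feasible X Y) ω φ τ (fun _ => c) (fun j => e j s) (fun j => ξ j s) k,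
      iterate_mem S.prox.differentiableOn S.compact S.nontrivial.nonempty _ _ _ k⟩ :
        feasible X Y)) (fun s => (e k s, ξ k s)) P := by
  rw [IndepFun_iff_Indep]
  exact indep_of_indep_of_le_left (indep_history hs k) (measurable_history_iterate S.conj.one_le
    S.prox S.compact S.convex S.nontrivial.nonempty hφ c k).comap_le

theorem measurable_output (c : ℝ) (N : ℕ) : Measurable fun s =>
    output (feasible X Y) ω φ τ (fun _ => c) N (fun j => e j s) (fun j => ξ j s) := by
  unfold output
  have h : Measurable fun s => ∑ k ∈ Finset.range N,
      c • iterate (feasible X Y) ω φ τ (fun _ => c) (fun j => e j s) (fun j => ξ j s) k :=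
    Finset.measurable_fun_sum _ fun k _ => (S.measurable_iterate hφ hs c k).const_smul c
  exact h.const_smul ((∑ _k ∈ Finset.range N, c)⁻¹)

/-- The convergence bound of the method, in terms of a bound `β` on the bias and a bound `G` on the
second moment of the gradient estimator. -/
theorem integral_saddleGap_output_le {Lφ : Ξ → ℝ} (hL : MemLp Lφ 2 μ)
    (hφL : ∀ z ∈ feasible X Y, ∀ e : Joint m n, ‖e‖ = 1 → ∀ ξ,
      |φ (z + τ • e) ξ - φ (z - τ • e) ξ| ≤ Lφ ξ)
    {β G : ℝ} (hβ : ∀ z ∈ feasible X Y, saddleGap F xs ys z - β ≤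
      ∫ w, inner ℝ (gradEst φ τ z w.2 w.1) (z - joint xs ys) ∂(sphereUniform m n).prod μ)
    (hG : ∀ z ∈ feasible X Y,
      ∫ w, ellNorm q (gradEst φ τ z w.2 w.1) ^ 2 ∂(sphereUniform m n).prod μ ≤ G)
    {c : ℝ} (hc : 0 < c) {N : ℕ} (hN : 1 ≤ N) :
    ∫ s, saddleGap F xs ys (output (feasible X Y) ω φ τ (fun _ => c) N (fun j => e j s)
      (fun j => ξ j s)) ∂P ≤ omegaDiam (feasible X Y) ω ^ 2 / (2 * c * N) + c * G / 2 + β := by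
  have hnt := nontrivial_joint S.one_le_dim
  have hq : 1 ≤ q := S.conj.symm.one_le
  have hτ := S.τ_pos
  have hN0 : (0 : ℝ) < N := by exact_mod_cast hN
  have hprob : IsProbabilityMeasure (sphereUniform m n) :=
    isProbabilityMeasure_unitSphereMeasure (E := Joint m n)
  set Z := feasible X Y with hZ
  set u := joint xs ys with hu
  set ν := (sphereUniform m n).prod μ with hν
  set z : ℕ → Ω → Joint m n := fun k s =>
    iterate Z ω φ τ (fun _ => c) (fun j => e j s) (fun j => ξ j s) k with hz
  have hmem : ∀ k s, z k s ∈ Z := fun k s =>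
    iterate_mem S.prox.differentiableOn S.compact S.nontrivial.nonempty _ _ _ k
  set U : ℕ → Ω → Z := fun k s => ⟨z k s, hmem k s⟩ with hU
  have hUm : ∀ k, Measurable (U k) := fun k => (S.measurable_iterate hφ hs c k).subtype_mk
  have hWm : ∀ k, Measurable fun s => (e k s, ξ k s) := fun k =>
    (hs.measurable_e k).prodMk (hs.measurable_ξ k)
  have hind : ∀ k, IndepFun (U k) (fun s => (e k s, ξ k s)) P := S.indepFun_iterate hφ hs c
  have hnorm : ∀ᵐ w ∂ν, ‖w.1‖ = 1 :=
    Measure.quasiMeasurePreserving_fst.ae (ae_unitSphereMeasure_norm (E := Joint m n))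
  have hLφ : Integrable (fun w : Joint m n × Ξ => Lφ w.2) ν :=
    (hL.integrable (by norm_num)).comp_snd (sphereUniform m n)
  have hLφ2 : Integrable (fun w : Joint m n × Ξ => Lφ w.2 ^ 2) ν :=
    (hL.integrable_sq).comp_snd (sphereUniform m n)
  set A : ℝ := ((m + n : ℕ) : ℝ) / (2 * τ) with hA
  have hA0 : 0 ≤ A := by positivity
  obtain ⟨R, hR⟩ := S.compact.exists_bound_of_continuousOn
    (f := fun v => v - u) (by fun_prop)
  obtain ⟨Q, hQ⟩ := (isCompact_sphere (0 : Joint m n) 1).exists_bound_of_continuousOn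
    (continuous_ellNorm hq).continuousOn
  set Ψ₁ : Z × (Joint m n × Ξ) → ℝ := fun w =>
    inner ℝ (gradEst φ τ w.1 w.2.2 w.2.1) ((w.1 : Joint m n) - u) with hΨ₁
  set Ψ₂ : Z × (Joint m n × Ξ) → ℝ := fun w =>
    ellNorm q (gradEst φ τ w.1 w.2.2 w.2.1) ^ 2 with hΨ₂
  have hgm : Measurable fun w : Z × (Joint m n × Ξ) => gradEst φ τ w.1 w.2.2 w.2.1 :=
    measurable_gradEst hφ
  have hΨ₁m : Measurable Ψ₁ := hgm.inner (by fun_prop)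
  have hΨ₂m : Measurable Ψ₂ := ((continuous_ellNorm hq).measurable.comp hgm).pow_const 2
  -- The bound is uniform over the compact set of states and integrable in `ξ`, as Fubini requires;
  -- `hb₂` plays the same role for the squared norm.
  have hb₁ : ∀ᵐ w ∂ν, ∀ v : Z, |Ψ₁ (v, w)| ≤ A * R * Lφ w.2 := by
    filter_upwards [hnorm] with w hw v
    simp only [hΨ₁]
    have h1 := hφL v v.2 w.1 hw w.2
    have h2 := hR v v.2
    rw [inner_gradEst, abs_mul, abs_mul, abs_of_nonneg hA0]
    have h3 : |inner ℝ w.1 (flipY ((v : Joint m n) - u))| ≤ R := by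
      refine (abs_real_inner_le_norm _ _).trans ?_
      rw [hw, one_mul, norm_flipY]
      exact h2
    calc A * |φ (v + τ • w.1) w.2 - φ (v - τ • w.1) w.2| * |inner ℝ w.1 (flipY ((v : Joint m n) - u))|
        ≤ A * Lφ w.2 * R := by
          gcongr
          exact mul_nonneg hA0 ((abs_nonneg _).trans h1)
      _ = _ := by ring
  have hb₂ : ∀ᵐ w ∂ν, ∀ v : Z, |Ψ₂ (v, w)| ≤ (A * Q) ^ 2 * Lφ w.2 ^ 2 := by
    filter_upwards [hnorm] with w hw v
    simp only [hΨ₂]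
    have h1 := hφL v v.2 w.1 hw w.2
    have h2 := hQ w.1 (by simp [hw])
    rw [Real.norm_of_nonneg (ellNorm_nonneg hq _)] at h2
    rw [ellNorm_gradEst hq, abs_of_nonneg (sq_nonneg _), ← mul_pow, abs_mul, abs_of_nonneg hA0]
    refine pow_le_pow_left₀ (mul_nonneg (by positivity) (ellNorm_nonneg hq _)) ?_ 2
    calc A * |φ (v + τ • w.1) w.2 - φ (v - τ • w.1) w.2| * ellNorm q w.1
        ≤ A * Lφ w.2 * Q := by
          gcongr
          · exact ellNorm_nonneg hq _
          · exact mul_nonneg hA0 ((abs_nonneg _).trans h1)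
      _ = _ := by ring
  have hgapint : ∀ k, Integrable (fun s => saddleGap F xs ys (z k s)) P := fun k =>
    S.integrable_saddleGap_comp (S.measurable_iterate hφ hs c k) (hmem k)
  have hint₁ : ∀ k, Integrable (fun s => Ψ₁ (U k s, (e k s, ξ k s))) P := fun k =>
    (integrable_comp_of_indepFun (hUm k) (hWm k) (hind k) (hs.law k) hΨ₁m
      (hLφ.const_mul (A * R)) hb₁).2.1
  have hint₂ : ∀ k, Integrable (fun s => Ψ₂ (U k s, (e k s, ξ k s))) P := fun k =>
    (integrable_comp_of_indepFun (hUm k) (hWm k) (hind k) (hs.law k) hΨ₂m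
      (hLφ2.const_mul ((A * Q) ^ 2)) hb₂).2.1
  have hE₁ : ∀ k, ∫ s, saddleGap F xs ys (z k s) ∂P - β ≤ ∫ s, Ψ₁ (U k s, (e k s, ξ k s)) ∂P := by
    intro k
    have h := integral_le_of_indepFun (B := fun v : Z => saddleGap F xs ys v - β)
      (hUm k) (hWm k) (hind k) (hs.law k) hΨ₁m (hLφ.const_mul (A * R)) hb₁
      ((hgapint k).sub (integrable_const β)) fun v => hβ v v.2
    rw [integral_sub (hgapint k) (integrable_const β)] at h
    simpa using h
  have hE₂ : ∀ k, ∫ s, Ψ₂ (U k s, (e k s, ξ k s)) ∂P ≤ G := by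
    intro k
    -- The upper bound is obtained from the lower-bound lemma by a change of sign.
    have h := integral_le_of_indepFun (B := fun _ : Z => -G) (Ψ := fun w => -Ψ₂ w)
      (hUm k) (hWm k) (hind k) (hs.law k) hΨ₂m.neg (hLφ2.const_mul ((A * Q) ^ 2))
      (by simpa only [abs_neg] using hb₂) (integrable_const _) fun v => by
        rw [integral_neg]; exact neg_le_neg (hG v v.2)
    simp only [integral_const, probReal_univ, one_smul, integral_neg] at h
    linarith
  have hregret : c * ∑ k ∈ Finset.range N, ∫ s, Ψ₁ (U k s, (e k s, ξ k s)) ∂P ≤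
      omegaDiam Z ω ^ 2 / 2 + c ^ 2 / 2 * ∑ k ∈ Finset.range N,
        ∫ s, Ψ₂ (U k s, (e k s, ξ k s)) ∂P := by
    have hpath : ∀ s, c * ∑ k ∈ Finset.range N, Ψ₁ (U k s, (e k s, ξ k s)) ≤
        omegaDiam Z ω ^ 2 / 2 + c ^ 2 / 2 * ∑ k ∈ Finset.range N, Ψ₂ (U k s, (e k s, ξ k s)) :=
      fun s => sum_inner_gradEst_le S.conj S.prox S.compact S.convex S.saddle_mem c
        (fun j => e j s) (fun j => ξ j s) N
    have hs₁ : Integrable (fun s => ∑ k ∈ Finset.range N, Ψ₁ (U k s, (e k s, ξ k s))) P :=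
      integrable_finsetSum _ fun k _ => hint₁ k
    have hs₂ : Integrable (fun s => ∑ k ∈ Finset.range N, Ψ₂ (U k s, (e k s, ξ k s))) P :=
      integrable_finsetSum _ fun k _ => hint₂ k
    have h := integral_mono (hs₁.const_mul c)
      ((integrable_const (omegaDiam Z ω ^ 2 / 2)).add (hs₂.const_mul (c ^ 2 / 2))) hpath
    simp only [Pi.add_apply] at h
    rw [integral_const_mul, integral_finsetSum _ fun k _ => hint₁ k,
      integral_add (integrable_const _) (hs₂.const_mul _), integral_const_mul,
      integral_finsetSum _ fun k _ => hint₂ k] at h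
    simpa using h
  have hJ : ∫ s, saddleGap F xs ys (output Z ω φ τ (fun _ => c) N (fun j => e j s)
      (fun j => ξ j s)) ∂P ≤ 1 / N * ∑ k ∈ Finset.range N, ∫ s, saddleGap F xs ys (z k s) ∂P := by
    rw [← integral_finsetSum _ fun k _ => hgapint k, ← integral_const_mul]
    refine integral_mono (S.integrable_saddleGap_comp (S.measurable_output hφ hs c N)
      fun s => S.output_mem hc.ne' hN _ _)
      ((integrable_finsetSum _ fun k _ => hgapint k).const_mul _) fun s => ?_
    simp only
    rw [output_eq_sum hc.ne', Finset.mul_sum]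
    exact saddleGap_sum_le hτ.le S.convexConcave S.saddle.1 S.saddle.2.1
      (fun _ _ => by positivity) (by simp [hN0.ne']) fun k _ => hmem k s
  have hsum₁ : ∑ k ∈ Finset.range N, ∫ s, saddleGap F xs ys (z k s) ∂P ≤
      ∑ k ∈ Finset.range N, ∫ s, Ψ₁ (U k s, (e k s, ξ k s)) ∂P + N * β := by
    have h := Finset.sum_le_sum fun k (_ : k ∈ Finset.range N) => hE₁ k
    rw [Finset.sum_sub_distrib] at h
    simp only [Finset.sum_const, Finset.card_range, nsmul_eq_mul] at h
    linarith
  have hsum₂ : ∑ k ∈ Finset.range N, ∫ s, Ψ₂ (U k s, (e k s, ξ k s)) ∂P ≤ N * G := by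
    have h := Finset.sum_le_sum fun k (_ : k ∈ Finset.range N) => hE₂ k
    simpa using h
  refine hJ.trans ?_
  set T := ∑ k ∈ Finset.range N, ∫ s, Ψ₁ (U k s, (e k s, ξ k s)) ∂P
  have hT : T ≤ omegaDiam Z ω ^ 2 / (2 * c) + c / 2 * (N * G) := by
    have h1 : c * T ≤ c * (omegaDiam Z ω ^ 2 / (2 * c) + c / 2 * (N * G)) := by
      refine hregret.trans ?_
      have h2 : c * (omegaDiam Z ω ^ 2 / (2 * c) + c / 2 * (N * G)) =
          omegaDiam Z ω ^ 2 / 2 + c ^ 2 / 2 * (N * G) := by field_simp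
      rw [h2]
      gcongr
    exact le_of_mul_le_mul_left h1 hc
  calc 1 / (N : ℝ) * ∑ k ∈ Finset.range N, ∫ s, saddleGap F xs ys (z k s) ∂P
      ≤ 1 / N * (omegaDiam Z ω ^ 2 / (2 * c) + c / 2 * (N * G) + N * β) := by
        gcongr
        linarith
    _ = _ := by field_simp

end IsSaddleSetup

end Convergence

/-! ### The noisy oracle: mean and second moment of the gradient estimator. -/

section Oracle

variable {m n : ℕ} {q : ℝ≥0∞} {Z : Set (Joint m n)} {Ξ : Type*} [MeasurableSpace Ξ]
  {μ : Measure Ξ} [IsProbabilityMeasure μ] {f φ : Joint m n → Ξ → ℝ} {δ : Joint m n → ℝ}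
  {L : Ξ → ℝ} {τ : ℝ} {z : Joint m n}

theorem norm_add_smul_sub_sub_smul (hτ : 0 ≤ τ) {e : Joint m n} (he : ‖e‖ = 1) :
    ‖z + τ • e - (z - τ • e)‖ = 2 * τ := by
  rw [show z + τ • e - (z - τ • e) = (2 * τ) • e by module, norm_smul, he,
    Real.norm_of_nonneg (by positivity), mul_one]

/-- A function that is measurable in `ξ` and Lipschitz in `z ∈ S` agrees on `S` with a jointly
measurable function. -/
theorem exists_measurable_extension {S : Set (Joint m n)} (hS : MeasurableSet S)
    (hf : ∀ z ∈ S, Measurable (f z))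
    (hL : ∀ ξ, ∀ z₁ ∈ S, ∀ z₂ ∈ S, |f z₁ ξ - f z₂ ξ| ≤ L ξ * ‖z₁ - z₂‖) :
    ∃ f' : Joint m n → Ξ → ℝ, (Measurable fun w : Joint m n × Ξ => f' w.1 w.2) ∧
      ∀ z ∈ S, f' z = f z := by
  set g : S → Ξ → ℝ := fun z => f z with hg
  have hgm : Measurable (Function.uncurry g) := by
    refine measurable_uncurry_of_continuous_of_measurable (fun ξ => ?_) fun z => hf z z.2
    refine (LipschitzWith.of_dist_le_mul (K := |L ξ|.toNNReal) fun x y => ?_).continuous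
    rw [Real.coe_toNNReal _ (abs_nonneg _), Real.dist_eq, Subtype.dist_eq, dist_eq_norm]
    exact (hL ξ x x.2 y y.2).trans (by gcongr; exact le_abs_self _)
  have hemb : MeasurableEmbedding (Prod.map (Subtype.val : S → Joint m n) (id : Ξ → Ξ)) :=
    (MeasurableEmbedding.subtype_coe hS).prodMap MeasurableEmbedding.id
  refine ⟨fun z ξ => Function.extend (Prod.map (Subtype.val : S → Joint m n) (id : Ξ → Ξ))
    (Function.uncurry g) (fun _ => 0) (z, ξ), hemb.measurable_extend hgm measurable_const, ?_⟩
  intro z hz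
  ext ξ
  exact hemb.injective.extend_apply (Function.uncurry g) _ (⟨z, hz⟩, ξ)

/-- Jensen's inequality gives `(𝔼 L)² ≤ 𝔼 L² ≤ M²`. -/
theorem lipschitzOnWith_meanObj {S : Set (Joint m n)} {M : ℝ} (hM : 0 ≤ M)
    (hf : ∀ z ∈ S, Integrable (f z) μ) (hL : MemLp L 2 μ) (hLM : ∫ ξ, L ξ ^ 2 ∂μ ≤ M ^ 2)
    (hfL : ∀ ξ, ∀ z₁ ∈ S, ∀ z₂ ∈ S, |f z₁ ξ - f z₂ ξ| ≤ L ξ * ‖z₁ - z₂‖) :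
    LipschitzOnWith M.toNNReal (meanObj μ f) S := by
  have hLi : Integrable L μ := hL.integrable (by norm_num)
  have h1 : ∫ ξ, L ξ ∂μ ≤ M := by
    refine abs_le_of_sq_le_sq' ?_ hM |>.2
    exact ((even_two.convexOn_pow (𝕜 := ℝ)).map_integral_le (by fun_prop) isClosed_univ
      (Filter.Eventually.of_forall fun _ => Set.mem_univ _) hLi hL.integrable_sq).trans hLM
  refine LipschitzOnWith.of_dist_le_mul fun x hx y hy => ?_
  rw [Real.coe_toNNReal _ hM, Real.dist_eq, dist_eq_norm, meanObj, meanObj,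
    ← integral_sub (hf x hx) (hf y hy)]
  calc |∫ ξ, (f x ξ - f y ξ) ∂μ| ≤ ∫ ξ, |f x ξ - f y ξ| ∂μ := abs_integral_le_integral_abs
    _ ≤ ∫ ξ, L ξ * ‖x - y‖ ∂μ :=
      integral_mono ((hf x hx).sub (hf y hy)).abs (hLi.mul_const _) fun ξ => hfL ξ x hx y hy
    _ = (∫ ξ, L ξ ∂μ) * ‖x - y‖ := integral_mul_const _ _
    _ ≤ M * ‖x - y‖ := by gcongr

variable (hd : 1 ≤ m + n) (hτ : 0 < τ) (hz : z ∈ Z)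
include hd hτ hz

/-- The expectation of the gradient estimator with noise. -/
theorem integral_inner_gradEst (hf : Measurable fun w : Joint m n × Ξ => f w.1 w.2)
    (hfi : ∀ z ∈ nbhd Z τ, Integrable (f z) μ) (hL : MemLp L 2 μ)
    (hfL : ∀ ξ, ∀ z₁ ∈ nbhd Z τ, ∀ z₂ ∈ nbhd Z τ, |f z₁ ξ - f z₂ ξ| ≤ L ξ * ‖z₁ - z₂‖)
    (hδ : Measurable δ) {B : ℝ}
    (hB : ∀ e : Joint m n, ‖e‖ = 1 → |δ (z + τ • e) - δ (z - τ • e)| ≤ B) (v : Joint m n) :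
    ∫ w, inner ℝ (gradEst (noisyOracle f δ) τ z w.2 w.1) v ∂(sphereUniform m n).prod μ =
      twoPoint (meanObj μ f) τ z (flipY v) + twoPoint δ τ z (flipY v) := by
  have hnt := nontrivial_joint hd
  have hprob : IsProbabilityMeasure (sphereUniform m n) :=
    isProbabilityMeasure_unitSphereMeasure (E := Joint m n)
  set A : ℝ := ((m + n : ℕ) : ℝ) / (2 * τ) with hA
  have hA0 : 0 ≤ A := by positivity
  have hnorm : ∀ᵐ w ∂(sphereUniform m n).prod μ, ‖w.1‖ = 1 :=
    Measure.quasiMeasurePreserving_fst.ae (ae_unitSphereMeasure_norm (E := Joint m n))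
  have hin : ∀ e : Joint m n, ‖e‖ = 1 → |inner ℝ e (flipY v)| ≤ ‖v‖ := fun e he =>
    (abs_real_inner_le_norm _ _).trans (by rw [he, one_mul, norm_flipY])
  have hfm : ∀ s : ℝ, Measurable fun w : Joint m n × Ξ => f (z + s • w.1) w.2 := fun s =>
    hf.comp (g := fun w : Joint m n × Ξ => f w.1 w.2)
      (f := fun w : Joint m n × Ξ => (z + s • w.1, w.2)) (by fun_prop)
  have hfm' : Measurable fun w : Joint m n × Ξ => f (z - τ • w.1) w.2 := by
    simpa only [neg_smul, ← sub_eq_add_neg] using hfm (-τ)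
  have hinm : Measurable fun w : Joint m n × Ξ => (inner ℝ w.1 (flipY v) : ℝ) := by fun_prop
  have hi₁ : Integrable (fun w : Joint m n × Ξ =>
      A * (f (z + τ • w.1) w.2 - f (z - τ • w.1) w.2) * inner ℝ w.1 (flipY v))
      ((sphereUniform m n).prod μ) := by
    refine (((hL.integrable (by norm_num)).comp_snd (sphereUniform m n)).const_mul
      (A * (2 * τ) * ‖v‖)).mono' ((measurable_const.mul ((hfm τ).sub hfm')).mul
        hinm).aestronglyMeasurable ?_
    filter_upwards [hnorm] with w hw
    have h1 := hfL w.2 _ (add_smul_mem_nbhd hτ.le hz hw.le) _ (sub_smul_mem_nbhd hτ.le hz hw.le)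
    rw [norm_add_smul_sub_sub_smul hτ.le hw] at h1
    rw [Real.norm_eq_abs, abs_mul, abs_mul, abs_of_nonneg hA0]
    calc A * |f (z + τ • w.1) w.2 - f (z - τ • w.1) w.2| * |inner ℝ w.1 (flipY v)|
        ≤ A * (L w.2 * (2 * τ)) * ‖v‖ := by
          gcongr
          · exact mul_nonneg hA0 ((abs_nonneg _).trans h1)
          · exact hin _ hw
      _ = _ := by ring
  have hi₂ : Integrable (fun e : Joint m n =>
      A * (δ (z + τ • e) - δ (z - τ • e)) * inner ℝ e (flipY v)) (sphereUniform m n) := by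
    refine Integrable.of_bound (C := A * B * ‖v‖) (Measurable.aestronglyMeasurable (by fun_prop)) ?_
    filter_upwards [ae_unitSphereMeasure_norm (E := Joint m n)] with e he
    have h1 := hB e he
    rw [Real.norm_eq_abs, abs_mul, abs_mul, abs_of_nonneg hA0]
    gcongr
    · exact mul_nonneg hA0 ((abs_nonneg _).trans h1)
    · exact hin _ he
  calc ∫ w, inner ℝ (gradEst (noisyOracle f δ) τ z w.2 w.1) v ∂(sphereUniform m n).prod μ
      = ∫ w, (A * (f (z + τ • w.1) w.2 - f (z - τ • w.1) w.2) * inner ℝ w.1 (flipY v) +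
          A * (δ (z + τ • w.1) - δ (z - τ • w.1)) * inner ℝ w.1 (flipY v))
            ∂(sphereUniform m n).prod μ := by
        refine integral_congr_ae (Filter.Eventually.of_forall fun w => ?_)
        simp only [inner_gradEst, noisyOracle]
        ring
    _ = _ := by
        rw [integral_add hi₁ (hi₂.comp_fst μ), integral_prod _ hi₁,
          integral_prod _ (hi₂.comp_fst μ)]
        congr 1
        · refine integral_congr_ae ?_
          filter_upwards [ae_unitSphereMeasure_norm (E := Joint m n)] with e he
          simp only [meanObj]
          rw [integral_mul_const, integral_const_mul,
            integral_sub (hfi _ (add_smul_mem_nbhd hτ.le hz he.le))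
              (hfi _ (sub_smul_mem_nbhd hτ.le hz he.le))]
        · simp [twoPoint, sphereUniform_eq, hA]

/-- Bounded noise biases the two-point estimator by at most `√d Δ τ⁻¹`. -/
theorem neg_le_twoPoint_of_boundedNoise {Δ : ℝ} (hΔ : BoundedNoise (nbhd Z τ) δ Δ)
    (u : Joint m n) : -(√((m + n : ℕ) : ℝ) * Δ / τ * ‖u‖) ≤ twoPoint δ τ z u := by
  have hnt := nontrivial_joint hd
  have hd0 : (0 : ℝ) < ((m + n : ℕ) : ℝ) := by exact_mod_cast hd
  have hΔ0 : 0 ≤ Δ := (abs_nonneg _).trans (hΔ z (subset_nbhd hτ.le hz))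
  refine (neg_le_of_abs_le (a := twoPoint δ τ z u) ?_)
  calc |twoPoint δ τ z u|
      ≤ ∫ e, ((m + n : ℕ) : ℝ) * Δ / τ * |inner ℝ e u| ∂unitSphereMeasure (Joint m n) := by
        rw [← Real.norm_eq_abs]
        refine norm_integral_le_of_norm_le
          (integrable_unitSphereMeasure_of_continuous (by fun_prop)) ?_
        filter_upwards [ae_unitSphereMeasure_norm] with e he
        have h1 := abs_le.1 (hΔ _ (add_smul_mem_nbhd hτ.le hz he.le))
        have h2 := abs_le.1 (hΔ _ (sub_smul_mem_nbhd hτ.le hz he.le))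
        rw [Real.norm_eq_abs, abs_mul, abs_mul, abs_of_nonneg (by positivity)]
        gcongr
        calc ((m + n : ℕ) : ℝ) / (2 * τ) * |δ (z + τ • e) - δ (z - τ • e)|
            ≤ ((m + n : ℕ) : ℝ) / (2 * τ) * (2 * Δ) := by
              gcongr
              exact abs_le.2 ⟨by linarith, by linarith⟩
          _ = _ := by field_simp
    _ = ((m + n : ℕ) : ℝ) * Δ / τ * ∫ e, |inner ℝ e u| ∂unitSphereMeasure (Joint m n) :=
        integral_const_mul _ _
    -- A random direction is nearly orthogonal to `u`; this reduces the factor `d` to `√d`.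
    _ ≤ ((m + n : ℕ) : ℝ) * Δ / τ * (‖u‖ / √((m + n : ℕ) : ℝ)) := by
        gcongr
        exact integral_abs_inner_le hd u
    _ = √((m + n : ℕ) : ℝ) * Δ / τ * ‖u‖ := by
        have h := Real.mul_self_sqrt hd0.le
        have h0 : √((m + n : ℕ) : ℝ) ≠ 0 := by positivity
        nth_rewrite 1 [← h]
        field_simp

theorem integrable_ellNorm_gradEst_sq (hq : 1 ≤ q)
    (hφ : Measurable fun w : Joint m n × Ξ => φ w.1 w.2) (hL : MemLp L 2 μ)
    (hφL : ∀ ξ, ∀ e : Joint m n, ‖e‖ = 1 → |φ (z + τ • e) ξ - φ (z - τ • e) ξ| ≤ L ξ) :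
    Integrable (fun w => ellNorm q (gradEst φ τ z w.2 w.1) ^ 2) ((sphereUniform m n).prod μ) := by
  have hnt := nontrivial_joint hd
  have hprob : IsProbabilityMeasure (sphereUniform m n) :=
    isProbabilityMeasure_unitSphereMeasure (E := Joint m n)
  set A : ℝ := ((m + n : ℕ) : ℝ) / (2 * τ) with hA
  have hA0 : 0 ≤ A := by positivity
  obtain ⟨Q, hQ⟩ := (isCompact_sphere (0 : Joint m n) 1).exists_bound_of_continuousOn
    (continuous_ellNorm hq).continuousOn
  have hm : Measurable fun w : Joint m n × Ξ => gradEst φ τ z w.2 w.1 :=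
    (measurable_gradEst (Z := Z) hφ).comp (measurable_prodMk_left (x := (⟨z, hz⟩ : Z)))
  refine ((hL.integrable_sq.comp_snd (sphereUniform m n)).const_mul ((A * Q) ^ 2)).mono'
    (((continuous_ellNorm hq).measurable.comp hm).pow_const 2).aestronglyMeasurable ?_
  filter_upwards [Measure.quasiMeasurePreserving_fst.ae
    (ae_unitSphereMeasure_norm (E := Joint m n))] with w hw
  have h1 := hφL w.2 w.1 hw
  have h2 := hQ w.1 (by simp [hw])
  rw [Real.norm_of_nonneg (ellNorm_nonneg hq _)] at h2
  rw [ellNorm_gradEst hq, Real.norm_of_nonneg (sq_nonneg _), ← mul_pow, abs_mul, abs_of_nonneg hA0]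
  refine pow_le_pow_left₀ (mul_nonneg (by positivity) (ellNorm_nonneg hq _)) ?_ 2
  calc A * |φ (z + τ • w.1) w.2 - φ (z - τ • w.1) w.2| * ellNorm q w.1
      ≤ A * L w.2 * Q := by
        gcongr
        · exact ellNorm_nonneg hq _
        · exact mul_nonneg hA0 ((abs_nonneg _).trans h1)
    _ = _ := by ring

/-- The second moment of the gradient estimator of a Lipschitz objective. -/
theorem integral_ellNorm_gradEst_sq_le (hq : 1 ≤ q)
    (hφ : Measurable fun w : Joint m n × Ξ => φ w.1 w.2) (hL : MemLp L 2 μ) (hL0 : ∀ ξ, 0 ≤ L ξ)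
    (hφL : ∀ ξ, ∀ z₁ ∈ nbhd Z τ, ∀ z₂ ∈ nbhd Z τ, |φ z₁ ξ - φ z₂ ξ| ≤ L ξ * ‖z₁ - z₂‖) :
    ∫ w, ellNorm q (gradEst φ τ z w.2 w.1) ^ 2 ∂(sphereUniform m n).prod μ ≤
      secondMomentConst / 4 * (((m + n : ℕ) : ℝ) * aSq m n q) * ∫ ξ, L ξ ^ 2 ∂μ := by
  have hnt := nontrivial_joint hd
  have hd0 : (0 : ℝ) < ((m + n : ℕ) : ℝ) := by exact_mod_cast hd
  have hprob : IsProbabilityMeasure (sphereUniform m n) :=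
    isProbabilityMeasure_unitSphereMeasure (E := Joint m n)
  have hint := integrable_ellNorm_gradEst_sq hd hτ hz hq hφ (hL.const_mul (2 * τ))
    fun ξ e he => by
      have h := hφL ξ _ (add_smul_mem_nbhd hτ.le hz he.le) _ (sub_smul_mem_nbhd hτ.le hz he.le)
      rwa [norm_add_smul_sub_sub_smul hτ.le he, mul_comm] at h
  rw [integral_prod_symm _ hint, ← integral_const_mul]
  refine integral_mono hint.integral_prod_right (hL.integrable_sq.const_mul _) fun ξ => ?_
  -- Concentration is applied for each fixed `ξ`, with Lipschitz constant `τ L(ξ)` on the sphere;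
  -- the powers of `τ` then cancel.
  have h := integral_sub_neg_sq_mul_ellNorm_sq_le hd hq (h := fun e => φ (z + τ • e) ξ)
    (L := τ * L ξ) (mul_nonneg hτ.le (hL0 ξ)) fun x y hx hy => by
      refine (hφL ξ _ (add_smul_mem_nbhd hτ.le hz hx.le) _
        (add_smul_mem_nbhd hτ.le hz hy.le)).trans (le_of_eq ?_)
      rw [add_sub_add_left_eq_sub, ← smul_sub, norm_smul, Real.norm_of_nonneg hτ.le]
      ring
  calc ∫ e, ellNorm q (gradEst φ τ z ξ e) ^ 2 ∂sphereUniform m n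
      = (((m + n : ℕ) : ℝ) / (2 * τ)) ^ 2 * ∫ e, (φ (z + τ • e) ξ - φ (z + τ • -e) ξ) ^ 2 *
          ellNorm q e ^ 2 ∂unitSphereMeasure (Joint m n) := by
        rw [← integral_const_mul, sphereUniform_eq]
        refine integral_congr_ae (Filter.Eventually.of_forall fun e => ?_)
        simp only [ellNorm_gradEst hq, mul_pow, sq_abs, smul_neg, ← sub_eq_add_neg]
        ring
    _ ≤ (((m + n : ℕ) : ℝ) / (2 * τ)) ^ 2 *
          (secondMomentConst * (τ * L ξ) ^ 2 / ((m + n : ℕ) : ℝ) * aSq m n q) := by gcongr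
    _ = _ := by field_simp; ring

/-- The second moment of the gradient estimator with bounded noise. -/
theorem integral_ellNorm_gradEst_sq_le_of_boundedNoise (hq : 1 ≤ q)
    (hf : Measurable fun w : Joint m n × Ξ => f w.1 w.2) (hL : MemLp L 2 μ) (hL0 : ∀ ξ, 0 ≤ L ξ)
    (hfL : ∀ ξ, ∀ z₁ ∈ nbhd Z τ, ∀ z₂ ∈ nbhd Z τ, |f z₁ ξ - f z₂ ξ| ≤ L ξ * ‖z₁ - z₂‖)
    {Δ : ℝ} (hΔ : BoundedNoise (nbhd Z τ) δ Δ) :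
    ∫ w, ellNorm q (gradEst (noisyOracle f δ) τ z w.2 w.1) ^ 2 ∂(sphereUniform m n).prod μ ≤
      secondMomentConst / 2 * (((m + n : ℕ) : ℝ) * aSq m n q) * ∫ ξ, L ξ ^ 2 ∂μ +
        2 * (((m + n : ℕ) : ℝ) ^ 2 * aSq m n q * Δ ^ 2 / τ ^ 2) := by
  have hnt := nontrivial_joint hd
  have hprob : IsProbabilityMeasure (sphereUniform m n) :=
    isProbabilityMeasure_unitSphereMeasure (E := Joint m n)
  have hΔ0 : 0 ≤ Δ := (abs_nonneg _).trans (hΔ z (subset_nbhd hτ.le hz))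
  have hint := integrable_ellNorm_gradEst_sq hd hτ hz hq hf (hL.const_mul (2 * τ))
    fun ξ e he => by
      have h := hfL ξ _ (add_smul_mem_nbhd hτ.le hz he.le) _ (sub_smul_mem_nbhd hτ.le hz he.le)
      rwa [norm_add_smul_sub_sub_smul hτ.le he, mul_comm] at h
  have hint₂ : Integrable (fun w : Joint m n × Ξ => ellNorm q w.1 ^ 2)
      ((sphereUniform m n).prod μ) :=
    Integrable.comp_fst (f := fun e : Joint m n => ellNorm q e ^ 2)
      (integrable_unitSphereMeasure_of_continuous ((continuous_ellNorm hq).pow 2)) μ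
  set B := ((m + n : ℕ) : ℝ) ^ 2 * Δ ^ 2 / τ ^ 2 with hB
  -- Bounded noise need not concentrate, so its contribution is estimated pointwise and keeps the
  -- full factor `d²`.
  have h1 : ∫ w, ellNorm q (gradEst (noisyOracle f δ) τ z w.2 w.1) ^ 2 ∂(sphereUniform m n).prod μ
      ≤ ∫ w, (2 * ellNorm q (gradEst f τ z w.2 w.1) ^ 2 + 2 * B * ellNorm q w.1 ^ 2)
        ∂(sphereUniform m n).prod μ := by
    refine integral_mono_of_nonneg (Filter.Eventually.of_forall fun _ => sq_nonneg _)
      ((hint.const_mul 2).add (hint₂.const_mul (2 * B))) ?_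
    filter_upwards [Measure.quasiMeasurePreserving_fst.ae
      (ae_unitSphereMeasure_norm (E := Joint m n))] with w hw
    have h1 := abs_le.1 (hΔ _ (add_smul_mem_nbhd hτ.le hz hw.le))
    have h2 := abs_le.1 (hΔ _ (sub_smul_mem_nbhd hτ.le hz hw.le))
    have h3 : (δ (z + τ • w.1) - δ (z - τ • w.1)) ^ 2 ≤ (2 * Δ) ^ 2 :=
      sq_le_sq' (by linarith) (by linarith)
    simp only [ellNorm_gradEst hq, mul_pow, sq_abs, noisyOracle]
    set s := f (z + τ • w.1) w.2 - f (z - τ • w.1) w.2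
    set t := δ (z + τ • w.1) - δ (z - τ • w.1)
    have h4 : (f (z + τ • w.1) w.2 + δ (z + τ • w.1) -
        (f (z - τ • w.1) w.2 + δ (z - τ • w.1))) ^ 2 ≤ 2 * s ^ 2 + 2 * (2 * Δ) ^ 2 := by
      have : f (z + τ • w.1) w.2 + δ (z + τ • w.1) -
        (f (z - τ • w.1) w.2 + δ (z - τ • w.1)) = s + t := by ring
      rw [this]
      nlinarith [sq_nonneg (s - t)]
    calc _ ≤ (((m + n : ℕ) : ℝ) / (2 * τ)) ^ 2 * (2 * s ^ 2 + 2 * (2 * Δ) ^ 2) *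
          ellNorm q w.1 ^ 2 := by gcongr
      _ = _ := by rw [hB]; field_simp
  have h2 : ∫ w : Joint m n × Ξ, ellNorm q w.1 ^ 2 ∂(sphereUniform m n).prod μ ≤ aSq m n q := by
    rw [integral_prod _ hint₂]
    simpa [sphereUniform_eq] using integral_ellNorm_sq_le_aSq hd hq
  have h3 := integral_ellNorm_gradEst_sq_le hd hτ hz hq hf hL hL0 hfL
  rw [integral_add (hint.const_mul 2) (hint₂.const_mul (2 * B)), integral_const_mul,
    integral_const_mul] at h1
  have h4 : 2 * B * ∫ w : Joint m n × Ξ, ellNorm q w.1 ^ 2 ∂(sphereUniform m n).prod μ ≤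
      2 * B * aSq m n q := by gcongr
  have h5 : 2 * B * aSq m n q = 2 * (((m + n : ℕ) : ℝ) ^ 2 * aSq m n q * Δ ^ 2 / τ ^ 2) := by
    rw [hB]; ring
  linarith

/-- The second moment of the gradient estimator with Lipschitz noise. -/
theorem integral_ellNorm_gradEst_sq_le_of_lipschitzNoise (hq : 1 ≤ q)
    (hf : Measurable fun w : Joint m n × Ξ => f w.1 w.2) (hL : MemLp L 2 μ) (hL0 : ∀ ξ, 0 ≤ L ξ)
    (hfL : ∀ ξ, ∀ z₁ ∈ nbhd Z τ, ∀ z₂ ∈ nbhd Z τ, |f z₁ ξ - f z₂ ξ| ≤ L ξ * ‖z₁ - z₂‖)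
    (hδ : Measurable δ) {Mδ : ℝ} (hMδ : 0 ≤ Mδ) (hδM : LipschitzNoise (nbhd Z τ) δ Mδ) :
    ∫ w, ellNorm q (gradEst (noisyOracle f δ) τ z w.2 w.1) ^ 2 ∂(sphereUniform m n).prod μ ≤
      secondMomentConst / 2 * (((m + n : ℕ) : ℝ) * aSq m n q) *
        (∫ ξ, L ξ ^ 2 ∂μ + Mδ ^ 2) := by
  have hL' : MemLp (fun ξ => L ξ + Mδ) 2 μ := hL.add (memLp_const Mδ)
  -- The noisy oracle is itself Lipschitz in `z`, with constant `L(ξ) + M_δ`, so concentration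
  -- covers the noise as well.
  have h1 := integral_ellNorm_gradEst_sq_le (φ := noisyOracle f δ) hd hτ hz hq
    (by simp only [noisyOracle]; fun_prop) hL' (fun ξ => add_nonneg (hL0 ξ) hMδ)
    fun ξ z₁ hz₁ z₂ hz₂ => by
      have h1 := hfL ξ z₁ hz₁ z₂ hz₂
      have h2 := hδM z₁ hz₁ z₂ hz₂
      simp only [noisyOracle]
      calc |f z₁ ξ + δ z₁ - (f z₂ ξ + δ z₂)| = |(f z₁ ξ - f z₂ ξ) + (δ z₁ - δ z₂)| := by
            congr 1; ring
        _ ≤ |f z₁ ξ - f z₂ ξ| + |δ z₁ - δ z₂| := abs_add_le _ _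
        _ ≤ (L ξ + Mδ) * ‖z₁ - z₂‖ := by rw [add_mul]; exact add_le_add h1 h2
  have h2 : ∫ ξ, (L ξ + Mδ) ^ 2 ∂μ ≤ 2 * (∫ ξ, L ξ ^ 2 ∂μ + Mδ ^ 2) := by
    have h := integral_mono (μ := μ) hL'.integrable_sq
      ((hL.integrable_sq.const_mul 2).add (integrable_const (2 * Mδ ^ 2))) fun ξ => by
        simp only [Pi.add_apply]
        nlinarith [sq_nonneg (L ξ - Mδ)]
    simp only [Pi.add_apply] at h
    rw [integral_add (hL.integrable_sq.const_mul 2) (integrable_const _), integral_const_mul] at h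
    simp only [integral_const, probReal_univ, one_smul] at h
    linarith
  have h3 : 0 ≤ secondMomentConst / 4 * (((m + n : ℕ) : ℝ) * aSq m n q) := by
    have := secondMomentConst_nonneg
    have := aSq_nonneg m n q
    positivity
  calc _ ≤ _ := h1
    _ ≤ secondMomentConst / 4 * (((m + n : ℕ) : ℝ) * aSq m n q) *
        (2 * (∫ ξ, L ξ ^ 2 ∂μ + Mδ ^ 2)) := by gcongr
    _ = _ := by ring

end Oracle

/-! ### From the convergence bound to the accuracy `ε`. -/

section Accuracy

/-- The optimization error for the step size `(D / Mc) √(2 / N)`. -/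
theorem stepSize_error_le {D Mc W ε η C K₁ K₂ G N : ℝ} (hD : 0 < D) (hMc : 0 < Mc) (hW : 0 < W)
    (hε : 0 < ε) (hη : 0 ≤ η) (hK₁ : 0 ≤ K₁) (hG : G ≤ K₁ * Mc ^ 2) (hK₂ : Mc ^ 2 ≤ K₂ * W)
    (hC : K₂ * (1 / 2 + K₁) ^ 2 ≤ 2 * C * η ^ 2) (hN : 1 ≤ N) (hCN : C * (W * D ^ 2 / ε ^ 2) ≤ N) :
    D ^ 2 / (2 * (D / Mc * √(2 / N)) * N) + D / Mc * √(2 / N) * G / 2 ≤ η * ε := by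
  have hN0 : 0 < N := by linarith
  set r := √(2 * N) with hr
  have hr0 : 0 < r := by positivity
  have hr2 : r ^ 2 = 2 * N := Real.sq_sqrt (by positivity)
  have h1 : √(2 / N) = 2 / r := by
    rw [Real.sqrt_eq_iff_mul_self_eq (by positivity) (by positivity)]
    rw [div_mul_div_comm, ← sq r, hr2]
    field_simp
  have h2 : D ^ 2 / (2 * (D / Mc * (2 / r)) * N) = D * Mc / r * (1 / 2) := by
    have : N = r ^ 2 / 2 := by linarith
    rw [this]
    field_simp
  have h3 : D / Mc * (2 / r) * G / 2 ≤ D * Mc / r * K₁ := by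
    calc D / Mc * (2 / r) * G / 2 ≤ D / Mc * (2 / r) * (K₁ * Mc ^ 2) / 2 := by gcongr
      _ = _ := by field_simp
  -- For this step size both error terms are multiples of `D Mc / √(2 N)`; squaring reduces the
  -- claim to the lower bound on `N`.
  have h4 : D * Mc / r * (1 / 2 + K₁) ≤ η * ε := by
    refine abs_le_of_sq_le_sq' ?_ (by positivity) |>.2
    have h5 : (D * Mc / r * (1 / 2 + K₁)) ^ 2 = D ^ 2 * Mc ^ 2 * (1 / 2 + K₁) ^ 2 / (2 * N) := by
      rw [mul_pow, div_pow, hr2]; ring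
    rw [h5, div_le_iff₀ (by positivity)]
    calc D ^ 2 * Mc ^ 2 * (1 / 2 + K₁) ^ 2 ≤ D ^ 2 * (K₂ * W) * (1 / 2 + K₁) ^ 2 := by gcongr
      _ = D ^ 2 * W * (K₂ * (1 / 2 + K₁) ^ 2) := by ring
      _ ≤ D ^ 2 * W * (2 * C * η ^ 2) := by gcongr
      _ = (η * ε) ^ 2 * (2 * (C * (W * D ^ 2 / ε ^ 2))) := by field_simp
      _ ≤ (η * ε) ^ 2 * (2 * N) := by gcongr
  rw [h1, h2]
  linarith

variable {m n : ℕ} {p q : ℝ≥0∞} {X : Set (EuclideanSpace ℝ (Fin m))}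
  {Y : Set (EuclideanSpace ℝ (Fin n))} {ω : Joint m n → ℝ} {Ξ : Type*} [MeasurableSpace Ξ]
  {φ φ' : Joint m n → Ξ → ℝ} {F : Joint m n → ℝ} {τ : ℝ} {xs : EuclideanSpace ℝ (Fin m)}
  {ys : EuclideanSpace ℝ (Fin n)} {Ω : Type*} [MeasurableSpace Ω] {P : Measure Ω}
  [IsProbabilityMeasure P] {μ : Measure Ξ} [IsProbabilityMeasure μ] {e : ℕ → Ω → Joint m n}
  {ξ : ℕ → Ω → Ξ}

theorem ae_forall_norm_eq_one (hd : 1 ≤ m + n) (hs : IsSampling P μ e ξ) :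
    ∀ᵐ s ∂P, ∀ k, ‖e k s‖ = 1 := by
  have hnt := nontrivial_joint hd
  refine ae_all_iff.2 fun k => ?_
  have h : ∀ᵐ w ∂(sphereUniform m n).prod μ, ‖w.1‖ = 1 :=
    Measure.quasiMeasurePreserving_fst.ae (ae_unitSphereMeasure_norm (E := Joint m n))
  rw [← hs.law k] at h
  exact ae_of_ae_map ((hs.measurable_e k).prodMk (hs.measurable_ξ k)).aemeasurable h

theorem iterate_congr {Z : Set (Joint m n)} (hω : DifferentiableOn ℝ ω Z) (hZ : IsCompact Z)
    (hne : Z.Nonempty) (hτ : 0 ≤ τ) (h : ∀ z ∈ nbhd Z τ, φ z = φ' z) (γ : ℕ → ℝ)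
    {e : ℕ → Joint m n} (he : ∀ k, ‖e k‖ = 1) (ξ : ℕ → Ξ) (k : ℕ) :
    iterate Z ω φ τ γ e ξ k = iterate Z ω φ' τ γ e ξ k := by
  induction k with
  | zero => rfl
  | succ k ih =>
    have hz : iterate Z ω φ' τ γ e ξ k ∈ Z := iterate_mem hω hZ hne γ e ξ k
    simp only [iterate, ih, gradEst]
    rw [h _ (add_smul_mem_nbhd hτ hz (he k).le), h _ (sub_smul_mem_nbhd hτ hz (he k).le)]

/-- The accuracy only depends on the values of the oracle at the possible query points. -/
theorem reachesAccuracy_congr (hd : 1 ≤ m + n) (hs : IsSampling P μ e ξ) {Z : Set (Joint m n)}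
    (hω : DifferentiableOn ℝ ω Z) (hZ : IsCompact Z) (hne : Z.Nonempty) (hτ : 0 ≤ τ)
    (h : ∀ z ∈ nbhd Z τ, φ z = φ' z) {γ : ℕ → ℝ} {N : ℕ} {ε : ℝ}
    (hacc : ReachesAccuracy P F xs ys ε
      (fun s => output Z ω φ' τ γ N (fun k => e k s) (fun k => ξ k s))) :
    ReachesAccuracy P F xs ys ε
      (fun s => output Z ω φ τ γ N (fun k => e k s) (fun k => ξ k s)) := by
  have heq : (fun s => saddleGap F xs ys
      (output Z ω φ' τ γ N (fun k => e k s) (fun k => ξ k s))) =ᵐ[P] fun s => saddleGap F xs ys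
      (output Z ω φ τ γ N (fun k => e k s) (fun k => ξ k s)) := by
    filter_upwards [ae_forall_norm_eq_one hd hs] with s hs
    simp only [output, iterate_congr hω hZ hne hτ h γ hs]
  exact ⟨hacc.1.congr heq, (integral_congr_ae heq).symm.trans_le hacc.2⟩

namespace IsSaddleSetup

variable {M : ℝ} {L : Ξ → ℝ} {f : Joint m n → Ξ → ℝ} {δ : Joint m n → ℝ}
  (S : IsSaddleSetup p q X Y ω F τ M xs ys)
include S

theorem reachesAccuracy_of_forall_le (hs : IsSampling P μ e ξ)
    (hφ : Measurable fun w : Joint m n × Ξ => φ w.1 w.2) {c ε : ℝ} (hc : c ≠ 0) {N : ℕ}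
    (hN : 1 ≤ N) (hε : ∀ z ∈ feasible X Y, saddleGap F xs ys z ≤ ε) :
    ReachesAccuracy P F xs ys ε (fun s =>
      output (feasible X Y) ω φ τ (fun _ => c) N (fun k => e k s) (fun k => ξ k s)) := by
  have hint := S.integrable_saddleGap_comp (P := P) (S.measurable_output hφ hs c N)
    fun s => S.output_mem hc hN _ _
  refine ⟨hint, ?_⟩
  have h := integral_mono hint (integrable_const ε) fun s => hε _ (S.output_mem hc hN _ _)
  simpa using h

theorem saddleGap_sub_le_integral (hM : 0 < M)
    (hf : Measurable fun w : Joint m n × Ξ => f w.1 w.2)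
    (hfi : ∀ z ∈ nbhd (feasible X Y) τ, Integrable (f z) μ)
    (hfF : ∀ z ∈ nbhd (feasible X Y) τ, meanObj μ f z = F z) (hL : MemLp L 2 μ)
    (hfL : ∀ ξ, ∀ z₁ ∈ nbhd (feasible X Y) τ, ∀ z₂ ∈ nbhd (feasible X Y) τ,
      |f z₁ ξ - f z₂ ξ| ≤ L ξ * ‖z₁ - z₂‖) (hδ : Measurable δ) {B b : ℝ}
    {z : Joint m n} (hz : z ∈ feasible X Y)
    (hB : ∀ e : Joint m n, ‖e‖ = 1 → |δ (z + τ • e) - δ (z - τ • e)| ≤ B)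
    (hb : -b ≤ twoPoint δ τ z (flipY (z - joint xs ys))) :
    saddleGap F xs ys z - (2 * τ * M + b) ≤
      ∫ w, inner ℝ (gradEst (noisyOracle f δ) τ z w.2 w.1) (z - joint xs ys)
        ∂(sphereUniform m n).prod μ := by
  have h1 := saddleGap_sub_le_twoPoint S.one_le_dim S.τ_pos S.lipschitz S.convexConcave hz
    S.saddle.1 S.saddle.2.1
  rw [Real.coe_toNNReal _ hM.le] at h1
  rw [integral_inner_gradEst S.one_le_dim S.τ_pos hz hf hfi hL hfL hδ hB,
    twoPoint_congr S.τ_pos.le hfF hz]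
  linarith

/-- Two distinct feasible points force the sign of the constant. -/
theorem lipschitz_nonneg {A : ℝ} {g : Joint m n → ℝ}
    (hg : ∀ z₁ ∈ nbhd (feasible X Y) τ, ∀ z₂ ∈ nbhd (feasible X Y) τ,
      |g z₁ - g z₂| ≤ A * ‖z₁ - z₂‖) : 0 ≤ A := by
  obtain ⟨z, hz, v, hv, hne⟩ := S.nontrivial
  have h := (abs_nonneg _).trans
    (hg z (subset_nbhd S.τ_pos.le hz) v (subset_nbhd S.τ_pos.le hv))
  exact nonneg_of_mul_nonneg_left h (norm_pos_iff.2 (sub_ne_zero.2 hne))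

/-- The accuracy of the method with bounded noise. -/
theorem reachesAccuracy_of_boundedNoise (hM : 0 < M) (hs : IsSampling P μ e ξ)
    (hf : Measurable fun w : Joint m n × Ξ => f w.1 w.2)
    (hfi : ∀ z ∈ nbhd (feasible X Y) τ, Integrable (f z) μ)
    (hfF : ∀ z ∈ nbhd (feasible X Y) τ, meanObj μ f z = F z) (hL : MemLp L 2 μ)
    (hLM : ∫ ξ, L ξ ^ 2 ∂μ ≤ M ^ 2)
    (hfL : ∀ ξ, ∀ z₁ ∈ nbhd (feasible X Y) τ, ∀ z₂ ∈ nbhd (feasible X Y) τ,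
      |f z₁ ξ - f z₂ ξ| ≤ L ξ * ‖z₁ - z₂‖) (hδ : Measurable δ)
    {Δ : ℝ} (hΔ : BoundedNoise (nbhd (feasible X Y) τ) δ Δ) (hp : p ≤ 2)
    {a b c κ η C ε : ℝ} (hb : 0 < b) (hc : 0 < c) (hκ : 0 < κ) (hκη : κ ≤ b * η) (hε : 0 < ε)
    (haη : 2 * a + 2 * η ≤ 1) (hη : 0 < η) (hτa : τ ≤ a * (ε / M)) (hτb : b * (ε / M) ≤ τ)
    (hΔκ : Δ ≤ κ * (ε ^ 2 / (omegaDiam (feasible X Y) ω * M * √((m + n : ℕ) : ℝ))))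
    (hC : (c + 2 * κ ^ 2 / b ^ 2) * (1 / 2 + (secondMomentConst / (2 * c) + 2)) ^ 2 ≤
      2 * C * η ^ 2) {N : ℕ} (hN : 1 ≤ N)
    (hCN : C * (((m + n : ℕ) : ℝ) * aSq m n q * M ^ 2 * omegaDiam (feasible X Y) ω ^ 2 / ε ^ 2)
      ≤ N) :
    ReachesAccuracy P F xs ys ε (fun s =>
      output (feasible X Y) ω (noisyOracle f δ) τ
        (stepSize (omegaDiam (feasible X Y) ω) (MBounded m n q c M Δ τ) N) N
        (fun k => e k s) (fun k => ξ k s)) := by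
  have hd := S.one_le_dim
  have hd0 : (0 : ℝ) < ((m + n : ℕ) : ℝ) := by exact_mod_cast hd
  have hτ := S.τ_pos
  have hpq := S.conj
  have hq : 1 ≤ q := S.conj.symm.one_le
  have hN0 : (0 : ℝ) < N := by exact_mod_cast hN
  have hD : 0 < omegaDiam (feasible X Y) ω := omegaDiam_pos S.conj.one_le S.prox S.nontrivial
  have hdist : ∀ z ∈ feasible X Y, ‖z - joint xs ys‖ ≤ omegaDiam (feasible X Y) ω := fun z hz =>
    (norm_le_ellNorm_of_le_two S.conj.one_le hp _).trans
      (ellNorm_sub_le_omegaDiam S.prox hz S.saddle_mem)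
  set D := omegaDiam (feasible X Y) ω with hDdef
  set d : ℝ := ((m + n : ℕ) : ℝ) with hddef
  have haq := aSq_pos hd hq
  have hsm := secondMomentConst_nonneg
  have hΔ0 : 0 ≤ Δ :=
    (abs_nonneg _).trans (hΔ (joint xs ys) (subset_nbhd hτ.le S.saddle_mem))
  have hMc2 : MBounded m n q c M Δ τ ^ 2 =
      c * d * aSq m n q * M ^ 2 + d ^ 2 * aSq m n q * Δ ^ 2 / τ ^ 2 :=
    Real.sq_sqrt (by positivity)
  have hMc : 0 < MBounded m n q c M Δ τ := Real.sqrt_pos.2 (by positivity)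
  set Mc := MBounded m n q c M Δ τ with hMcdef
  have hφ : Measurable fun w : Joint m n × Ξ => noisyOracle f δ w.1 w.2 := by
    simp only [noisyOracle]; fun_prop
  set γ := D / Mc * √(2 / (N : ℝ)) with hγ
  have hγ0 : 0 < γ := by positivity
  change ReachesAccuracy P F xs ys ε (fun s => output (feasible X Y) ω (noisyOracle f δ) τ
    (fun _ => γ) N (fun k => e k s) (fun k => ξ k s))
  have hsd : 0 < √d := Real.sqrt_pos.2 hd0
  -- The lower bound on `τ` enters here: bounded noise is amplified by `1 / τ`.
  have hΔτ : √d * Δ / τ ≤ κ * ε / (b * D) := by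
    rw [div_le_div_iff₀ hτ (by positivity)]
    have h1 : Δ * (D * M * √d) ≤ κ * ε ^ 2 := by
      rw [← mul_div_assoc, le_div_iff₀ (by positivity)] at hΔκ
      exact hΔκ
    have h2 : b * ε ≤ τ * M := by
      rw [← mul_div_assoc, div_le_iff₀ hM] at hτb
      exact hτb
    have h3 : M * (√d * Δ * (b * D)) ≤ M * (κ * ε * τ) := by
      calc M * (√d * Δ * (b * D)) = b * (Δ * (D * M * √d)) := by ring
        _ ≤ b * (κ * ε ^ 2) := by gcongr
        _ = κ * ε * (b * ε) := by ring
        _ ≤ κ * ε * (τ * M) := by gcongr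
        _ = _ := by ring
    exact le_of_mul_le_mul_left h3 hM
  -- If the feasible set is this small, every feasible point is accurate enough. Otherwise `ε < √2 M
  -- D`, which makes the noise part of `Mc²` at most a multiple of `d a_q² M²`.
  rcases le_or_gt (√2 * M * D) ε with hbig | hsmall
  · refine S.reachesAccuracy_of_forall_le hs hφ hγ0.ne' hN fun z hz => ?_
    refine (S.saddleGap_le hz).trans (le_trans ?_ hbig)
    gcongr
    exact hdist z hz
  refine ⟨S.integrable_saddleGap_comp (S.measurable_output hφ hs γ N)
    fun s => S.output_mem hγ0.ne' hN _ _, ?_⟩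
  have hL0 : ∀ ξ, 0 ≤ L ξ := fun ξ => S.lipschitz_nonneg (hfL ξ)
  have hLφ : MemLp (fun ξ => 2 * τ * L ξ + 2 * Δ) 2 μ :=
    (hL.const_mul (2 * τ)).add (memLp_const _)
  have hδ2 : ∀ z ∈ feasible X Y, ∀ e : Joint m n, ‖e‖ = 1 →
      |δ (z + τ • e) - δ (z - τ • e)| ≤ 2 * Δ := fun z hz e he => by
    have h1 := abs_le.1 (hΔ _ (add_smul_mem_nbhd hτ.le hz he.le))
    have h2 := abs_le.1 (hΔ _ (sub_smul_mem_nbhd hτ.le hz he.le))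
    exact abs_le.2 ⟨by linarith, by linarith⟩
  have key := S.integral_saddleGap_output_le hφ hs hLφ (c := γ) (N := N)
    (β := 2 * τ * M + κ * ε / b)
    (G := secondMomentConst / 2 * (d * aSq m n q) * M ^ 2 +
        2 * (d ^ 2 * aSq m n q * Δ ^ 2 / τ ^ 2))
    (fun z hz e he ξ => by
      have h1 := hfL ξ _ (add_smul_mem_nbhd hτ.le hz he.le) _ (sub_smul_mem_nbhd hτ.le hz he.le)
      rw [norm_add_smul_sub_sub_smul hτ.le he] at h1
      simp only [noisyOracle]
      calc |f (z + τ • e) ξ + δ (z + τ • e) - (f (z - τ • e) ξ + δ (z - τ • e))|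
          = |(f (z + τ • e) ξ - f (z - τ • e) ξ) + (δ (z + τ • e) - δ (z - τ • e))| := by
            congr 1; ring
        _ ≤ |f (z + τ • e) ξ - f (z - τ • e) ξ| + |δ (z + τ • e) - δ (z - τ • e)| :=
            abs_add_le _ _
        _ ≤ L ξ * (2 * τ) + 2 * Δ := add_le_add h1 (hδ2 z hz e he)
        _ = _ := by ring)
    (fun z hz => S.saddleGap_sub_le_integral hM hf hfi hfF hL hfL hδ hz (hδ2 z hz) (by
      refine le_trans ?_ (neg_le_twoPoint_of_boundedNoise hd hτ hz hΔ _)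
      rw [norm_flipY]
      refine neg_le_neg ?_
      calc √d * Δ / τ * ‖z - joint xs ys‖ ≤ κ * ε / (b * D) * D := by
            gcongr
            exact hdist z hz
        _ = κ * ε / b := by field_simp))
    (fun z hz => (integral_ellNorm_gradEst_sq_le_of_boundedNoise hd hτ hz hq hf hL hL0 hfL
      hΔ).trans (by gcongr))
    hγ0 hN
  refine key.trans ?_
  have hopt := stepSize_error_le (D := D) (Mc := Mc) (W := d * aSq m n q * M ^ 2) (ε := ε) (η := η)
    (K₁ := secondMomentConst / (2 * c) + 2) (K₂ := c + 2 * κ ^ 2 / b ^ 2) (N := N)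
    (G := secondMomentConst / 2 * (d * aSq m n q) * M ^ 2 +
        2 * (d ^ 2 * aSq m n q * Δ ^ 2 / τ ^ 2)) hD hMc (by positivity) hε hη.le (by positivity)
    (by
      rw [hMc2]
      set V := d ^ 2 * aSq m n q * Δ ^ 2 / τ ^ 2
      have hV : 0 ≤ V := by positivity
      have h1 : 0 ≤ secondMomentConst / (2 * c) * V := by positivity
      have h2 : 0 ≤ 2 * (c * d * aSq m n q * M ^ 2) := by positivity
      have h3 : secondMomentConst / (2 * c) * (c * d * aSq m n q * M ^ 2) =
        secondMomentConst / 2 * (d * aSq m n q) * M ^ 2 := by field_simp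
      linarith)
    (by
      rw [hMc2]
      have h1 : √d * Δ / τ ≤ κ * √2 * M / b := by
        refine hΔτ.trans ?_
        rw [div_le_div_iff₀ (by positivity) hb]
        calc κ * ε * b ≤ κ * (√2 * M * D) * b := by gcongr
          _ = _ := by ring
      have h2 := pow_le_pow_left₀ (by positivity) h1 2
      rw [div_pow, div_pow, mul_pow, mul_pow, mul_pow, Real.sq_sqrt hd0.le,
        Real.sq_sqrt (by norm_num)] at h2
      calc c * d * aSq m n q * M ^ 2 + d ^ 2 * aSq m n q * Δ ^ 2 / τ ^ 2
          = c * d * aSq m n q * M ^ 2 + d * aSq m n q * (d * Δ ^ 2 / τ ^ 2) := by ring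
        _ ≤ c * d * aSq m n q * M ^ 2 + d * aSq m n q * (κ ^ 2 * 2 * M ^ 2 / b ^ 2) := by gcongr
        _ = _ := by ring)
    hC (by exact_mod_cast hN) hCN
  have hτM : τ * M ≤ a * ε := by
    rw [← mul_div_assoc, le_div_iff₀ hM] at hτa
    exact hτa
  have hκb : κ * ε / b ≤ η * ε := by
    rw [div_le_iff₀ hb]
    calc κ * ε ≤ b * η * ε := by gcongr
      _ = _ := by ring
  have hfin : (2 * a + 2 * η) * ε ≤ 1 * ε := by gcongr
  linarith

/-- The accuracy of the method with Lipschitz noise. -/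
theorem reachesAccuracy_of_lipschitzNoise (hM : 0 < M) (hs : IsSampling P μ e ξ)
    (hf : Measurable fun w : Joint m n × Ξ => f w.1 w.2)
    (hfi : ∀ z ∈ nbhd (feasible X Y) τ, Integrable (f z) μ)
    (hfF : ∀ z ∈ nbhd (feasible X Y) τ, meanObj μ f z = F z) (hL : MemLp L 2 μ)
    (hLM : ∫ ξ, L ξ ^ 2 ∂μ ≤ M ^ 2)
    (hfL : ∀ ξ, ∀ z₁ ∈ nbhd (feasible X Y) τ, ∀ z₂ ∈ nbhd (feasible X Y) τ,
      |f z₁ ξ - f z₂ ξ| ≤ L ξ * ‖z₁ - z₂‖) (hδ : Measurable δ)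
    {Mδ : ℝ} (hδM : LipschitzNoise (nbhd (feasible X Y) τ) δ Mδ)
    {a c κ η C ε : ℝ} (hc : 0 < c) (hκ : 0 < κ) (hκη : κ ≤ η) (hε : 0 < ε)
    (haη : 2 * a + 2 * η ≤ 1) (hη : 0 < η) (hτa : τ ≤ a * (ε / M))
    (hδκ : Mδ ≤ κ * (ε / (omegaDiam (feasible X Y) ω * √((m + n : ℕ) : ℝ))))
    (hC : (c * (1 + 2 * κ ^ 2)) * (1 / 2 + secondMomentConst / (2 * c)) ^ 2 ≤
      2 * C * η ^ 2) {N : ℕ} (hN : 1 ≤ N)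
    (hCN : C * (((m + n : ℕ) : ℝ) * aSq m n q * M ^ 2 * omegaDiam (feasible X Y) ω ^ 2 / ε ^ 2)
      ≤ N) :
    ReachesAccuracy P F xs ys ε (fun s =>
      output (feasible X Y) ω (noisyOracle f δ) τ
        (stepSize (omegaDiam (feasible X Y) ω) (MLipschitz m n q c M Mδ) N) N
        (fun k => e k s) (fun k => ξ k s)) := by
  have hd := S.one_le_dim
  have hd0 : (0 : ℝ) < ((m + n : ℕ) : ℝ) := by exact_mod_cast hd
  have hτ := S.τ_pos
  have hpq := S.conj
  have hq : 1 ≤ q := S.conj.symm.one_le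
  have hN0 : (0 : ℝ) < N := by exact_mod_cast hN
  have hD : 0 < omegaDiam (feasible X Y) ω := omegaDiam_pos S.conj.one_le S.prox S.nontrivial
  -- Here `p` is arbitrary, so the Euclidean diameter is bounded only by `√d D`; the `√d` in the
  -- condition on the noise compensates for this.
  have hdist : ∀ z ∈ feasible X Y,
      ‖z - joint xs ys‖ ≤ √((m + n : ℕ) : ℝ) * omegaDiam (feasible X Y) ω := fun z hz =>
    (norm_le_sqrt_mul_ellNorm S.conj.one_le _).trans
      (by gcongr; exact ellNorm_sub_le_omegaDiam S.prox hz S.saddle_mem)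
  set D := omegaDiam (feasible X Y) ω with hDdef
  set d : ℝ := ((m + n : ℕ) : ℝ) with hddef
  have haq := aSq_pos hd hq
  have hsm := secondMomentConst_nonneg
  have hMδ0 : 0 ≤ Mδ := S.lipschitz_nonneg hδM
  have hMc2 : MLipschitz m n q c M Mδ ^ 2 = c * d * aSq m n q * (M ^ 2 + Mδ ^ 2) :=
    Real.sq_sqrt (by positivity)
  have hMc : 0 < MLipschitz m n q c M Mδ := Real.sqrt_pos.2 (by positivity)
  set Mc := MLipschitz m n q c M Mδ with hMcdef
  have hφ : Measurable fun w : Joint m n × Ξ => noisyOracle f δ w.1 w.2 := by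
    simp only [noisyOracle]; fun_prop
  set γ := D / Mc * √(2 / (N : ℝ)) with hγ
  have hγ0 : 0 < γ := by positivity
  change ReachesAccuracy P F xs ys ε (fun s => output (feasible X Y) ω (noisyOracle f δ) τ
    (fun _ => γ) N (fun k => e k s) (fun k => ξ k s))
  have hsd : 0 < √d := Real.sqrt_pos.2 hd0
  have hδD : Mδ * (√d * D) ≤ κ * ε := by
    rw [← mul_div_assoc, le_div_iff₀ (by positivity)] at hδκ
    linarith
  -- The same dichotomy with `√d D` as the diameter; in the second case it yields `Mδ ≤ κ √2 M`.
  rcases le_or_gt (√2 * M * (√d * D)) ε with hbig | hsmall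
  · refine S.reachesAccuracy_of_forall_le hs hφ hγ0.ne' hN fun z hz => ?_
    refine (S.saddleGap_le hz).trans (le_trans ?_ hbig)
    gcongr
    exact hdist z hz
  refine ⟨S.integrable_saddleGap_comp (S.measurable_output hφ hs γ N)
    fun s => S.output_mem hγ0.ne' hN _ _, ?_⟩
  have hL0 : ∀ ξ, 0 ≤ L ξ := fun ξ => S.lipschitz_nonneg (hfL ξ)
  have hLφ : MemLp (fun ξ => 2 * τ * L ξ + Mδ * (2 * τ)) 2 μ :=
    (hL.const_mul (2 * τ)).add (memLp_const _)
  have hδ2 : ∀ z ∈ feasible X Y, ∀ e : Joint m n, ‖e‖ = 1 →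
      |δ (z + τ • e) - δ (z - τ • e)| ≤ Mδ * (2 * τ) := fun z hz e he => by
    have h1 := hδM _ (add_smul_mem_nbhd hτ.le hz he.le) _ (sub_smul_mem_nbhd hτ.le hz he.le)
    rwa [norm_add_smul_sub_sub_smul hτ.le he] at h1
  have hδlip : LipschitzOnWith Mδ.toNNReal δ (nbhd (feasible X Y) τ) := by
    refine LipschitzOnWith.of_dist_le_mul fun x hx y hy => ?_
    rw [Real.coe_toNNReal _ hMδ0, Real.dist_eq, dist_eq_norm]
    exact hδM x hx y hy
  have key := S.integral_saddleGap_output_le hφ hs hLφ (c := γ) (N := N)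
    (β := 2 * τ * M + κ * ε)
    (G := secondMomentConst / 2 * (d * aSq m n q) * (M ^ 2 + Mδ ^ 2))
    (fun z hz e he ξ => by
      have h1 := hfL ξ _ (add_smul_mem_nbhd hτ.le hz he.le) _ (sub_smul_mem_nbhd hτ.le hz he.le)
      rw [norm_add_smul_sub_sub_smul hτ.le he] at h1
      simp only [noisyOracle]
      calc |f (z + τ • e) ξ + δ (z + τ • e) - (f (z - τ • e) ξ + δ (z - τ • e))|
          = |(f (z + τ • e) ξ - f (z - τ • e) ξ) + (δ (z + τ • e) - δ (z - τ • e))| := by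
            congr 1; ring
        _ ≤ |f (z + τ • e) ξ - f (z - τ • e) ξ| + |δ (z + τ • e) - δ (z - τ • e)| :=
            abs_add_le _ _
        _ ≤ L ξ * (2 * τ) + Mδ * (2 * τ) := add_le_add h1 (hδ2 z hz e he)
        _ = _ := by ring)
    (fun z hz => S.saddleGap_sub_le_integral hM hf hfi hfF hL hfL hδ hz (hδ2 z hz) (by
      refine le_trans ?_ (neg_mul_norm_le_twoPoint hd hτ hδlip hz _)
      rw [norm_flipY, Real.coe_toNNReal _ hMδ0]
      refine neg_le_neg (le_trans ?_ hδD)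
      gcongr
      exact hdist z hz))
    (fun z hz => (integral_ellNorm_gradEst_sq_le_of_lipschitzNoise hd hτ hz hq hf hL hL0 hfL
      hδ hMδ0 hδM).trans (by gcongr))
    hγ0 hN
  refine key.trans ?_
  have hopt := stepSize_error_le (D := D) (Mc := Mc) (W := d * aSq m n q * M ^ 2) (ε := ε) (η := η)
    (K₁ := secondMomentConst / (2 * c)) (K₂ := c * (1 + 2 * κ ^ 2)) (N := N)
    (G := secondMomentConst / 2 * (d * aSq m n q) * (M ^ 2 + Mδ ^ 2)) hD hMc (by positivity) hε
    hη.le (by positivity)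
    (by rw [hMc2]; refine le_of_eq ?_; field_simp)
    (by
      rw [hMc2]
      have h1 : Mδ ≤ κ * √2 * M := by
        refine le_of_mul_le_mul_right (a := √d * D) ?_ (by positivity)
        calc Mδ * (√d * D) ≤ κ * ε := hδD
          _ ≤ κ * (√2 * M * (√d * D)) := by gcongr
          _ = _ := by ring
      have h2 := pow_le_pow_left₀ hMδ0 h1 2
      rw [mul_pow, mul_pow, Real.sq_sqrt (by norm_num)] at h2
      calc c * d * aSq m n q * (M ^ 2 + Mδ ^ 2)
          ≤ c * d * aSq m n q * (M ^ 2 + κ ^ 2 * 2 * M ^ 2) := by gcongr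
        _ = _ := by ring)
    hC (by exact_mod_cast hN) hCN
  have hτM : τ * M ≤ a * ε := by
    rw [← mul_div_assoc, le_div_iff₀ hM] at hτa
    exact hτa
  have hκb : κ * ε ≤ η * ε := by gcongr
  have hfin : (2 * a + 2 * η) * ε ≤ 1 * ε := by gcongr
  linarith

end IsSaddleSetup

end Accuracy

end

/-! ### The choice of constants and the reduction to measurable data. -/

theorem corollary1 :
    -- the size of `a_q²`
    (∃ K : ℝ, 0 < K ∧ ∀ (m n : ℕ) (q : ℝ≥0∞), 2 ≤ m + n → 1 ≤ q →
      aSq m n q ≤ K * (min q (ENNReal.ofReal (Real.log ((m + n : ℕ) : ℝ)))).toReal *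
        ((m + n : ℕ) : ℝ) ^ (2 * (q⁻¹).toReal - 1)) ∧
    -- the noise level and the number of iterations
    ∀ c a b : ℝ, 0 < c → 0 < b → b ≤ a → a < 1 / 2 →
      ∃ κ C : ℝ, 0 < κ ∧ 0 < C ∧
        ∀ (m n : ℕ) (p q : ℝ≥0∞), ENNReal.HolderConjugate p q →
        ∀ (X : Set (EuclideanSpace ℝ (Fin m))) (Y : Set (EuclideanSpace ℝ (Fin n))),
          IsCompact X → Convex ℝ X → IsCompact Y → Convex ℝ Y →
          (feasible X Y).Nontrivial →
        ∀ (ω : Joint m n → ℝ), IsProxFunction p (feasible X Y) ω →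
        ∀ (Ξ : Type*) [MeasurableSpace Ξ] (μ : Measure Ξ) [IsProbabilityMeasure μ]
          (f : Joint m n → Ξ → ℝ) (δ : Joint m n → ℝ) (ε M τ : ℝ),
          0 < ε → 0 < M → 0 < τ → τ ≤ a * (ε / M) →
          (∀ z ∈ nbhd (feasible X Y) τ, Measurable (f z) ∧ Integrable (f z) μ) →
          LipschitzObjective μ (nbhd (feasible X Y) τ) f M →
          ConvexConcaveOn (nbhd (feasible X Y) τ) (meanObj μ f) →
        ∀ (xs : EuclideanSpace ℝ (Fin m)) (ys : EuclideanSpace ℝ (Fin n)),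
          IsSaddlePoint X Y (meanObj μ f) xs ys →
        ∀ (Ω : Type*) [MeasurableSpace Ω] (P : Measure Ω) [IsProbabilityMeasure P]
          (e : ℕ → Ω → Joint m n) (ξ : ℕ → Ω → Ξ), IsSampling P μ e ξ →
        ∀ N : ℕ, 1 ≤ N →
          C * (((m + n : ℕ) : ℝ) * aSq m n q * M ^ 2 * omegaDiam (feasible X Y) ω ^ 2 / ε ^ 2)
            ≤ N →
          -- bounded noise
          (∀ Δ : ℝ, p ≤ 2 → b * (ε / M) ≤ τ → Measurable δ →
            BoundedNoise (nbhd (feasible X Y) τ) δ Δ →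
            Δ ≤ κ * (ε ^ 2 /
              (omegaDiam (feasible X Y) ω * M * √((m + n : ℕ) : ℝ))) →
            ReachesAccuracy P (meanObj μ f) xs ys ε (fun s =>
              output (feasible X Y) ω (noisyOracle f δ) τ
                (stepSize (omegaDiam (feasible X Y) ω) (MBounded m n q c M Δ τ) N) N
                (fun k => e k s) (fun k => ξ k s))) ∧
          -- Lipschitz noise
          (∀ Mδ : ℝ, LipschitzNoise (nbhd (feasible X Y) τ) δ Mδ →
            Mδ ≤ κ * (ε / (omegaDiam (feasible X Y) ω * √((m + n : ℕ) : ℝ))) →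
            ReachesAccuracy P (meanObj μ f) xs ys ε (fun s =>
              output (feasible X Y) ω (noisyOracle f δ) τ
                (stepSize (omegaDiam (feasible X Y) ω) (MLipschitz m n q c M Mδ) N) N
                (fun k => e k s) (fun k => ξ k s))) := by
  refine ⟨aSq_le, ?_⟩
  intro c a b hc hb hba ha
  -- `η` is half of the slack left by the smoothing bias `2 a ε`: one share for the bias of the
  -- noise, one for the optimization error.
  obtain ⟨η, hη, haη⟩ : ∃ η : ℝ, 0 < η ∧ 2 * a + 2 * η ≤ 1 :=
    ⟨(1 - 2 * a) / 2, by linarith, by linarith⟩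
  have hκ : 0 < b * η := mul_pos hb hη
  have hκη : b * η ≤ η := mul_le_of_le_one_left hη.le (by linarith)
  have hsm := secondMomentConst_nonneg
  -- The bias of bounded noise is at most `κ ε / b` and that of Lipschitz noise at most `κ ε`. Since
  -- `b < 1`, both are at most `η ε`.
  set κ := b * η with hκdef
  set K₁ := (c + 2 * κ ^ 2 / b ^ 2) * (1 / 2 + (secondMomentConst / (2 * c) + 2)) ^ 2 with hK₁
  set K₂ := (c * (1 + 2 * κ ^ 2)) * (1 / 2 + secondMomentConst / (2 * c)) ^ 2 with hK₂
  have hK₁0 : 0 < K₁ := by positivity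
  have hK₂0 : 0 < K₂ := by positivity
  have hC : 2 * ((K₁ + K₂) / (2 * η ^ 2)) * η ^ 2 = K₁ + K₂ := by field_simp
  -- The sum of the constants required by the two noise models serves both.
  refine ⟨κ, (K₁ + K₂) / (2 * η ^ 2), hκ, by positivity, ?_⟩
  intro m n p q hpq X Y hX hXc hY hYc hne ω hω Ξ _ μ _ f δ ε M τ hε hM hτ hτa hf hLip hcc xs ys
    hsad Ω _ P _ e ξ hs N hN hCN
  obtain ⟨L, hL, hLM, hfL⟩ := hLip
  have S : IsSaddleSetup p q X Y ω (meanObj μ f) τ M xs ys :=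
    { conj := hpq, compact_X := hX, convex_X := hXc, compact_Y := hY, convex_Y := hYc
      nontrivial := hne, prox := hω, τ_pos := hτ, K_nonneg := hM.le
      lipschitz := lipschitzOnWith_meanObj hM.le (fun z hz => (hf z hz).2) hL hLM hfL
      convexConcave := hcc, saddle := hsad }
  have hmeas : MeasurableSet (nbhd (feasible X Y) τ) := (isClosed_nbhd S.compact τ).measurableSet
  -- The objective is measurable only in `ξ` for each fixed `z`, and only on the neighbourhood. A
  -- jointly measurable function with the same values there yields almost surely the same iterates.
  obtain ⟨f', hf'm, hf'⟩ := exists_measurable_extension hmeas (fun z hz => (hf z hz).1) hfL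
  have hf'i : ∀ z ∈ nbhd (feasible X Y) τ, Integrable (f' z) μ := fun z hz => by
    rw [hf' z hz]; exact (hf z hz).2
  have hf'F : ∀ z ∈ nbhd (feasible X Y) τ, meanObj μ f' z = meanObj μ f z := fun z hz => by
    simp only [meanObj, hf' z hz]
  have hf'L : ∀ ξ, ∀ z₁ ∈ nbhd (feasible X Y) τ, ∀ z₂ ∈ nbhd (feasible X Y) τ,
      |f' z₁ ξ - f' z₂ ξ| ≤ L ξ * ‖z₁ - z₂‖ := fun ξ z₁ hz₁ z₂ hz₂ => by
    rw [hf' z₁ hz₁, hf' z₂ hz₂]; exact hfL ξ z₁ hz₁ z₂ hz₂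
  constructor
  · intro Δ hp hτb hδ hΔ hΔκ
    refine reachesAccuracy_congr S.one_le_dim hs hω.differentiableOn S.compact hne.nonempty hτ.le
      (φ' := noisyOracle f' δ) (fun z hz => ?_) ?_
    · ext ξ; simp only [noisyOracle, hf' z hz]
    · exact S.reachesAccuracy_of_boundedNoise hM hs hf'm hf'i hf'F hL hLM hf'L hδ hΔ hp hb hc hκ
        le_rfl hε haη hη hτa hτb hΔκ (by rw [hC]; linarith) hN hCN
  · intro Mδ hδM hδκ
    -- Lipschitz noise is measurable on the neighbourhood but arbitrary outside it; the same
    -- extension lemma, with a one-point sample space, repairs this.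
    obtain ⟨δ', hδ'm, hδ'⟩ := exists_measurable_extension (Ξ := Unit) (f := fun z _ => δ z)
      (L := fun _ => Mδ) hmeas (fun z _ => measurable_const) fun _ => hδM
    have hδ'' : ∀ z ∈ nbhd (feasible X Y) τ, δ' z () = δ z := fun z hz => by rw [hδ' z hz]
    have hδ'm' : Measurable fun z => δ' z () :=
      hδ'm.comp (f := fun z : Joint m n => (z, ())) (by fun_prop)
    have hδ'M : LipschitzNoise (nbhd (feasible X Y) τ) (fun z => δ' z ()) Mδ :=
      fun z₁ hz₁ z₂ hz₂ => by
        simp only [hδ'' z₁ hz₁, hδ'' z₂ hz₂]; exact hδM z₁ hz₁ z₂ hz₂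
    refine reachesAccuracy_congr S.one_le_dim hs hω.differentiableOn S.compact hne.nonempty hτ.le
      (φ' := noisyOracle f' fun z => δ' z ()) (fun z hz => ?_) ?_
    · ext ξ; simp only [noisyOracle, hf' z hz, hδ'' z hz]
    · exact S.reachesAccuracy_of_lipschitzNoise hM hs hf'm hf'i hf'F hL hLM hf'L hδ'm' hδ'M hc hκ
        hκη hε haη hη hτa hδκ (by rw [hC]; linarith) hN hCN
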